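/- Let $v$ be an indeterminate. Let $\mathcal H_n$ ($n\ge 0$) be the Hecke algebra of $\mathfrak S_n$ over $\mathbb C(v)$: it is generated by $T_1,\dots,T_{n-1}$ with relations $(T_k-v)(T_k+1)=0$, $T_kT_{k+1}T_k=T_{k+1}T_kT_{k+1}$, and $T_kT_l=T_lT_k$ for $|k-l|>1$. Put $T_w=T_{i_1}\cdots T_{i_r}$ for a reduced expression $w=s_{i_1}\cdots s_{i_r}$, and let $\ell(w)$ be the length of $w$. For a partition $\lambda=(\lambda_1,\lambda_2,\dots)$ of $n$ with $\ell(\lambda)$ parts, let $w_\lambda=(1,\dots,\lambda_1)(\lambda_1+1,\dots,\lambda_1+\lambda_2)\cdots$, let $c_\lambda\in\mathbb C\mathfrak S_n$ be the sum of all permutations of cycle type $\lambda$, and let $z_\lambda=\prod_{i\ge1}i^{m_i}m_i!$, where $m_i$ is the multiplicity of $i$ in $\lambda$. Let $\Lambda$ be the ring of symmetric functions over $\mathbb C$ in $x=\{x_1,x_2,\dots\}$, with monomial symmetric functions $m_\lambda$ and power sums $p_k$, $p_\lambda=\prod_i p_{\lambda_i}$, and let $\Lambda_v=\mathbb C(v)\otimes_{\mathbb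 C}\Lambda$. An element $a\in\mathbb C(v)$ is called regular if it has no pole at $v=1$; its value there is $a(1)$. (1) Every $F\in\Lambda_v$ is in exactly one way a polynomial over $\mathbb C(v)$ in $p_1,p_2,\dots$. Let $F\big(\tfrac{x}{v-1}\big)$ denote the result of replacing each $p_k$ by $p_k/(v^k-1)$ in this polynomial. (2) For each $n$ there is exactly one family $f_{w,\lambda}\in\mathbb Z[v,v^{-1}]$ ($w\in\mathfrak S_n$, $\lambda$ a partition of $n$) with $T_w\equiv\sum_\lambda f_{w,\lambda}T_{w_\lambda}$ modulo the span $[\mathcal H_n,\mathcal H_n]$ of the commutators. Put $f^*_\lambda=\sum_{w\in\mathfrak S_n}v^{-\ell(w)}f_{w,\lambda}T_{w^{-1}}$. (3) All $f^*_\lambda$ are central, and there is exactly one $\mathbb C(v)$-linear map $\Psi:\bigoplus_{n\ge0}\mathcal Z(\mathcal H_n)\to\Lambda_v$ (the quantum Frobenius map) with $\Psi(f^*_\lambda)=(v-1)^{\ell(\lambda)}m_\lambda\big(\tfrac{x}{v-1}\big)$ for all partitions $\lambda$. All $c_\lambda$ are central, and there is exactly one $\mathbb C$-linear map $\psi:\bigoplus_{n\ge0}\mathcal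 Z(\mathbb C\mathfrak S_n)\to\Lambda$ (the classical Frobenius map) with $\psi(c_\lambda)=p_\lambda/z_\lambda$ for all partitions $\lambda$. (4) The specialization of $\Psi$ at $v=1$ is $\psi$, in the following sense. Say that $h\in\mathcal H_n$ specializes to $c\in\mathbb C\mathfrak S_n$ if $h=\sum_w a_wT_w$ and $c=\sum_w a_w(1)\,w$ with all $a_w$ regular; that an element of $\bigoplus_n\mathcal Z(\mathcal H_n)$ specializes to an element of $\bigoplus_n\mathcal Z(\mathbb C\mathfrak S_n)$ if it does so in every degree; and that $F\in\Lambda_v$ specializes to $g\in\Lambda$ if $F=\sum_i a_i\otimes f_i$ and $g=\sum_i a_i(1)f_i$ for finitely many regular $a_i$ and $f_i\in\Lambda$. Then every $z\in\bigoplus_n\mathcal Z(\mathcal H_n)$ whose components are combinations of the $T_w$ with regular coefficients specializes to exactly one $c\in\bigoplus_n\mathcal Z(\mathbb C\mathfrak S_n)$; every $c\in\bigoplus_n\mathcal Z(\mathbb C\mathfrak S_n)$ arises in this way; $f^*_\lambda$ specializes to $c_\lambda$ for every $\lambda$; and whenever $z$ specializes to $c$, the symmetric function $\Psi(z)$ specializes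 to $\psi(c)$ and to no other element of $\Lambda$. -/

import Mathlib

open scoped TensorProduct

noncomputable section

namespace HeckeFrobenius

/-! ### The symmetric group: words, length, cycle types -/

/-- The simple transposition `s_i` of the symmetric group on `Fin n`, exchanging the `i`-th and
the `(i+1)`-st letter (letters and generators are numbered from `0`). -/
def simpleSwap (n : ℕ) (i : Fin (n - 1)) : Equiv.Perm (Fin n) :=
  Equiv.swap ⟨i, by omega⟩ ⟨i + 1, by omega⟩

/-- The permutation `s_{i_1} ⋯ s_{i_r}` of a word `[i_1, …, i_r]`. -/
def wordPerm (n : ℕ) (l : List (Fin (n - 1))) : Equiv.Perm (Fin n) :=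
  (l.map (simpleSwap n)).prod

/-- `l` is a reduced expression of `w`: it represents `w` and no shorter word does. -/
def IsReducedWord (n : ℕ) (w : Equiv.Perm (Fin n)) (l : List (Fin (n - 1))) : Prop :=
  wordPerm n l = w ∧ ∀ l', wordPerm n l' = w → l.length ≤ l'.length

theorem exists_word (n : ℕ) (w : Equiv.Perm (Fin n)) : ∃ l, wordPerm n l = w := by
  cases n with
  | zero => exact ⟨[], Subsingleton.elim _ _⟩
  | succ n =>
    have h : w ∈ Submonoid.closure
        (Set.range fun i : Fin n => Equiv.swap i.castSucc i.succ) := by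
      rw [Equiv.Perm.mclosure_swap_castSucc_succ]; trivial
    induction h using Submonoid.closure_induction with
    | mem x hx =>
      obtain ⟨i, rfl⟩ := hx
      refine ⟨[i], ?_⟩
      simp only [wordPerm, simpleSwap, List.map_cons, List.map_nil, List.prod_singleton]
      rfl
    | one => exact ⟨[], rfl⟩
    | mul x y _ _ hx hy =>
      obtain ⟨a, rfl⟩ := hx
      obtain ⟨b, rfl⟩ := hy
      exact ⟨a ++ b, by simp [wordPerm]⟩

theorem exists_reducedWord (n : ℕ) (w : Equiv.Perm (Fin n)) : ∃ l, IsReducedWord n w l := by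
  classical
  have h : ∃ k, ∃ l, wordPerm n l = w ∧ l.length = k := by
    obtain ⟨l, hl⟩ := exists_word n w
    exact ⟨l.length, l, hl, rfl⟩
  obtain ⟨l, hl, hk⟩ := Nat.find_spec h
  exact ⟨l, hl, fun l' hl' => hk ▸ Nat.find_min' h ⟨l', hl', rfl⟩⟩

/-- A chosen reduced expression of `w`. -/
def reducedWord (n : ℕ) (w : Equiv.Perm (Fin n)) : List (Fin (n - 1)) :=
  (exists_reducedWord n w).choose

/-- The length `ℓ(w)`. -/
def permLength (n : ℕ) (w : Equiv.Perm (Fin n)) : ℕ := (reducedWord n w).length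

/-- The partition `lam`, with its parts in decreasing order, as a composition of `n`. -/
def partComposition {n : ℕ} (lam : n.Partition) : Composition n where
  blocks := lam.parts.sort (· ≥ ·)
  blocks_pos := fun h => lam.parts_pos ((Multiset.mem_sort _).1 h)
  blocks_sum := by
    rw [← Multiset.sum_coe, Multiset.sort_eq, lam.parts_sum]

/-- The permutation
`w_lam = (1, …, lam_1)(lam_1 + 1, …, lam_1 + lam_2) ⋯`: it rotates each of the consecutive blocks
of letters of sizes `lam_1 ≥ lam_2 ≥ ⋯` by one step. -/
def cyclePerm {n : ℕ} (lam : n.Partition) : Equiv.Perm (Fin n) :=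
  (partComposition lam).blocksFinEquiv.permCongr
    (Equiv.sigmaCongrRight fun i => finRotate ((partComposition lam).blocksFun i))

/-- The class sum `c_lam` in the complex group algebra of the symmetric group: the sum of all
permutations of cycle type `lam` (fixed points counted as parts equal to `1`). -/
def classSum {n : ℕ} (lam : n.Partition) : MonoidAlgebra ℂ (Equiv.Perm (Fin n)) :=
  ∑ w : Equiv.Perm (Fin n) with w.partition.parts = lam.parts, MonoidAlgebra.of ℂ _ w

/-- `z_lam = ∏ i ^ m_i * m_i !`, where `m_i` is the multiplicity of `i` in `lam`. -/
def zNum {n : ℕ} (lam : n.Partition) : ℕ :=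
  ∏ i ∈ lam.parts.toFinset, i ^ lam.parts.count i * (lam.parts.count i).factorial

/-- The number of parts `ℓ(lam)`. -/
def partLength {n : ℕ} (lam : n.Partition) : ℕ := Multiset.card lam.parts

/-! ### The Hecke algebra over `ℂ(v)` -/

/-- The field `ℂ(v)`. -/
abbrev Cv : Type := RatFunc ℂ

/-- The indeterminate `v`. -/
def v : Cv := RatFunc.X

/-- The defining relations of the Hecke algebra. -/
inductive HeckeRel (n : ℕ) :
    FreeAlgebra Cv (Fin (n - 1)) → FreeAlgebra Cv (Fin (n - 1)) → Prop
  | quad (k : Fin (n - 1)) :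
      HeckeRel n
        ((FreeAlgebra.ι Cv k - algebraMap Cv _ v) * (FreeAlgebra.ι Cv k + 1)) 0
  | braid (k l : Fin (n - 1)) (h : (k : ℕ) + 1 = l) :
      HeckeRel n
        (FreeAlgebra.ι Cv k * FreeAlgebra.ι Cv l * FreeAlgebra.ι Cv k)
        (FreeAlgebra.ι Cv l * FreeAlgebra.ι Cv k * FreeAlgebra.ι Cv l)
  | comm (k l : Fin (n - 1)) (h : (k : ℕ) + 1 < l ∨ (l : ℕ) + 1 < k) :
      HeckeRel n
        (FreeAlgebra.ι Cv k * FreeAlgebra.ι Cv l)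
        (FreeAlgebra.ι Cv l * FreeAlgebra.ι Cv k)

/-- The Hecke algebra `H_n`, by generators and relations. -/
abbrev Hecke (n : ℕ) : Type := RingQuot (HeckeRel n)

/-- The generator `T_i`. -/
def heckeGen (n : ℕ) (i : Fin (n - 1)) : Hecke n :=
  RingQuot.mkAlgHom Cv (HeckeRel n) (FreeAlgebra.ι Cv i)

/-- `T_w = T_{i_1} ⋯ T_{i_r}` for a reduced expression of `w`. -/
def heckeT (n : ℕ) (w : Equiv.Perm (Fin n)) : Hecke n :=
  ((reducedWord n w).map (heckeGen n)).prod

/-- The span `[H_n, H_n]` of all commutators. -/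
def commutators (n : ℕ) : Submodule Cv (Hecke n) :=
  Submodule.span Cv (Set.range fun p : Hecke n × Hecke n => p.1 * p.2 - p.2 * p.1)

/-- The defining property of the family `f_{w, lam}`: its values are Laurent polynomials in `v`
with integer coefficients, and `T_w` is congruent to `∑ f_{w, lam} T_{w_lam}` modulo
commutators. -/
def IsClassPolynomialFamily (n : ℕ) (f : Equiv.Perm (Fin n) → n.Partition → Cv) : Prop :=
  (∀ w lam, f w lam ∈ Algebra.adjoin ℤ ({v, v⁻¹} : Set Cv)) ∧
  ∀ w, heckeT n w - ∑ lam, f w lam • heckeT n (cyclePerm lam) ∈ commutators n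

/-- The class polynomials `f_{w, lam}` (the family with the defining property above). -/
def classPolynomial (n : ℕ) : Equiv.Perm (Fin n) → n.Partition → Cv :=
  Classical.epsilon (IsClassPolynomialFamily n)

/-- The Geck-Rouquier element `f*_lam = ∑ v^{-ℓ(w)} f_{w, lam} T_{w⁻¹}`. -/
def geckRouquier {n : ℕ} (lam : n.Partition) : Hecke n :=
  ∑ w, ((v ^ permLength n w)⁻¹ * classPolynomial n w lam) • heckeT n w⁻¹

/-- The direct sum of the centers of all the Hecke algebras. -/
abbrev HeckeCenters : Type :=
  DirectSum ℕ fun n => Subalgebra.center Cv (Hecke n)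

/-- The direct sum of the centers of the complex group algebras of all the symmetric groups. -/
abbrev GroupCenters : Type :=
  DirectSum ℕ fun n => Subalgebra.center ℂ (MonoidAlgebra ℂ (Equiv.Perm (Fin n)))

/-! ### Symmetric functions in infinitely many variables -/

/-- The ring of symmetric functions over `ℂ`: formal power series of bounded degree in the
variables `x_0, x_1, …` which are invariant under permutations of the variables. -/
def SymFun : Subalgebra ℂ (MvPowerSeries ℕ ℂ) where
  carrier := {f | (∀ e : Equiv.Perm ℕ, MvPowerSeries.renameEquiv ℂ e f = f) ∧
    ∃ d : ℕ, ∀ m : ℕ →₀ ℕ, MvPowerSeries.coeff m f ≠ 0 → m.degree ≤ d}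
  mul_mem' := by
    rintro f g ⟨hf, d, hd⟩ ⟨hg, d', hd'⟩
    refine ⟨fun e => by rw [map_mul, hf, hg], d + d', fun m hm => ?_⟩
    classical
    rw [MvPowerSeries.coeff_mul] at hm
    obtain ⟨p, hp, hne⟩ := Finset.exists_ne_zero_of_sum_ne_zero hm
    rw [← Finset.HasAntidiagonal.mem_antidiagonal.1 hp, map_add]
    exact add_le_add (hd _ (left_ne_zero_of_mul hne)) (hd' _ (right_ne_zero_of_mul hne))
  add_mem' := by
    rintro f g ⟨hf, d, hd⟩ ⟨hg, d', hd'⟩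
    refine ⟨fun e => by rw [map_add, hf, hg], max d d', fun m hm => ?_⟩
    rw [map_add] at hm
    by_cases h : MvPowerSeries.coeff m f = 0
    · rw [h, zero_add] at hm
      exact (hd' m hm).trans (le_max_right _ _)
    · exact (hd m h).trans (le_max_left _ _)
  algebraMap_mem' := by
    classical
    intro r
    refine ⟨fun e => AlgEquiv.commutes _ r, 0, fun m hm => ?_⟩
    rw [MvPowerSeries.algebraMap_apply, MvPowerSeries.coeff_C] at hm
    by_cases h : m = 0
    · simp [h]
    · simp [h] at hm

/-- A power series whose coefficients are invariant under permutation of the exponents is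
invariant under permutation of the variables. -/
theorem renameEquiv_eq_self {f : MvPowerSeries ℕ ℂ} (e : Equiv.Perm ℕ)
    (h : ∀ m : ℕ →₀ ℕ, MvPowerSeries.coeff (m.embDomain e.toEmbedding) f =
      MvPowerSeries.coeff m f) :
    MvPowerSeries.renameEquiv ℂ e f = f := by
  ext m
  have hm : (m.embDomain e.symm.toEmbedding).embDomain e.toEmbedding = m := by
    ext i
    obtain ⟨j, rfl⟩ := e.surjective i
    have h1 := Finsupp.embDomain_apply_self e.toEmbedding
      (m.embDomain e.symm.toEmbedding) j
    have h2 := Finsupp.embDomain_apply_self e.symm.toEmbedding m (e j)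
    simp only [Equiv.coe_toEmbedding, Equiv.symm_apply_apply] at h1 h2
    rw [h1, h2]
  rw [← hm]
  have := MvPowerSeries.coeff_embDomain_rename e.toEmbedding f (m.embDomain e.symm.toEmbedding)
  rw [h]
  exact this

/-- The power series with given coefficients. -/
def seriesOf (c : (ℕ →₀ ℕ) → ℂ) : MvPowerSeries ℕ ℂ := c

theorem coeff_seriesOf (c : (ℕ →₀ ℕ) → ℂ) (m : ℕ →₀ ℕ) :
    MvPowerSeries.coeff m (seriesOf c) = c m := rfl

open Classical in
/-- The monomial symmetric function `m_lam`: the sum of all monomials whose multiset of nonzero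
exponents is `lam`. -/
def monomialSym {n : ℕ} (lam : n.Partition) : SymFun :=
  ⟨seriesOf fun m => if m.support.val.map m = lam.parts then 1 else 0, by
    refine ⟨fun e => renameEquiv_eq_self e fun m => ?_, n, fun m hm => ?_⟩
    · have h : (m.embDomain e.toEmbedding).support.val.map (m.embDomain e.toEmbedding) =
          m.support.val.map m := by
        rw [Finsupp.support_embDomain, Finset.map_val, Multiset.map_map]
        exact Multiset.map_congr rfl fun i _ => Finsupp.embDomain_apply_self _ _ _
      simp only [coeff_seriesOf, h]
    · rw [coeff_seriesOf] at hm
      have h := (ite_ne_right_iff.1 hm).1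
      have : m.degree = n := by
        rw [Finsupp.degree_apply, Finset.sum_eq_multiset_sum, h, lam.parts_sum]
      exact this.le⟩

open Classical in
/-- The power sum `p_k = ∑ x_i ^ k` (used for `k ≥ 1`). -/
def powerSum (k : ℕ) : SymFun :=
  ⟨seriesOf fun m => if ∃ i, m = Finsupp.single i k then 1 else 0, by
    refine ⟨fun e => renameEquiv_eq_self e fun m => ?_, k, fun m hm => ?_⟩
    · have h : (∃ i, m.embDomain e.toEmbedding = Finsupp.single i k) ↔
          ∃ i, m = Finsupp.single i k := by
        constructor
        · rintro ⟨i, hi⟩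
          refine ⟨e.symm i, Finsupp.embDomain_injective e.toEmbedding ?_⟩
          rw [hi, Finsupp.embDomain_single]
          simp
        · rintro ⟨i, rfl⟩
          exact ⟨e i, Finsupp.embDomain_single _ _ _⟩
      simp only [coeff_seriesOf, h]
    · rw [coeff_seriesOf] at hm
      obtain ⟨i, rfl⟩ := (ite_ne_right_iff.1 hm).1
      simp⟩

/-- The power sum `p_lam`, the product of the `p_k` over the parts `k` of `lam`. -/
def powerSumPart {n : ℕ} (lam : n.Partition) : SymFun :=
  (lam.parts.map powerSum).prod

/-- The algebra `ℂ(v) ⊗ Λ` of symmetric functions over `ℂ(v)`. -/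
abbrev SymFunV : Type := Cv ⊗[ℂ] SymFun

/-- `p_k` in `ℂ(v) ⊗ Λ`, for `k ≥ 1`. -/
def powerSumV (k : ℕ+) : SymFunV := 1 ⊗ₜ powerSum k

/-- The expression of `F` as a polynomial in the power sums `p_1, p_2, …`. -/
def powerSumExpression (F : SymFunV) : MvPolynomial ℕ+ Cv :=
  Classical.epsilon fun P => MvPolynomial.aeval powerSumV P = F

/-- The `λ`-ring substitution `F(x / (v - 1))`: express `F` in terms of power sums and replace
each `p_k` by `p_k / (v ^ k - 1)`. -/
def substDiv (F : SymFunV) : SymFunV :=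
  MvPolynomial.aeval (fun k : ℕ+ => (v ^ (k : ℕ) - 1)⁻¹ • powerSumV k) (powerSumExpression F)

/-- `(v - 1) ^ ℓ(lam) * m_lam(x / (v - 1))`. -/
def monomialBar {n : ℕ} (lam : n.Partition) : SymFunV :=
  (v - 1) ^ partLength lam • substDiv (1 ⊗ₜ monomialSym lam)

/-! ### The two Frobenius maps -/

/-- `Ψ` is a quantum Frobenius map: it sends each (central) element `f*_lam` to
`(v - 1) ^ ℓ(lam) * m_lam(x / (v - 1))`. -/
def IsQuantumFrobenius (Ψ : HeckeCenters →ₗ[Cv] SymFunV) : Prop :=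
  ∀ (n : ℕ) (lam : n.Partition),
    ∃ h : geckRouquier lam ∈ Subalgebra.center Cv (Hecke n),
      Ψ (DirectSum.lof Cv ℕ (fun n => Subalgebra.center Cv (Hecke n)) n ⟨geckRouquier lam, h⟩) =
        monomialBar lam

/-- `ψ` is a classical Frobenius map: it sends each (central) class sum `c_lam` to
`p_lam / z_lam`. -/
def IsClassicalFrobenius (ψ : GroupCenters →ₗ[ℂ] SymFun) : Prop :=
  ∀ (n : ℕ) (lam : n.Partition),
    ∃ h : classSum lam ∈ Subalgebra.center ℂ (MonoidAlgebra ℂ (Equiv.Perm (Fin n))),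
      ψ (DirectSum.lof ℂ ℕ
        (fun n => Subalgebra.center ℂ (MonoidAlgebra ℂ (Equiv.Perm (Fin n)))) n
          ⟨classSum lam, h⟩) = (zNum lam : ℂ)⁻¹ • powerSumPart lam

/-! ### Specialization at `v = 1` -/

/-- The rational function `a` has no pole at `v = 1`. -/
def RegularAtOne (a : Cv) : Prop := a.denom.eval 1 ≠ 0

/-- The value of a rational function at `v = 1` (used where it is regular). -/
def valueAtOne (a : Cv) : ℂ := a.eval (RingHom.id ℂ) 1

/-- `h` is defined at `v = 1`: it is a combination of the `T_w` with coefficients regular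
at `1`. -/
def HeckeRegular {n : ℕ} (h : Hecke n) : Prop :=
  ∃ a : Equiv.Perm (Fin n) → Cv, (∀ w, RegularAtOne (a w)) ∧ h = ∑ w, a w • heckeT n w

/-- The element `h` of the Hecke algebra specializes at `v = 1` to the element `c` of the group
algebra: `h = ∑ a_w T_w` with all `a_w` regular at `1`, and `c = ∑ a_w(1) w`. -/
def HeckeSpecializes {n : ℕ} (h : Hecke n) (c : MonoidAlgebra ℂ (Equiv.Perm (Fin n))) : Prop :=
  ∃ a : Equiv.Perm (Fin n) → Cv, (∀ w, RegularAtOne (a w)) ∧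
    h = ∑ w, a w • heckeT n w ∧ c = ∑ w, valueAtOne (a w) • MonoidAlgebra.of ℂ _ w

/-- `z` specializes at `v = 1` to `c`, in every degree. -/
def CenterSpecializes (z : HeckeCenters) (c : GroupCenters) : Prop :=
  ∀ n, HeckeSpecializes (z n : Hecke n) (c n : MonoidAlgebra ℂ (Equiv.Perm (Fin n)))

/-- The symmetric function `F` over `ℂ(v)` specializes at `v = 1` to the symmetric function `g`:
`F = ∑ a_i ⊗ f_i` with all `a_i` regular at `1`, and `g = ∑ a_i(1) f_i`. -/
def SymSpecializes (F : SymFunV) (g : SymFun) : Prop :=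
  ∃ (k : ℕ) (a : Fin k → Cv) (f : Fin k → SymFun), (∀ i, RegularAtOne (a i)) ∧
    F = ∑ i, a i ⊗ₜ[ℂ] f i ∧ g = ∑ i, valueAtOne (a i) • f i

end HeckeFrobenius

end

open HeckeFrobenius

open scoped TensorProduct

noncomputable section

namespace HeckeFrobenius

open scoped Matrix

/-! ### Length and inversions -/

/-! Everything rests on two structures on the Hecke algebra: a family of characters that can be
evaluated at `v = 1`, and the symmetrizing trace `T_w ↦ δ_{w,1}`.

Characters. The algebra acts on words in the letters `0, 1, 2, …` of fixed content `m` by a deformed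
place permutation (`heckeRep`). Applied to the increasing word with distinct letters, the `T_w` give
distinct words, so they form a basis (`heckeCoeff`). In general the matrices have entries in `ℂ[v]`,
and at `v = 1` the trace of `T_w` counts the words fixed by `w`, which is the coefficient of `x^m`
in the power sum of the cycle type of `w` (`card_fixed_words`). These coefficients form a matrix
that is triangular with respect to the number of parts (`powerCoeff_det_ne_zero`). Hence the
characters separate the `T_{w_λ}`, and since they kill commutators, the class polynomials are unique
and take at `v = 1` the value 1 or 0 according to whether `w` has type `λ`
(`IsClassPolynomialFamily.hasValue`). The same triangularity makes the power sums free generators of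
`Λ`.

Existence of the class polynomials. Let `H_k` be the ring generated by `v` and the `T_j` with `j + 1
< k`. Then `H_{k+1}` is additively spanned by `H_k` and `H_k T_{k-1} H_k`, so modulo commutators
every element reduces, generator by generator, to increasing products of distinct generators
(`mul_heckeWord_mem_reducible`). Such a product is `T` of a product of block rotations, and
reordering the blocks changes it only by a commutator (`heckeT_blockCycle_sub_mem_commutators`).

Centers. Under the trace, `f*_λ` represents the linear form `T_w ↦ f_{w,λ}`, which vanishes on
commutators. Therefore the `f*_λ` are central, and they form a basis of the center dual to the
`T_{w_λ}` (`eq_sum_geckRouquier`, `centerCoord_geckRouquier`). The coordinates of a central element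
are, up to powers of `v`, coefficients in the basis `T_w`, so they are regular whenever the element
is.

Specialization. By linearity only `(v-1)^{ℓ(λ)} m_λ(x/(v-1))` has to be evaluated. Write `m_λ` as
`p_λ / ∏ m_i!` plus a combination of `p_μ` with fewer parts. Each part `k` of `μ` contributes
`1/(v^k-1)`, which one factor `v-1` turns into a function with value `1/k`. Shorter `μ` leave a
spare factor `v-1` and vanish, and the term of `λ` gives `p_λ/z_λ` (`symSpecializes_monomialBar`).
-/

/-- The smaller of the two letters exchanged by `s_i`. -/
def lo {n : ℕ} (i : Fin (n - 1)) : Fin n := ⟨i, by omega⟩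

/-- The larger of the two letters exchanged by `s_i`. -/
def hi {n : ℕ} (i : Fin (n - 1)) : Fin n := ⟨i + 1, by omega⟩

theorem simpleSwap_eq {n : ℕ} (i : Fin (n - 1)) : simpleSwap n i = Equiv.swap (lo i) (hi i) := rfl

theorem lo_lt_hi {n : ℕ} (i : Fin (n - 1)) : lo i < hi i := by simp [lo, hi, Fin.lt_def]

@[simp] theorem simpleSwap_lo {n : ℕ} (i : Fin (n - 1)) : simpleSwap n i (lo i) = hi i :=
  Equiv.swap_apply_left _ _

@[simp] theorem simpleSwap_hi {n : ℕ} (i : Fin (n - 1)) : simpleSwap n i (hi i) = lo i :=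
  Equiv.swap_apply_right _ _

theorem simpleSwap_of_ne {n : ℕ} {i : Fin (n - 1)} {x : Fin n} (h : (x : ℕ) ≠ i)
    (h' : (x : ℕ) ≠ i + 1) : simpleSwap n i x = x :=
  Equiv.swap_apply_of_ne_of_ne (fun e => h (by rw [e])) (fun e => h' (by rw [e]))

@[simp] theorem simpleSwap_mul_self {n : ℕ} (i : Fin (n - 1)) :
    simpleSwap n i * simpleSwap n i = 1 := Equiv.swap_mul_self _ _

@[simp] theorem simpleSwap_inv {n : ℕ} (i : Fin (n - 1)) :
    (simpleSwap n i)⁻¹ = simpleSwap n i := Equiv.swap_inv _ _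

@[simp] theorem simpleSwap_simpleSwap {n : ℕ} (i : Fin (n - 1)) (x : Fin n) :
    simpleSwap n i (simpleSwap n i x) = x := by
  rw [← Equiv.Perm.mul_apply, simpleSwap_mul_self, Equiv.Perm.one_apply]

@[simp] theorem mul_simpleSwap_mul_simpleSwap {n : ℕ} (w : Equiv.Perm (Fin n)) (i : Fin (n - 1)) :
    w * simpleSwap n i * simpleSwap n i = w := by rw [mul_assoc]; simp

@[simp] theorem simpleSwap_mul_simpleSwap_mul {n : ℕ} (w : Equiv.Perm (Fin n)) (i : Fin (n - 1)) :
    simpleSwap n i * (simpleSwap n i * w) = w := by rw [← mul_assoc]; simp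

theorem simpleSwap_comm {n : ℕ} {i j : Fin (n - 1)} (h : (i : ℕ) + 1 < j ∨ (j : ℕ) + 1 < i) :
    simpleSwap n i * simpleSwap n j = simpleSwap n j * simpleSwap n i := by
  refine (Equiv.Perm.Disjoint.commute fun x => ?_).eq
  by_cases hx : (x : ℕ) = i ∨ (x : ℕ) = i + 1
  · right; apply simpleSwap_of_ne <;> omega
  · left; apply simpleSwap_of_ne <;> omega

theorem simpleSwap_braid {n : ℕ} {i j : Fin (n - 1)} (h : (i : ℕ) + 1 = j) :
    simpleSwap n i * simpleSwap n j * simpleSwap n i =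
      simpleSwap n j * simpleSwap n i * simpleSwap n j := by
  have h1 : lo j = hi i := by ext; simp [lo, hi, h]
  have h2 : simpleSwap n i (hi j) = hi j := by apply simpleSwap_of_ne <;> simp [hi] <;> omega
  have h3 : simpleSwap n j (lo i) = lo i := by apply simpleSwap_of_ne <;> simp [lo] <;> omega
  have h4 := simpleSwap_lo j
  have h5 := simpleSwap_hi j
  rw [h1] at h4 h5
  ext x
  by_cases hx : x = lo i
  · subst hx; simp [h3, h2, h4]
  by_cases hx' : x = hi i
  · subst hx'; simp [h3, h2, h4, h5]
  by_cases hx'' : x = hi j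
  · subst hx''; simp [h3, h2, h5]
  · have a1 : simpleSwap n i x = x := Equiv.swap_apply_of_ne_of_ne hx hx'
    have a2 : simpleSwap n j x = x := Equiv.swap_apply_of_ne_of_ne (fun e => hx' (e.trans h1)) hx''
    simp [a1, a2]

/-- The set of inversions of a permutation. -/
def inversions {n : ℕ} (w : Equiv.Perm (Fin n)) : Finset (Fin n × Fin n) :=
  {p | p.1 < p.2 ∧ w p.2 < w p.1}

theorem mem_inversions {n : ℕ} {w : Equiv.Perm (Fin n)} {p : Fin n × Fin n} :
    p ∈ inversions w ↔ p.1 < p.2 ∧ w p.2 < w p.1 := by simp [inversions]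

theorem simpleSwap_lt {n : ℕ} (i : Fin (n - 1)) {a b : Fin n} (h : a < b)
    (hne : ¬ (a = lo i ∧ b = hi i)) : simpleSwap n i a < simpleSwap n i b := by
  rw [simpleSwap_eq]
  simp only [Equiv.swap_apply_def, lo, hi, Fin.ext_iff, Fin.lt_def] at *
  split_ifs <;> simp <;> omega

/-- Exchanging the two places carries the inversions of `w` injectively to inversions of `w s_i`,
because `s_i` reverses the order of no pair other than `(i, i+1)`. That pair is the only new
inversion. -/
theorem card_inversions_mul {n : ℕ} {w : Equiv.Perm (Fin n)} {i : Fin (n - 1)}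
    (h : w (lo i) < w (hi i)) :
    (inversions (w * simpleSwap n i)).card = (inversions w).card + 1 := by
  classical
  set s := simpleSwap n i with hs
  have hinj : Function.Injective (Prod.map s s) := s.injective.prodMap s.injective
  have : inversions (w * s) = insert (lo i, hi i) ((inversions w).image (Prod.map s s)) := by
    ext ⟨a, b⟩
    simp only [Finset.mem_insert, Finset.mem_image, mem_inversions, Prod.mk.injEq,
      Equiv.Perm.mul_apply, Prod.exists, Prod.map_apply]
    constructor
    · rintro ⟨hab, hw⟩
      by_cases hne : a = lo i ∧ b = hi i
      · exact Or.inl hne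
      · exact Or.inr ⟨s a, s b, ⟨simpleSwap_lt i hab hne, hw⟩, by simp [hs], by simp [hs]⟩
    · rintro (⟨rfl, rfl⟩ | ⟨c, d, ⟨hcd, hw⟩, rfl, rfl⟩)
      · exact ⟨lo_lt_hi i, by simpa [hs] using h⟩
      · refine ⟨simpleSwap_lt i hcd ?_, by simpa [hs] using hw⟩
        rintro ⟨rfl, rfl⟩
        exact absurd hw h.not_gt
  rw [this, Finset.card_insert_of_notMem, Finset.card_image_of_injective _ hinj]
  simp only [Finset.mem_image, mem_inversions, Prod.mk.injEq, Prod.exists,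
    Prod.map_apply, not_exists]
  rintro c d ⟨⟨hcd, -⟩, hc, hd⟩
  have h1 : c = hi i := by rw [← simpleSwap_lo i, ← hc]; simp [hs]
  have h2 : d = lo i := by rw [← simpleSwap_hi i, ← hd]; simp [hs]
  rw [h1, h2] at hcd
  exact absurd hcd (lo_lt_hi i).not_gt

theorem apply_lo_ne_apply_hi {n : ℕ} (w : Equiv.Perm (Fin n)) (i : Fin (n - 1)) :
    w (lo i) ≠ w (hi i) := fun h => (lo_lt_hi i).ne (w.injective h)

theorem card_inversions_mul' {n : ℕ} {w : Equiv.Perm (Fin n)} {i : Fin (n - 1)}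
    (h : w (hi i) < w (lo i)) :
    (inversions (w * simpleSwap n i)).card + 1 = (inversions w).card := by
  rw [← card_inversions_mul (w := w * simpleSwap n i) (i := i) (by simpa using h)]
  simp

/-- A permutation without descents is an order automorphism of `Fin n`, and the identity is the only
one. -/
theorem eq_one_of_forall_lt {n : ℕ} {w : Equiv.Perm (Fin n)}
    (h : ∀ i : Fin (n - 1), w (lo i) < w (hi i)) : w = 1 := by
  cases n with
  | zero => exact Subsingleton.elim _ _
  | succ n =>
    have hm : StrictMono w := Fin.strictMono_iff_lt_succ.2 fun i => h i
    ext x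
    have := Subsingleton.elim (hm.orderIsoOfSurjective w w.surjective) (OrderIso.refl (Fin (n + 1)))
    have h2 := congrArg (fun e : Fin (n + 1) ≃o Fin (n + 1) => e x) this
    simpa using congrArg Fin.val h2

theorem wordPerm_append {n : ℕ} (a b : List (Fin (n - 1))) :
    wordPerm n (a ++ b) = wordPerm n a * wordPerm n b := by simp [wordPerm]

@[simp] theorem wordPerm_cons {n : ℕ} (i : Fin (n - 1)) (b : List (Fin (n - 1))) :
    wordPerm n (i :: b) = simpleSwap n i * wordPerm n b := by simp [wordPerm]

@[simp] theorem wordPerm_nil {n : ℕ} : wordPerm n [] = 1 := by simp [wordPerm]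

theorem card_inversions_wordPerm_le {n : ℕ} (l : List (Fin (n - 1))) :
    (inversions (wordPerm n l)).card ≤ l.length := by
  induction l using List.reverseRecOn with
  | nil =>
    simp only [wordPerm_nil, List.length_nil, Nat.le_zero, Finset.card_eq_zero]
    ext p
    simp only [mem_inversions, Equiv.Perm.one_apply, Finset.notMem_empty, iff_false, not_and]
    exact fun h => h.not_gt
  | append_singleton l i ih =>
    rw [wordPerm_append]
    simp only [wordPerm_cons, wordPerm_nil, mul_one, List.length_append, List.length_singleton]
    rcases (apply_lo_ne_apply_hi (wordPerm n l) i).lt_or_gt with h | h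
    · rw [card_inversions_mul h]; omega
    · have := card_inversions_mul' h; omega

/-- Bubble sort: as long as there is a descent, multiplying by its transposition removes exactly one
inversion. -/
theorem exists_word_length_eq {n : ℕ} (w : Equiv.Perm (Fin n)) :
    ∃ l, wordPerm n l = w ∧ l.length = (inversions w).card := by
  induction hk : (inversions w).card generalizing w with
  | zero =>
    refine ⟨[], ?_, rfl⟩
    rw [wordPerm_nil, eq_one_of_forall_lt (w := w)]
    intro i
    refine (apply_lo_ne_apply_hi w i).lt_or_gt.resolve_right fun h => ?_
    have := card_inversions_mul' h
    omega
  | succ k ih =>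
    by_cases h : ∀ i : Fin (n - 1), w (lo i) < w (hi i)
    · have := card_inversions_wordPerm_le (n := n) []
      rw [wordPerm_nil, ← eq_one_of_forall_lt h, hk] at this
      simp at this
    · push Not at h
      obtain ⟨i, hi'⟩ := h
      have := card_inversions_mul' (lt_of_le_of_ne hi' (apply_lo_ne_apply_hi w i).symm)
      obtain ⟨l, hl, hlen⟩ := ih (w * simpleSwap n i) (by omega)
      exact ⟨l ++ [i], by simp [wordPerm_append, hl], by simp [hlen]⟩

theorem isReducedWord_reducedWord {n : ℕ} (w : Equiv.Perm (Fin n)) :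
    IsReducedWord n w (reducedWord n w) := (exists_reducedWord n w).choose_spec

theorem permLength_eq_card_inversions {n : ℕ} (w : Equiv.Perm (Fin n)) :
    permLength n w = (inversions w).card := by
  obtain ⟨h, hmin⟩ := isReducedWord_reducedWord w
  obtain ⟨l, hl, hlen⟩ := exists_word_length_eq w
  refine le_antisymm ?_ ?_
  · rw [← hlen]; exact hmin l hl
  · have := card_inversions_wordPerm_le (reducedWord n w)
    rwa [h] at this

theorem isReducedWord_iff {n : ℕ} {w : Equiv.Perm (Fin n)} {l : List (Fin (n - 1))} :
    IsReducedWord n w l ↔ wordPerm n l = w ∧ l.length = permLength n w := by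
  obtain ⟨h, hmin⟩ := isReducedWord_reducedWord w
  constructor
  · rintro ⟨h1, h2⟩
    exact ⟨h1, le_antisymm (h2 _ h) (hmin _ h1)⟩
  · rintro ⟨h1, h2⟩
    exact ⟨h1, fun l' hl' => h2.le.trans (hmin l' hl')⟩

theorem wordPerm_reverse {n : ℕ} (l : List (Fin (n - 1))) :
    wordPerm n l.reverse = (wordPerm n l)⁻¹ := by
  induction l with
  | nil => simp
  | cons i l ih => simp [wordPerm_append, ih]

theorem permLength_inv {n : ℕ} (w : Equiv.Perm (Fin n)) : permLength n w⁻¹ = permLength n w := by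
  have key : ∀ w : Equiv.Perm (Fin n), permLength n w⁻¹ ≤ permLength n w := fun w => by
    obtain ⟨h, -⟩ := isReducedWord_reducedWord w
    obtain ⟨-, hmin⟩ := isReducedWord_reducedWord w⁻¹
    have := hmin (reducedWord n w).reverse (by rw [wordPerm_reverse, h])
    simpa [permLength] using this
  exact le_antisymm (key w) (by simpa using key w⁻¹)

theorem permLength_mul_of_lt {n : ℕ} {w : Equiv.Perm (Fin n)} {i : Fin (n - 1)}
    (h : w (lo i) < w (hi i)) : permLength n (w * simpleSwap n i) = permLength n w + 1 := by
  simp [permLength_eq_card_inversions, card_inversions_mul h]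

theorem permLength_mul_of_gt {n : ℕ} {w : Equiv.Perm (Fin n)} {i : Fin (n - 1)}
    (h : w (hi i) < w (lo i)) : permLength n (w * simpleSwap n i) + 1 = permLength n w := by
  simp [permLength_eq_card_inversions, card_inversions_mul' h]

theorem permLength_simpleSwap_mul_of_lt {n : ℕ} {w : Equiv.Perm (Fin n)} {i : Fin (n - 1)}
    (h : w⁻¹ (lo i) < w⁻¹ (hi i)) : permLength n (simpleSwap n i * w) = permLength n w + 1 := by
  rw [← permLength_inv, ← permLength_inv w, mul_inv_rev, simpleSwap_inv, permLength_mul_of_lt h]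

theorem permLength_simpleSwap_mul_of_gt {n : ℕ} {w : Equiv.Perm (Fin n)} {i : Fin (n - 1)}
    (h : w⁻¹ (hi i) < w⁻¹ (lo i)) : permLength n (simpleSwap n i * w) + 1 = permLength n w := by
  rw [← permLength_inv, ← permLength_inv w, mul_inv_rev, simpleSwap_inv, permLength_mul_of_gt h]

@[simp] theorem permLength_one {n : ℕ} : permLength n 1 = 0 := by
  have := (isReducedWord_reducedWord (1 : Equiv.Perm (Fin n))).2 [] wordPerm_nil
  simpa [permLength] using this

/-! ### Independence of `T_w` of the reduced expression -/

/-- The product `T_{i_1} ⋯ T_{i_r}` of a word. -/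
def heckeWord (n : ℕ) (l : List (Fin (n - 1))) : Hecke n := (l.map (heckeGen n)).prod

@[simp] theorem heckeWord_cons {n : ℕ} (i : Fin (n - 1)) (l : List (Fin (n - 1))) :
    heckeWord n (i :: l) = heckeGen n i * heckeWord n l := by simp [heckeWord]

@[simp] theorem heckeWord_nil {n : ℕ} : heckeWord n [] = 1 := by simp [heckeWord]

theorem heckeWord_append {n : ℕ} (a b : List (Fin (n - 1))) :
    heckeWord n (a ++ b) = heckeWord n a * heckeWord n b := by simp [heckeWord]

theorem heckeGen_quad {n : ℕ} (i : Fin (n - 1)) :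
    heckeGen n i * heckeGen n i = (v - 1) • heckeGen n i + v • 1 := by
  have := RingQuot.mkAlgHom_rel Cv (HeckeRel.quad i)
  simp only [map_mul, map_sub, map_add, AlgHom.commutes, map_one, map_zero] at this
  change (heckeGen n i - algebraMap Cv _ v) * (heckeGen n i + 1) = 0 at this
  rw [sub_mul, mul_add, mul_one, sub_eq_zero, ← Algebra.smul_def] at this
  rw [eq_sub_of_add_eq this, smul_add, sub_smul (R := Cv) v 1 (heckeGen n i), one_smul]
  abel

theorem heckeGen_braid {n : ℕ} {i j : Fin (n - 1)} (h : (i : ℕ) + 1 = j) :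
    heckeGen n i * heckeGen n j * heckeGen n i = heckeGen n j * heckeGen n i * heckeGen n j := by
  have := RingQuot.mkAlgHom_rel Cv (HeckeRel.braid i j h)
  simp only [map_mul] at this
  exact this

theorem heckeGen_comm {n : ℕ} {i j : Fin (n - 1)} (h : (i : ℕ) + 1 < j ∨ (j : ℕ) + 1 < i) :
    heckeGen n i * heckeGen n j = heckeGen n j * heckeGen n i := by
  have := RingQuot.mkAlgHom_rel Cv (HeckeRel.comm i j h)
  simp only [map_mul] at this
  exact this

/-- The inequality for `w⁻¹` expresses that `i` is a left descent of `w`. If it failed, removing the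
first letter would leave a word too short for `s_i w`. -/
theorem IsReducedWord.of_cons {n : ℕ} {w : Equiv.Perm (Fin n)} {i : Fin (n - 1)}
    {l : List (Fin (n - 1))} (h : IsReducedWord n w (i :: l)) :
    IsReducedWord n (simpleSwap n i * w) l ∧ w⁻¹ (hi i) < w⁻¹ (lo i) := by
  obtain ⟨h1, h2⟩ := h
  have hl : wordPerm n l = simpleSwap n i * w := by rw [← h1]; simp
  refine ⟨⟨hl, fun l' hl' => ?_⟩, ?_⟩
  · have := h2 (i :: l') (by simp [hl'])
    simpa using this
  · refine (apply_lo_ne_apply_hi w⁻¹ i).lt_or_gt.resolve_left fun hlt => ?_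
    have e1 := permLength_simpleSwap_mul_of_lt hlt
    have e2 := (isReducedWord_iff.1 ⟨h1, h2⟩).2
    have e3 := (isReducedWord_reducedWord (simpleSwap n i * w)).2 l hl
    change permLength _ _ ≤ _ at e3
    simp only [List.length_cons] at e2
    omega

theorem IsReducedWord.cons {n : ℕ} {w : Equiv.Perm (Fin n)} {i : Fin (n - 1)}
    {l : List (Fin (n - 1))} (h : IsReducedWord n w l) (hw : w⁻¹ (lo i) < w⁻¹ (hi i)) :
    IsReducedWord n (simpleSwap n i * w) (i :: l) := by
  rw [isReducedWord_iff] at h ⊢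
  refine ⟨by simp [h.1], ?_⟩
  rw [permLength_simpleSwap_mul_of_lt hw, List.length_cons, h.2]

theorem IsReducedWord.cons_mul {n : ℕ} {w : Equiv.Perm (Fin n)} {i : Fin (n - 1)}
    {l : List (Fin (n - 1))} (h : IsReducedWord n (simpleSwap n i * w) l)
    (hw : w⁻¹ (hi i) < w⁻¹ (lo i)) : IsReducedWord n w (i :: l) := by
  have := h.cons (i := i) (by simpa [mul_inv_rev] using hw)
  simpa using this

/-- With `s = s_i` and `t = s_j`, both left descents of `w`, one has `w = s t s u = t s t u` with
lengths adding up. By induction both tails may be replaced by tails ending in the same word for `u`,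
and then the braid relation applies. -/
theorem heckeWord_eq_of_braid {n : ℕ} {w : Equiv.Perm (Fin n)} {i j : Fin (n - 1)}
    (hij : (i : ℕ) + 1 = j) {a b : List (Fin (n - 1))}
    (ih : ∀ (u : Equiv.Perm (Fin n)) (a b : List (Fin (n - 1))), permLength n u < permLength n w →
      IsReducedWord n u a → IsReducedWord n u b → heckeWord n a = heckeWord n b)
    (ha : IsReducedWord n w (i :: a)) (hb : IsReducedWord n w (j :: b)) :
    heckeWord n (i :: a) = heckeWord n (j :: b) := by
  obtain ⟨ha1, ha2⟩ := ha.of_cons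
  obtain ⟨hb1, hb2⟩ := hb.of_cons
  have e1 : lo j = hi i := by ext; simp [lo, hi, hij]
  have f1 : simpleSwap n i (hi j) = hi j := by apply simpleSwap_of_ne <;> simp [hi] <;> omega
  have f2 : simpleSwap n j (lo i) = lo i := by apply simpleSwap_of_ne <;> simp [lo] <;> omega
  have f3 := simpleSwap_lo j
  have f4 := simpleSwap_hi j
  rw [e1] at f3 f4 hb2
  have f5 := simpleSwap_lo i
  have f6 := simpleSwap_hi i
  have hs := simpleSwap_inv i
  have ht := simpleSwap_inv j
  have l1 := permLength_simpleSwap_mul_of_gt ha2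
  have l2 := permLength_simpleSwap_mul_of_gt (i := j) (by rw [e1]; exact hb2)
  set s := simpleSwap n i
  set t := simpleSwap n j
  -- This is the common remainder `u`, obtained from `w` by stripping `s t s`, or equally `t s t`,
  -- on the left.
  set c := reducedWord n (s * (t * (s * w)))
  have hc : IsReducedWord n (s * (t * (s * w))) c := isReducedWord_reducedWord _
  have hst : s * (t * (s * w)) = t * (s * (t * w)) := by
    simp only [← mul_assoc]; rw [simpleSwap_braid hij]
  have hc' : IsReducedWord n (t * (s * (t * w))) c := hst ▸ hc
  have r1 : IsReducedWord n (s * w) (j :: i :: c) := by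
    refine IsReducedWord.cons_mul (IsReducedWord.cons_mul hc ?_) ?_
    · rw [mul_inv_rev, Equiv.Perm.mul_apply, Equiv.Perm.mul_apply, mul_inv_rev, hs, ht]
      simpa only [mul_inv_rev, Equiv.Perm.mul_apply, hs, ht, f1, f2, f3, f5] using hb2
    · simpa only [mul_inv_rev, Equiv.Perm.mul_apply, hs, e1, f1, f6] using hb2.trans ha2
  have r2 : IsReducedWord n (t * w) (i :: j :: c) := by
    refine IsReducedWord.cons_mul (IsReducedWord.cons_mul hc' ?_) ?_
    · rw [mul_inv_rev, Equiv.Perm.mul_apply, Equiv.Perm.mul_apply, mul_inv_rev, hs, ht]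
      simpa only [mul_inv_rev, Equiv.Perm.mul_apply, hs, ht, e1, f1, f2, f4, f6] using ha2
    · simpa only [mul_inv_rev, Equiv.Perm.mul_apply, ht, f2, f3] using hb2.trans ha2
  rw [heckeWord_cons, heckeWord_cons, ih _ _ _ (by omega) ha1 r1, ih _ _ _ (by omega) hb1 r2]
  simp only [heckeWord_cons, ← mul_assoc]
  rw [heckeGen_braid hij]

/-- Matsumoto's theorem, by induction on the length. Two reduced words with different first letters
are both compared with words that begin with the two sides of the braid or commutation relation
between these letters. -/
theorem heckeWord_eq_of_isReducedWord {n : ℕ} (w : Equiv.Perm (Fin n)) {a b : List (Fin (n - 1))}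
    (ha : IsReducedWord n w a) (hb : IsReducedWord n w b) : heckeWord n a = heckeWord n b := by
  induction hk : permLength n w using Nat.strong_induction_on generalizing w a b with
  | _ k ih =>
    subst hk
    have ih' : ∀ (u : Equiv.Perm (Fin n)) (a b : List (Fin (n - 1))),
        permLength n u < permLength n w → IsReducedWord n u a → IsReducedWord n u b →
        heckeWord n a = heckeWord n b := fun u a b h h1 h2 => ih _ h u h1 h2 rfl
    have hlen : a.length = b.length :=
      (isReducedWord_iff.1 ha).2.trans (isReducedWord_iff.1 hb).2.symm
    match a, b with
    | [], [] => rfl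
    | [], _ :: _ => simp at hlen
    | _ :: _, [] => simp at hlen
    | i :: a, j :: b =>
      obtain ⟨ha1, ha2⟩ := ha.of_cons
      obtain ⟨hb1, hb2⟩ := hb.of_cons
      have l1 := permLength_simpleSwap_mul_of_gt ha2
      have l2 := permLength_simpleSwap_mul_of_gt hb2
      by_cases hij : i = j
      · subst hij
        rw [heckeWord_cons, heckeWord_cons, ih' _ _ _ (by omega) ha1 hb1]
      by_cases h1 : (i : ℕ) + 1 = j
      · exact heckeWord_eq_of_braid h1 ih' ha hb
      by_cases h2 : (j : ℕ) + 1 = i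
      · exact (heckeWord_eq_of_braid h2 ih' hb ha).symm
      have hne : (i : ℕ) ≠ j := fun h => hij (Fin.ext h)
      have hc : (i : ℕ) + 1 < j ∨ (j : ℕ) + 1 < i := by omega
      have g1 : simpleSwap n i (lo j) = lo j := by apply simpleSwap_of_ne <;> simp [lo] <;> omega
      have g2 : simpleSwap n i (hi j) = hi j := by apply simpleSwap_of_ne <;> simp [hi] <;> omega
      have g3 : simpleSwap n j (lo i) = lo i := by apply simpleSwap_of_ne <;> simp [lo] <;> omega
      have g4 : simpleSwap n j (hi i) = hi i := by apply simpleSwap_of_ne <;> simp [hi] <;> omega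
      set c := reducedWord n (simpleSwap n i * (simpleSwap n j * w))
      have hcr : IsReducedWord n (simpleSwap n i * (simpleSwap n j * w)) c :=
        isReducedWord_reducedWord _
      have hcr' : IsReducedWord n (simpleSwap n j * (simpleSwap n i * w)) c := by
        rw [← mul_assoc, simpleSwap_comm hc.symm, mul_assoc]; exact hcr
      have r1 : IsReducedWord n (simpleSwap n i * w) (j :: c) :=
        hcr'.cons_mul (by simpa [mul_inv_rev, g1, g2] using hb2)
      have r2 : IsReducedWord n (simpleSwap n j * w) (i :: c) :=
        hcr.cons_mul (by simpa [mul_inv_rev, g3, g4] using ha2)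
      rw [heckeWord_cons, heckeWord_cons, ih' _ _ _ (by omega) ha1 r1, ih' _ _ _ (by omega) hb1 r2,
        heckeWord_cons, heckeWord_cons, ← mul_assoc, ← mul_assoc, heckeGen_comm hc]

theorem IsReducedWord.heckeWord_eq {n : ℕ} {w : Equiv.Perm (Fin n)} {l : List (Fin (n - 1))}
    (h : IsReducedWord n w l) : heckeWord n l = heckeT n w :=
  heckeWord_eq_of_isReducedWord w h (isReducedWord_reducedWord w)

@[simp] theorem heckeT_one {n : ℕ} : heckeT n 1 = 1 := by
  rw [← IsReducedWord.heckeWord_eq (l := []) (isReducedWord_iff.2 (by simp)), heckeWord_nil]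

theorem heckeGen_mul_heckeT_of_lt {n : ℕ} {w : Equiv.Perm (Fin n)} {i : Fin (n - 1)}
    (h : w⁻¹ (lo i) < w⁻¹ (hi i)) :
    heckeGen n i * heckeT n w = heckeT n (simpleSwap n i * w) := by
  rw [← ((isReducedWord_reducedWord w).cons h).heckeWord_eq,
    ← (isReducedWord_reducedWord w).heckeWord_eq, heckeWord_cons]

theorem heckeGen_mul_heckeT_of_gt {n : ℕ} {w : Equiv.Perm (Fin n)} {i : Fin (n - 1)}
    (h : w⁻¹ (hi i) < w⁻¹ (lo i)) :
    heckeGen n i * heckeT n w = (v - 1) • heckeT n w + v • heckeT n (simpleSwap n i * w) := by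
  have h1 : heckeT n w = heckeGen n i * heckeT n (simpleSwap n i * w) := by
    rw [heckeGen_mul_heckeT_of_lt (by simpa [mul_inv_rev] using h)]; simp
  conv_lhs => rw [h1]
  rw [← mul_assoc, heckeGen_quad, add_mul, smul_mul_assoc, ← h1, smul_mul_assoc, one_mul]

theorem heckeT_mul_heckeGen_of_lt {n : ℕ} {w : Equiv.Perm (Fin n)} {i : Fin (n - 1)}
    (h : w (lo i) < w (hi i)) :
    heckeT n w * heckeGen n i = heckeT n (w * simpleSwap n i) := by
  have hr := isReducedWord_iff.1 (isReducedWord_reducedWord w)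
  have : IsReducedWord n (w * simpleSwap n i) (reducedWord n w ++ [i]) := by
    rw [isReducedWord_iff]
    refine ⟨by simp [wordPerm_append, hr.1], ?_⟩
    rw [permLength_mul_of_lt h, List.length_append, hr.2, List.length_singleton]
  rw [← this.heckeWord_eq, ← (isReducedWord_reducedWord w).heckeWord_eq, heckeWord_append]
  simp

/-- The quadratic relation reads `T (T - (v - 1)) = v`, and `v` is invertible. -/
theorem isUnit_heckeGen {n : ℕ} (i : Fin (n - 1)) : IsUnit (heckeGen n i) := by
  have hv : v ≠ 0 := RatFunc.X_ne_zero
  have h : heckeGen n i * (heckeGen n i - (v - 1) • 1) = v • 1 := by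
    rw [mul_sub, heckeGen_quad, mul_smul_comm, mul_one]; abel
  have h' : (heckeGen n i - (v - 1) • 1) * heckeGen n i = v • 1 := by
    rw [sub_mul, heckeGen_quad, smul_mul_assoc, one_mul]; abel
  refine ⟨⟨heckeGen n i, v⁻¹ • (heckeGen n i - (v - 1) • 1), ?_, ?_⟩, rfl⟩
  · rw [mul_smul_comm, h, smul_smul, inv_mul_cancel₀ hv, one_smul]
  · rw [smul_mul_assoc, h', smul_smul, inv_mul_cancel₀ hv, one_smul]

theorem isUnit_heckeT {n : ℕ} (w : Equiv.Perm (Fin n)) : IsUnit (heckeT n w) := by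
  rw [← (isReducedWord_reducedWord w).heckeWord_eq]
  induction reducedWord n w with
  | nil => simp
  | cons i l ih => rw [heckeWord_cons]; exact (isUnit_heckeGen i).mul ih

/-! ### The action on words -/

/-- The words of length `n` in the letters `0, 1, 2, …` in which each letter `a` occurs `m a`
times. -/
@[ext]
structure Words (n : ℕ) (m : ℕ →₀ ℕ) where
  /-- The letters of the word. -/
  letter : Fin n → ℕ
  content : ∑ i, Finsupp.single (letter i) 1 = m

instance (n : ℕ) (m : ℕ →₀ ℕ) : DecidableEq (Words n m) := Classical.decEq _

theorem Words.mem_support {n : ℕ} {m : ℕ →₀ ℕ} (f : Words n m) (i : Fin n) :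
    f.1 i ∈ m.support := by
  rw [Finsupp.mem_support_iff]
  intro h
  have h' := DFunLike.congr_fun f.content (f.letter i)
  rw [h, Finsupp.finsetSum_apply] at h'
  replace h := h'
  have := Finset.sum_eq_zero_iff.1 h i (Finset.mem_univ _)
  simp at this

instance (n : ℕ) (m : ℕ →₀ ℕ) : Finite (Words n m) :=
  Finite.of_injective (fun f i => (⟨f.1 i, f.mem_support i⟩ : m.support)) fun _ _ h =>
    Words.ext (funext fun i => congrArg Subtype.val (congrFun h i))

instance (n : ℕ) (m : ℕ →₀ ℕ) : Fintype (Words n m) := Fintype.ofFinite _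

/-- The place permutation of a word. -/
def Words.permute {n : ℕ} {m : ℕ →₀ ℕ} (f : Words n m) (w : Equiv.Perm (Fin n)) : Words n m :=
  ⟨f.1 ∘ w, (Equiv.sum_comp w fun i => Finsupp.single (f.1 i) 1).trans f.content⟩

theorem Words.permute_apply {n : ℕ} {m : ℕ →₀ ℕ} (f : Words n m) (w : Equiv.Perm (Fin n))
    (i : Fin n) : (f.permute w).1 i = f.1 (w i) := rfl

theorem Words.permute_permute {n : ℕ} {m : ℕ →₀ ℕ} (f : Words n m) (w u : Equiv.Perm (Fin n)) :
    (f.permute w).permute u = f.permute (w * u) := rfl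

theorem Words.permute_one {n : ℕ} {m : ℕ →₀ ℕ} (f : Words n m) : f.permute 1 = f := rfl

/-! ### The generator matrices on words, over any commutative ring with parameter `q` -/

section Action

variable {R : Type*} [CommRing R] (q : R) {n : ℕ} {m : ℕ →₀ ℕ}

/-- The diagonal coefficient of the action of a generator on a word with adjacent letters
`a`, `b`. -/
def stayCoeff (a b : ℕ) : R := if a < b then 0 else if a = b then q else q - 1

/-- The off-diagonal coefficient of the action of a generator on a word with adjacent letters
`a`, `b`. -/
def swapCoeff (a b : ℕ) : R := if a < b then 1 else if a = b then 0 else q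

/-- The matrix of the generator `T_i` acting on words. -/
def genMatrix (i : Fin (n - 1)) : Matrix (Words n m) (Words n m) R :=
  Matrix.of fun g f => stayCoeff q (f.1 (lo i)) (f.1 (hi i)) * (Pi.single f 1 : Words n m → R) g +
    swapCoeff q (f.1 (lo i)) (f.1 (hi i)) *
      (Pi.single (f.permute (simpleSwap n i)) 1 : Words n m → R) g

theorem genMatrix_mulVec (i : Fin (n - 1)) (f : Words n m) :
    genMatrix q i *ᵥ Pi.single f 1 =
      stayCoeff q (f.1 (lo i)) (f.1 (hi i)) • (Pi.single f 1 : Words n m → R) +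
      swapCoeff q (f.1 (lo i)) (f.1 (hi i)) • Pi.single (f.permute (simpleSwap n i)) 1 := by
  rw [Matrix.mulVec_single_one]
  rfl

/-- Compatibility with ring homomorphisms is the reason for the general parameter: matrices over
`ℂ[X]` are compared with those at `q = v` and at `q = 1`. -/
theorem genMatrix_map {S : Type*} [CommRing S] (φ : R →+* S) (i : Fin (n - 1)) :
    (genMatrix q i : Matrix (Words n m) (Words n m) R).map φ = genMatrix (φ q) i := by
  ext g f
  simp only [genMatrix, Matrix.map_apply, Matrix.of_apply, map_add, map_mul, stayCoeff, swapCoeff,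
    apply_ite φ, map_zero, map_one, map_sub, Pi.single_apply]

/-- The word and its exchanged partner span a stable subspace. If the two letters are equal the
generator acts by the eigenvalue `q`; otherwise a two-dimensional computation is needed. -/
theorem genMatrix_quad (i : Fin (n - 1)) :
    (genMatrix q i : Matrix (Words n m) (Words n m) R) * genMatrix q i =
      (q - 1) • genMatrix q i + q • 1 := by
  refine Matrix.ext_of_mulVec_single fun f => ?_
  rw [← Matrix.mulVec_mulVec]
  simp only [Matrix.add_mulVec, Matrix.smul_mulVec, genMatrix_mulVec, Matrix.mulVec_add,
    Matrix.mulVec_smul, Matrix.one_mulVec, Words.permute_apply, Words.permute_permute,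
    simpleSwap_lo, simpleSwap_hi, simpleSwap_mul_self, Words.permute_one]
  rcases lt_trichotomy (f.1 (lo i)) (f.1 (hi i)) with h | h | h
  · simp only [stayCoeff, swapCoeff, if_pos h, if_neg h.not_gt, if_neg h.ne']; module
  · simp only [stayCoeff, swapCoeff, h, lt_irrefl, if_true, if_false]; module
  · simp only [stayCoeff, swapCoeff, if_pos h, if_neg h.not_gt, if_neg h.ne']; module

theorem genMatrix_comm {i j : Fin (n - 1)} (h : (i : ℕ) + 1 < j ∨ (j : ℕ) + 1 < i) :
    (genMatrix q i : Matrix (Words n m) (Words n m) R) * genMatrix q j =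
      genMatrix q j * genMatrix q i := by
  have g1 : simpleSwap n i (lo j) = lo j := by apply simpleSwap_of_ne <;> simp [lo] <;> omega
  have g2 : simpleSwap n i (hi j) = hi j := by apply simpleSwap_of_ne <;> simp [hi] <;> omega
  have g3 : simpleSwap n j (lo i) = lo i := by apply simpleSwap_of_ne <;> simp [lo] <;> omega
  have g4 : simpleSwap n j (hi i) = hi i := by apply simpleSwap_of_ne <;> simp [hi] <;> omega
  refine Matrix.ext_of_mulVec_single fun f => ?_
  rw [← Matrix.mulVec_mulVec, ← Matrix.mulVec_mulVec]
  simp only [genMatrix_mulVec, Matrix.mulVec_add,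
    Matrix.mulVec_smul, Words.permute_apply, Words.permute_permute, g1, g2, g3, g4,
    simpleSwap_comm h]
  module

theorem genMatrix_braid {i j : Fin (n - 1)} (h : (i : ℕ) + 1 = j) :
    (genMatrix q i : Matrix (Words n m) (Words n m) R) * genMatrix q j * genMatrix q i =
      genMatrix q j * genMatrix q i * genMatrix q j := by
  have e1 : lo j = hi i := by ext; simp [lo, hi, h]
  have f1 : simpleSwap n i (hi j) = hi j := by apply simpleSwap_of_ne <;> simp [hi] <;> omega
  have f2 : simpleSwap n j (lo i) = lo i := by apply simpleSwap_of_ne <;> simp [lo] <;> omega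
  have f3 := simpleSwap_lo j
  have f4 := simpleSwap_hi j
  rw [e1] at f3 f4
  have hb := simpleSwap_braid h
  refine Matrix.ext_of_mulVec_single fun f => ?_
  simp only [← Matrix.mulVec_mulVec]
  simp only [genMatrix_mulVec, Matrix.mulVec_add,
    Matrix.mulVec_smul, Words.permute_apply, Words.permute_permute, e1, f1, f2, f3, f4,
    simpleSwap_lo, simpleSwap_hi, simpleSwap_mul_self, Words.permute_one, hb,
    Equiv.Perm.mul_apply]
  -- The words may be treated as independent symbols. The coefficients depend only on the relative
  -- order of three letters, so thirteen weak orderings are left to check.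
  generalize (Pi.single f 1 : Words n m → R) = x0
  generalize (Pi.single (f.permute (simpleSwap n i)) 1 : Words n m → R) = x1
  generalize (Pi.single (f.permute (simpleSwap n j)) 1 : Words n m → R) = x2
  generalize (Pi.single (f.permute (simpleSwap n i * simpleSwap n j)) 1 : Words n m → R) = x3
  generalize (Pi.single (f.permute (simpleSwap n j * simpleSwap n i)) 1 : Words n m → R) = x4
  generalize (Pi.single (f.permute (simpleSwap n j * simpleSwap n i * simpleSwap n j)) 1 :
    Words n m → R) = x5
  generalize f.1 (lo i) = a
  generalize f.1 (hi i) = b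
  generalize f.1 (hi j) = c
  rcases lt_trichotomy a b with h1 | h1 | h1 <;> rcases lt_trichotomy b c with h2 | h2 | h2 <;>
    rcases lt_trichotomy a c with h3 | h3 | h3 <;> try omega
  all_goals
    try subst h1
    try subst h2
    try subst h3
    simp only [stayCoeff, swapCoeff, *, not_lt_of_gt, ne_of_lt, ne_of_gt, lt_irrefl, if_true,
      if_false]
    module

/-- The product of the matrices of the generators in a word. -/
def wordMatrix (l : List (Fin (n - 1))) : Matrix (Words n m) (Words n m) R :=
  (l.map (genMatrix q)).prod

theorem wordMatrix_cons (i : Fin (n - 1)) (l : List (Fin (n - 1))) :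
    (wordMatrix q (i :: l) : Matrix (Words n m) (Words n m) R) =
      genMatrix q i * wordMatrix q l := by simp [wordMatrix]

theorem wordMatrix_map {S : Type*} [CommRing S] (φ : R →+* S) (l : List (Fin (n - 1))) :
    (wordMatrix q l : Matrix (Words n m) (Words n m) R).map φ = wordMatrix (φ q) l := by
  induction l with
  | nil => simp [wordMatrix]
  | cons i l ih => rw [wordMatrix_cons, wordMatrix_cons, Matrix.map_mul, ih, genMatrix_map]

/-- At `q = 1` the deformed action is plain place permutation; for equal letters the diagonal
coefficient `q = 1` agrees with it, as the exchange changes nothing. The inverse appears because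
`Words.permute` is a right action. -/
theorem wordMatrix_one_mulVec (l : List (Fin (n - 1))) (f : Words n m) :
    wordMatrix (1 : R) l *ᵥ Pi.single f 1 =
      (Pi.single (f.permute (wordPerm n l)⁻¹) 1 : Words n m → R) := by
  induction l with
  | nil => simp only [wordMatrix, List.map_nil, List.prod_nil, Matrix.one_mulVec, wordPerm_nil,
      inv_one, Words.permute_one]
  | cons i l ih =>
    rw [wordMatrix_cons, ← Matrix.mulVec_mulVec, ih, genMatrix_mulVec, Words.permute_permute,
      wordPerm_cons, mul_inv_rev, simpleSwap_inv]
    set g := f.permute (wordPerm n l)⁻¹ with hg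
    have hgs : f.permute ((wordPerm n l)⁻¹ * simpleSwap n i) = g.permute (simpleSwap n i) := rfl
    rw [hgs]
    rcases lt_trichotomy (g.1 (lo i)) (g.1 (hi i)) with h | h | h
    · simp [stayCoeff, swapCoeff, h]
    · have : g.permute (simpleSwap n i) = g := by
        refine Words.ext (funext fun x => ?_)
        rw [Words.permute_apply]
        by_cases hx : x = lo i
        · rw [hx, simpleSwap_lo, h]
        by_cases hx' : x = hi i
        · rw [hx', simpleSwap_hi, h]
        · rw [simpleSwap_eq, Equiv.swap_apply_of_ne_of_ne hx hx']
      simp [stayCoeff, swapCoeff, h, this]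
    · simp [stayCoeff, swapCoeff, h.not_gt, h.ne']

theorem trace_wordMatrix_one (l : List (Fin (n - 1))) :
    (wordMatrix (1 : R) l : Matrix (Words n m) (Words n m) R).trace =
      (Fintype.card {f : Words n m // f.permute (wordPerm n l) = f} : R) := by
  have : ∀ f : Words n m, (wordMatrix (1 : R) l : Matrix (Words n m) (Words n m) R) f f =
      if f.permute (wordPerm n l) = f then 1 else 0 := fun f => by
    have := congrFun (wordMatrix_one_mulVec (R := R) l f) f
    rw [Matrix.mulVec_single_one, Matrix.col_apply, Pi.single_apply] at this
    rw [this]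
    refine if_congr ⟨fun h => ?_, fun h => ?_⟩ rfl rfl
    · conv_lhs => rw [h]
      rw [Words.permute_permute, inv_mul_cancel, Words.permute_one]
    · conv_rhs => rw [← h]
      rw [Words.permute_permute, mul_inv_cancel, Words.permute_one]
  rw [Matrix.trace, Fintype.card_subtype]
  simp [Matrix.diag, this]

end Action

/-- The representation of the Hecke algebra on words. -/
def heckeRep (n : ℕ) (m : ℕ →₀ ℕ) : Hecke n →ₐ[Cv] Matrix (Words n m) (Words n m) Cv :=
  RingQuot.liftAlgHom Cv ⟨FreeAlgebra.lift Cv (genMatrix v), by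
    intro x y h
    cases h with
    | quad k =>
      simp only [map_mul, map_sub, map_add, FreeAlgebra.lift_ι_apply, AlgHom.commutes, map_one,
        map_zero]
      rw [Algebra.algebraMap_eq_smul_one, sub_mul, mul_add, mul_add, genMatrix_quad]
      simp only [smul_mul_assoc, one_mul, mul_one]
      rw [sub_smul (R := Cv) v 1, one_smul]
      abel
    | braid k l h =>
      simp only [map_mul, FreeAlgebra.lift_ι_apply]
      exact genMatrix_braid v h
    | comm k l h =>
      simp only [map_mul, FreeAlgebra.lift_ι_apply]
      exact genMatrix_comm v h⟩

theorem heckeRep_heckeGen {n : ℕ} {m : ℕ →₀ ℕ} (i : Fin (n - 1)) :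
    heckeRep n m (heckeGen n i) = genMatrix v i := by
  rw [heckeRep, heckeGen, RingQuot.liftAlgHom_mkAlgHom_apply, FreeAlgebra.lift_ι_apply]

theorem heckeRep_heckeWord {n : ℕ} {m : ℕ →₀ ℕ} (l : List (Fin (n - 1))) :
    heckeRep n m (heckeWord n l) = wordMatrix v l := by
  induction l with
  | nil => simp [wordMatrix]
  | cons i l ih => rw [heckeWord_cons, map_mul, ih, heckeRep_heckeGen, wordMatrix_cons]

/-! ### The basis `T_w` -/

/-- The increasing word `0, 1, …, n - 1`. -/
def stdWord (n : ℕ) : Words n (∑ i : Fin n, Finsupp.single (i : ℕ) 1) := ⟨Fin.val, rfl⟩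

theorem permute_stdWord_injective (n : ℕ) : Function.Injective (stdWord n).permute := by
  intro w u h
  ext i
  exact congrFun (congrArg Words.letter h) i

/-- Along a reduced expression every generator meets two adjacent letters in increasing order, where
it acts by a pure exchange. No lower terms arise. -/
theorem heckeRep_heckeT_mulVec {n : ℕ} (w : Equiv.Perm (Fin n)) :
    heckeRep n _ (heckeT n w) *ᵥ Pi.single (stdWord n) 1 =
      Pi.single ((stdWord n).permute w⁻¹) 1 := by
  have h := isReducedWord_reducedWord w
  rw [← h.heckeWord_eq, heckeRep_heckeWord]
  revert h
  generalize reducedWord n w = l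
  intro h
  induction l generalizing w with
  | nil =>
    obtain ⟨rfl, -⟩ := h
    simp only [wordMatrix, List.map_nil, List.prod_nil, Matrix.one_mulVec, wordPerm_nil,
      inv_one, Words.permute_one]
  | cons i l ih =>
    obtain ⟨h1, h2⟩ := h.of_cons
    rw [wordMatrix_cons, ← Matrix.mulVec_mulVec, ih _ h1, genMatrix_mulVec, mul_inv_rev,
      simpleSwap_inv, Words.permute_permute]
    have : ((stdWord n).permute (w⁻¹ * simpleSwap n i)).1 (lo i) <
        ((stdWord n).permute (w⁻¹ * simpleSwap n i)).1 (hi i) := by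
      simpa [Words.permute_apply, stdWord] using h2
    simp [stayCoeff, swapCoeff, this]

/-- The coefficient of `T_w`. -/
def heckeCoeff {n : ℕ} (w : Equiv.Perm (Fin n)) : Hecke n →ₗ[Cv] Cv where
  toFun h := (heckeRep n _ h *ᵥ Pi.single (stdWord n) 1) ((stdWord n).permute w⁻¹)
  map_add' x y := by simp only [map_add, Matrix.add_mulVec, Pi.add_apply]
  map_smul' a x := by
    simp only [map_smul, Matrix.smul_mulVec, Pi.smul_apply, RingHom.id_apply]

theorem heckeCoeff_heckeT {n : ℕ} (w u : Equiv.Perm (Fin n)) :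
    heckeCoeff w (heckeT n u) = if u = w then 1 else 0 := by
  change (heckeRep n _ (heckeT n u) *ᵥ Pi.single (stdWord n) 1) ((stdWord n).permute w⁻¹) = _
  rw [heckeRep_heckeT_mulVec, Pi.single_apply]
  refine if_congr ?_ rfl rfl
  rw [(permute_stdWord_injective n).eq_iff, inv_inj, eq_comm]

theorem heckeCoeff_sum {n : ℕ} (a : Equiv.Perm (Fin n) → Cv) (w : Equiv.Perm (Fin n)) :
    heckeCoeff w (∑ u, a u • heckeT n u) = a w := by
  simp [map_sum, map_smul, heckeCoeff_heckeT]

theorem adjoin_heckeGen (n : ℕ) : Algebra.adjoin Cv (Set.range (heckeGen n)) = ⊤ := by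
  have : Set.range (heckeGen n) =
      RingQuot.mkAlgHom Cv (HeckeRel n) '' Set.range (FreeAlgebra.ι Cv) := by
    rw [← Set.range_comp]; rfl
  rw [this, ← AlgHom.map_adjoin, FreeAlgebra.adjoin_range_ι, Algebra.map_top,
    AlgHom.range_eq_top]
  exact RingQuot.mkAlgHom_surjective _ _

/-- A subspace stable under left multiplication by the generators is a left ideal. -/
theorem mul_mem_of_heckeGen_mul_mem {n : ℕ} (S : Submodule Cv (Hecke n))
    (hS : ∀ i, ∀ y ∈ S, heckeGen n i * y ∈ S) (x : Hecke n) : ∀ y ∈ S, x * y ∈ S := by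
  have hx : x ∈ Algebra.adjoin Cv (Set.range (heckeGen n)) := by
    rw [adjoin_heckeGen]; trivial
  induction hx using Algebra.adjoin_induction with
  | mem x hx => obtain ⟨i, rfl⟩ := hx; exact hS i
  | algebraMap r =>
    intro y hy
    rw [← Algebra.smul_def]; exact S.smul_mem r hy
  | add x y _ _ h1 h2 =>
    intro z hz
    rw [add_mul]; exact S.add_mem (h1 z hz) (h2 z hz)
  | mul x y _ _ h1 h2 =>
    intro z hz
    rw [mul_assoc]; exact h1 _ (h2 z hz)

/-- The span contains `1` and is stable under left multiplication by the generators, by the two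
multiplication rules for `T_i T_w`. -/
theorem span_heckeT (n : ℕ) : Submodule.span Cv (Set.range (heckeT n)) = ⊤ := by
  refine eq_top_iff.2 fun x _ => ?_
  rw [← mul_one x, ← heckeT_one]
  refine mul_mem_of_heckeGen_mul_mem _ (fun i y hy => ?_) x _
    (Submodule.subset_span ⟨1, rfl⟩)
  induction hy using Submodule.span_induction with
  | mem y hy =>
    obtain ⟨w, rfl⟩ := hy
    rcases (apply_lo_ne_apply_hi w⁻¹ i).lt_or_gt with h | h
    · rw [heckeGen_mul_heckeT_of_lt h]
      exact Submodule.subset_span ⟨_, rfl⟩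
    · rw [heckeGen_mul_heckeT_of_gt h]
      exact Submodule.add_mem _ (Submodule.smul_mem _ _ (Submodule.subset_span ⟨_, rfl⟩))
        (Submodule.smul_mem _ _ (Submodule.subset_span ⟨_, rfl⟩))
  | zero => rw [mul_zero]; exact Submodule.zero_mem _
  | add x y _ _ h1 h2 => rw [mul_add]; exact Submodule.add_mem _ h1 h2
  | smul a x _ h => rw [mul_smul_comm]; exact Submodule.smul_mem _ _ h

theorem sum_heckeCoeff {n : ℕ} (h : Hecke n) : ∑ w, heckeCoeff w h • heckeT n w = h := by
  have hh : h ∈ Submodule.span Cv (Set.range (heckeT n)) := by rw [span_heckeT]; trivial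
  induction hh using Submodule.span_induction with
  | mem y hy =>
    obtain ⟨u, rfl⟩ := hy
    simp [heckeCoeff_heckeT]
  | zero => simp
  | add x y _ _ h1 h2 =>
    simp only [map_add, add_smul, Finset.sum_add_distrib, h1, h2]
  | smul a x _ h =>
    simp only [map_smul, smul_assoc, ← Finset.smul_sum, h]

/-- Linear maps agreeing on all `T_w` are equal. -/
theorem hecke_hom_ext {n : ℕ} {M : Type*} [AddCommMonoid M] [Module Cv M] {φ ψ : Hecke n →ₗ[Cv] M}
    (h : ∀ w, φ (heckeT n w) = ψ (heckeT n w)) : φ = ψ :=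
  LinearMap.ext_on_range (span_heckeT n) h

/-! ### The symmetrizing trace -/

/-- The last letter of a reduced word of `x` is moved over to `y`. A factor `v` is produced exactly
when this letter shortens `y`, which it always does if `y = x⁻¹`. -/
theorem heckeCoeff_one_mul {n : ℕ} (x y : Equiv.Perm (Fin n)) :
    heckeCoeff 1 (heckeT n x * heckeT n y) = if x * y = 1 then v ^ permLength n x else 0 := by
  have hx := isReducedWord_reducedWord x
  rw [← hx.heckeWord_eq]
  revert hx
  generalize reducedWord n x = l
  intro hx
  induction l using List.reverseRecOn generalizing x y with
  | nil =>
    obtain ⟨rfl, -⟩ := hx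
    simp [heckeCoeff_heckeT]
  | append_singleton l i ih =>
    have hlen := (isReducedWord_iff.1 hx).2
    have hl : wordPerm n l = x * simpleSwap n i := by
      rw [← hx.1, wordPerm_append]; simp
    have hgt : x (hi i) < x (lo i) := by
      refine (apply_lo_ne_apply_hi x i).lt_or_gt.resolve_left fun hlt => ?_
      have e1 := permLength_mul_of_lt hlt
      have e3 := (isReducedWord_reducedWord (x * simpleSwap n i)).2 l hl
      change permLength _ _ ≤ _ at e3
      simp only [List.length_append, List.length_singleton] at hlen
      omega
    have hpl := permLength_mul_of_gt hgt
    have hr : IsReducedWord n (x * simpleSwap n i) l := by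
      rw [isReducedWord_iff]
      refine ⟨hl, ?_⟩
      simp only [List.length_append, List.length_singleton] at hlen
      omega
    rw [heckeWord_append, heckeWord_cons, heckeWord_nil, mul_one, mul_assoc]
    rcases (apply_lo_ne_apply_hi y⁻¹ i).lt_or_gt with h | h
    · rw [heckeGen_mul_heckeT_of_lt h, ih _ _ hr, if_neg, if_neg]
      · intro e
        rw [← eq_inv_of_mul_eq_one_left e] at h
        exact h.not_gt hgt
      · intro e
        rw [mul_assoc, simpleSwap_mul_simpleSwap_mul] at e
        rw [← eq_inv_of_mul_eq_one_left e] at h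
        exact h.not_gt hgt
    -- The term `(v - 1) T_y` contributes nothing: `(x s_i) y = 1` would give `y⁻¹ = x s_i`, which
    -- does not have the descent that `y⁻¹` has at `i`.
    · rw [heckeGen_mul_heckeT_of_gt h, mul_add, mul_smul_comm, mul_smul_comm, map_add, map_smul,
        map_smul, ih _ _ hr, ih _ _ hr, if_neg, smul_zero, zero_add, mul_assoc,
        simpleSwap_mul_simpleSwap_mul, ← hpl]
      · rw [smul_eq_mul, mul_ite, mul_zero, pow_succ']
      · intro e
        rw [← eq_inv_of_mul_eq_one_left e] at h
        simp only [Equiv.Perm.mul_apply, simpleSwap_lo, simpleSwap_hi] at h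
        exact h.not_gt hgt

/-- The symmetrizing trace `T_w ↦ δ_{w, 1}` is symmetric. -/
theorem heckeCoeff_one_mul_comm {n : ℕ} (a b : Hecke n) :
    heckeCoeff 1 (a * b) = heckeCoeff 1 (b * a) := by
  have key : (LinearMap.mul Cv (Hecke n)).compr₂ (heckeCoeff 1) =
      (LinearMap.mul Cv (Hecke n)).flip.compr₂ (heckeCoeff 1) := by
    refine hecke_hom_ext fun x => hecke_hom_ext fun y => ?_
    simp only [LinearMap.compr₂_apply, LinearMap.mul_apply', LinearMap.flip_apply]
    rw [heckeCoeff_one_mul, heckeCoeff_one_mul]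
    by_cases h : x * y = 1
    · rw [if_pos h, if_pos (mul_eq_one_comm.1 h), eq_inv_of_mul_eq_one_left h, permLength_inv]
    · rw [if_neg h, if_neg (mt mul_eq_one_comm.1 h)]
  exact congrArg (fun f => f a b) key

/-- The bases `T_w` and `v^{-ℓ(w)} T_{w⁻¹}` are dual for the trace. This explains the normalization
of `f*_λ`. -/
theorem heckeCoeff_one_mul_heckeT {n : ℕ} (h : Hecke n) (y : Equiv.Perm (Fin n)) :
    heckeCoeff 1 (h * heckeT n y) = v ^ permLength n y * heckeCoeff y⁻¹ h := by
  conv_lhs => rw [← sum_heckeCoeff h]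
  rw [Finset.sum_mul, map_sum, Finset.sum_eq_single y⁻¹]
  · rw [smul_mul_assoc, map_smul, heckeCoeff_one_mul, inv_mul_cancel, if_pos rfl, permLength_inv,
      smul_eq_mul, mul_comm]
  · intro w _ hw
    rw [smul_mul_assoc, map_smul, heckeCoeff_one_mul, if_neg (fun e => hw
      (eq_inv_of_mul_eq_one_left e)), smul_zero]
  · simp

theorem v_ne_zero : v ≠ 0 := RatFunc.X_ne_zero

/-- The symmetrizing trace is nondegenerate. -/
theorem eq_of_heckeCoeff_one_mul {n : ℕ} {a b : Hecke n}
    (h : ∀ y, heckeCoeff 1 (a * heckeT n y) = heckeCoeff 1 (b * heckeT n y)) : a = b := by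
  rw [← sum_heckeCoeff a, ← sum_heckeCoeff b]
  refine Finset.sum_congr rfl fun w _ => ?_
  have := h w⁻¹
  rw [heckeCoeff_one_mul_heckeT, heckeCoeff_one_mul_heckeT, inv_inv] at this
  rw [mul_left_cancel₀ (pow_ne_zero _ v_ne_zero) this]

/-! ### Products of power sums -/

/-- Two finite families with the same multiset of values are rearrangements of each other. -/
theorem exists_equiv_of_map_univ_eq {ι κ α : Type*} [Fintype ι] [Fintype κ] {a : ι → α} {b : κ → α}
    (h : (Finset.univ : Finset ι).val.map a = (Finset.univ : Finset κ).val.map b) :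
    ∃ e : ι ≃ κ, ∀ i, b (e i) = a i := by
  classical
  have key : ∀ c, Nonempty ({i // a i = c} ≃ {k // b k = c}) := fun c => by
    refine Fintype.card_eq.1 ?_
    have := congrArg (Multiset.count c) h
    rw [Multiset.count_map, Multiset.count_map] at this
    rw [Fintype.card_subtype, Fintype.card_subtype]
    simpa only [eq_comm, Finset.card_def, Finset.filter_val] using this
  exact ⟨Equiv.ofFiberEquiv fun c => (key c).some, fun i => Equiv.ofFiberEquiv_map _ i⟩

/-- The multiset of nonzero exponents of a monomial. -/
def shape (m : ℕ →₀ ℕ) : Multiset ℕ := m.support.val.map m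

theorem pos_of_mem_shape {m : ℕ →₀ ℕ} {k : ℕ} (h : k ∈ shape m) : 0 < k := by
  obtain ⟨i, hi, rfl⟩ := Multiset.mem_map.1 h
  exact Nat.pos_of_ne_zero (Finsupp.mem_support_iff.1 hi)

theorem card_shape (m : ℕ →₀ ℕ) : Multiset.card (shape m) = m.support.card := by
  simp [shape]

theorem sum_shape (m : ℕ →₀ ℕ) : (shape m).sum = m.degree := rfl

/-! ### Fillings: distributing the parts `a b` over the variables, `g b` being the variable that
receives `a b` -/

section Fillings

variable {ι : Type*} [Fintype ι] {a : ι → ℕ} {m : ℕ →₀ ℕ}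

theorem sum_single_apply (g : ι → ℕ) (j : ℕ) :
    (∑ b, Finsupp.single (g b) (a b)) j = ∑ b with g b = j, a b := by
  rw [Finsupp.finsetSum_apply, Finset.sum_filter]
  simp [Finsupp.single_apply]

theorem support_eq_image {g : ι → ℕ} (ha : ∀ b, 0 < a b)
    (h : ∑ b, Finsupp.single (g b) (a b) = m) : m.support = Finset.univ.image g := by
  ext j
  rw [Finsupp.mem_support_iff, ← h, sum_single_apply, Ne, Finset.sum_eq_zero_iff]
  constructor
  · intro hj
    by_contra hn
    refine hj fun b hb => ?_
    exact absurd (Finset.mem_image.2 ⟨b, Finset.mem_univ _, (Finset.mem_filter.1 hb).2⟩) hn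
  · intro hj hz
    obtain ⟨b, -, hb⟩ := Finset.mem_image.1 hj
    exact (ha b).ne' (hz b (by simp [hb]))

theorem apply_of_injective {g : ι → ℕ} (hg : Function.Injective g)
    (h : ∑ b, Finsupp.single (g b) (a b) = m) (b : ι) : m (g b) = a b := by
  rw [← h, sum_single_apply, Finset.sum_eq_single b]
  · intro c hc hne
    exact absurd (hg (Finset.mem_filter.1 hc).2) hne
  · simp

theorem shape_eq_of_injective {g : ι → ℕ} (ha : ∀ b, 0 < a b) (hg : Function.Injective g)
    (h : ∑ b, Finsupp.single (g b) (a b) = m) :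
    shape m = (Finset.univ : Finset ι).val.map a := by
  rw [shape, support_eq_image ha h, Finset.image_val_of_injOn hg.injOn, Multiset.map_map]
  exact Multiset.map_congr rfl fun b _ => apply_of_injective hg h b

theorem exists_filling (h : shape m = (Finset.univ : Finset ι).val.map a) :
    ∃ g : ι → ℕ, Function.Injective g ∧ ∑ b, Finsupp.single (g b) (a b) = m := by
  have h1 : (Finset.univ : Finset m.support).val.map (fun j : m.support => m j.1) = shape m :=
    Multiset.attach_map_val' m.support.val m
  obtain ⟨e, he⟩ := exists_equiv_of_map_univ_eq (h1.trans h)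
  refine ⟨fun b => (e.symm b : ℕ), fun b c hbc => e.symm.injective (Subtype.ext hbc), ?_⟩
  rw [← Equiv.sum_comp e]
  simp only [Equiv.symm_apply_apply, he]
  conv_rhs => rw [← m.sum_single]
  exact Finset.sum_coe_sort m.support fun j => Finsupp.single j (m j)

/-- The coefficients of a product of power sums count fillings. -/
theorem coeff_prod_powerSum (ha : ∀ b, 0 < a b) :
    MvPowerSeries.coeff m (∏ b, powerSum (a b) : SymFun).1 =
      (Nat.card {g : ι → ℕ // ∑ b, Finsupp.single (g b) (a b) = m} : ℂ) := by
  classical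
  have h0 : (∏ b, powerSum (a b) : SymFun).1 = ∏ b, (powerSum (a b)).1 :=
    map_prod SymFun.val _ _
  have h1 : ∀ (l : ℕ →₀ ℕ) (k : ℕ), MvPowerSeries.coeff l (powerSum k).1 =
      if ∃ i, l = Finsupp.single i k then 1 else 0 := fun l k => by
    rw [powerSum, coeff_seriesOf]
  rw [h0, MvPowerSeries.coeff_prod]
  simp only [h1]
  have h2 : ∀ l : ι →₀ (ℕ →₀ ℕ),
      (∏ b, (if ∃ i, l b = Finsupp.single i (a b) then 1 else 0 : ℂ)) =
      if ∀ b, ∃ i, l b = Finsupp.single i (a b) then 1 else 0 := fun l => by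
    rw [Finset.prod_ite_zero]; simp
  simp only [h2]
  rw [Finset.sum_boole, ← Nat.card_eq_finsetCard]
  -- Expanding the product means choosing one variable from each factor. Positivity of `a b` makes
  -- the choice recoverable from the monomials.
  refine congrArg Nat.cast (Nat.card_eq_of_bijective
    (fun g : {g : ι → ℕ // ∑ b, Finsupp.single (g b) (a b) = m} =>
    (⟨Finsupp.equivFunOnFinite.symm fun b => Finsupp.single (g.1 b) (a b), ?_⟩ : {l // l ∈ _}))
    ⟨?_, ?_⟩).symm
  · rw [Finset.mem_filter, Finset.mem_finsuppAntidiag]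
    exact ⟨⟨g.2, Finset.subset_univ _⟩, fun b => ⟨g.1 b, rfl⟩⟩
  · rintro ⟨g, hg⟩ ⟨g', hg'⟩ h
    refine Subtype.ext (funext fun b => ?_)
    have := DFunLike.congr_fun (congrArg Subtype.val h) b
    exact (Finsupp.single_left_inj (ha b).ne').1 this
  · rintro ⟨l, hl⟩
    rw [Finset.mem_filter, Finset.mem_finsuppAntidiag] at hl
    obtain ⟨⟨hl, -⟩, hl'⟩ := hl
    choose g hg using hl'
    have hlg : l = Finsupp.equivFunOnFinite.symm fun b => Finsupp.single (g b) (a b) := by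
      ext1 b
      rw [hg b]; rfl
    refine ⟨⟨g, ?_⟩, Subtype.ext hlg.symm⟩
    rw [← hl]
    exact Finset.sum_congr rfl fun b _ => (hg b).symm

/-- This is the source of all triangularity. Either the filling is injective and the exponents are
the parts themselves, or two parts share a variable and fewer variables occur. -/
theorem card_support_lt_or_shape_eq {g : ι → ℕ} (ha : ∀ b, 0 < a b)
    (h : ∑ b, Finsupp.single (g b) (a b) = m) :
    m.support.card < Fintype.card ι ∨ shape m = (Finset.univ : Finset ι).val.map a := by
  have h1 := support_eq_image ha h
  rcases (Finset.card_image_le (s := Finset.univ) (f := g)).lt_or_eq with h2 | h2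
  · left; rwa [h1]
  · right
    exact shape_eq_of_injective ha (fun x y hxy =>
      Finset.card_image_iff.1 h2 (Finset.mem_univ _) (Finset.mem_univ _) hxy) h

/-- The number of variables forces every filling to be injective. Any two then differ by a unique
permutation of the parts preserving their sizes, so the count is the order of the stabilizer of `a`.
-/
theorem card_fillings (ha : ∀ b, 0 < a b) (h : shape m = (Finset.univ : Finset ι).val.map a) :
    Nat.card {g : ι → ℕ // ∑ b, Finsupp.single (g b) (a b) = m} =
      ∏ k ∈ (shape m).toFinset, ((shape m).count k).factorial := by
  classical
  obtain ⟨g₀, hg₀, h₀⟩ := exists_filling h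
  have hinj : ∀ g : ι → ℕ, ∑ b, Finsupp.single (g b) (a b) = m → Function.Injective g := by
    intro g hg x y hxy
    have h1 := support_eq_image ha hg
    have h2 := congrArg Finset.card h1
    rw [← card_shape, h, Multiset.card_map] at h2
    exact Finset.card_image_iff.1 h2.symm (Finset.mem_univ _) (Finset.mem_univ _) hxy
  have hcard : Fintype.card {σ : Equiv.Perm ι // a ∘ σ = a} =
      ∏ k ∈ (shape m).toFinset, ((shape m).count k).factorial := by
    rw [DomMulAct.stabilizer_card', h]
    have : ((Finset.univ : Finset ι).val.map a).toFinset = Finset.univ.image a := rfl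
    rw [this]
    refine Finset.prod_congr rfl fun k _ => ?_
    rw [Multiset.count_map, Fintype.card_subtype]
    simp only [eq_comm, Finset.card_def, Finset.filter_val]
  rw [← hcard, ← Nat.card_eq_fintype_card]
  refine (Nat.card_eq_of_bijective (fun σ : {σ : Equiv.Perm ι // a ∘ σ = a} =>
    (⟨g₀ ∘ σ.1, ?_⟩ : {g : ι → ℕ // ∑ b, Finsupp.single (g b) (a b) = m})) ⟨?_, ?_⟩).symm
  · rw [← h₀, ← Equiv.sum_comp σ.1 fun b => Finsupp.single (g₀ b) (a b)]
    refine Finset.sum_congr rfl fun b _ => ?_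
    have := congrFun σ.2 b
    simp only [Function.comp_apply] at this ⊢
    rw [this]
  · rintro ⟨σ, hσ⟩ ⟨τ, hτ⟩ hst
    refine Subtype.ext (Equiv.ext fun b => hg₀ ?_)
    exact congrFun (congrArg Subtype.val hst) b
  · rintro ⟨g, hg⟩
    have hs : ∀ b, ∃ c, g₀ c = g b := fun b => by
      have : g b ∈ m.support := by
        rw [support_eq_image ha hg]; exact Finset.mem_image_of_mem _ (Finset.mem_univ _)
      rw [support_eq_image ha h₀] at this
      obtain ⟨c, -, hc⟩ := Finset.mem_image.1 this
      exact ⟨c, hc⟩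
    choose s hs using hs
    have hsinj : Function.Injective s := fun x y hxy => hinj g hg (by rw [← hs, ← hs, hxy])
    refine ⟨⟨Equiv.ofBijective s (Finite.injective_iff_bijective.1 hsinj), funext fun b => ?_⟩,
      Subtype.ext (funext fun b => hs b)⟩
    simp only [Function.comp_apply, Equiv.ofBijective_apply]
    rw [← apply_of_injective hg₀ h₀, hs, apply_of_injective (hinj g hg) hg]

end Fillings

/-- The product of the power sums over a multiset. -/
def powerProd (s : Multiset ℕ) : SymFun := (s.map powerSum).prod

theorem exists_enumeration (s : Multiset ℕ) :
    ∃ a : Fin (Multiset.card s) → ℕ, s = (Finset.univ : Finset _).val.map a := by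
  induction s using Quotient.inductionOn with
  | _ l =>
    refine ⟨fun i => l.get i, ?_⟩
    rw [Fin.univ_val_map]
    simp

theorem powerProd_map {ι : Type*} [Fintype ι] (a : ι → ℕ) :
    powerProd ((Finset.univ : Finset ι).val.map a) = ∏ b, powerSum (a b) := by
  rw [powerProd, Multiset.map_map]; rfl

theorem coeff_powerProd_ne_zero {s : Multiset ℕ} (hs : ∀ k ∈ s, 0 < k) {m : ℕ →₀ ℕ}
    (h : MvPowerSeries.coeff m (powerProd s).1 ≠ 0) :
    m.degree = s.sum ∧ (m.support.card < Multiset.card s ∨ shape m = s) := by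
  obtain ⟨a, ha⟩ := exists_enumeration s
  have hpos : ∀ b, 0 < a b := fun b => hs _ (by
    rw [ha]; exact Multiset.mem_map_of_mem _ (Finset.mem_univ_val b))
  have hp : powerProd s = ∏ b, powerSum (a b) := by rw [← powerProd_map, ← ha]
  rw [hp, coeff_prod_powerSum hpos, Nat.cast_ne_zero] at h
  obtain ⟨⟨g, hg⟩⟩ : Nonempty {g : Fin (Multiset.card s) → ℕ //
      ∑ b, Finsupp.single (g b) (a b) = m} := (Nat.card_ne_zero.1 h).1
  refine ⟨?_, ?_⟩
  · rw [← hg, map_sum]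
    conv_rhs => rw [ha]
    change _ = ∑ b, a b
    simp
  · have := card_support_lt_or_shape_eq hpos hg
    rwa [Fintype.card_fin, ← ha] at this

/-- `∏ m_i !` for the multiplicities `m_i` of a multiset. -/
def multFactorial (s : Multiset ℕ) : ℕ := ∏ k ∈ s.toFinset, (s.count k).factorial

theorem multFactorial_ne_zero (s : Multiset ℕ) : multFactorial s ≠ 0 :=
  Finset.prod_ne_zero_iff.2 fun _ _ => Nat.factorial_ne_zero _

theorem coeff_powerProd_shape (m : ℕ →₀ ℕ) :
    MvPowerSeries.coeff m (powerProd (shape m)).1 = (multFactorial (shape m) : ℂ) := by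
  obtain ⟨a, ha⟩ := exists_enumeration (shape m)
  have hpos : ∀ b, 0 < a b := fun b => pos_of_mem_shape (m := m) (by
    rw [ha]; exact Multiset.mem_map_of_mem _ (Finset.mem_univ_val b))
  have hp : powerProd (shape m) = ∏ b, powerSum (a b) := by rw [← powerProd_map, ← ha]
  rw [hp, coeff_prod_powerSum hpos, card_fillings hpos ha, multFactorial]

theorem exists_shape_eq {s : Multiset ℕ} (hs : ∀ k ∈ s, 0 < k) : ∃ m, shape m = s := by
  obtain ⟨a, ha⟩ := exists_enumeration s
  refine ⟨∑ b : Fin _, Finsupp.single (b : ℕ) (a b), ?_⟩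
  conv_rhs => rw [ha]
  exact shape_eq_of_injective (fun b => hs _ (by
    rw [ha]; exact Multiset.mem_map_of_mem _ (Finset.mem_univ_val b))) Fin.val_injective rfl

/-- A monomial with the given multiset of nonzero exponents. -/
def expVec {n : ℕ} (mu : n.Partition) : ℕ →₀ ℕ :=
  (exists_shape_eq (s := mu.parts) fun _ h => mu.parts_pos h).choose

theorem shape_expVec {n : ℕ} (mu : n.Partition) : shape (expVec mu) = mu.parts :=
  (exists_shape_eq (s := mu.parts) fun _ h => mu.parts_pos h).choose_spec

theorem degree_expVec {n : ℕ} (mu : n.Partition) : (expVec mu).degree = n := by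
  rw [← sum_shape, shape_expVec, mu.parts_sum]

/-- Both monomials arise from one enumeration of the parts by injections into `ℕ`. Since their
domain is finite, some permutation of all variables carries one injection to the other. -/
theorem coeff_eq_of_shape_eq (F : SymFun) {m m' : ℕ →₀ ℕ} (h : shape m = shape m') :
    MvPowerSeries.coeff m F.1 = MvPowerSeries.coeff m' F.1 := by
  obtain ⟨a, ha⟩ := exists_enumeration (shape m)
  obtain ⟨g, hg, hm⟩ := exists_filling ha
  obtain ⟨g', hg', hm'⟩ := exists_filling (h.symm.trans ha)
  obtain ⟨σ, hσ⟩ := Equiv.Perm.exists_extending_pair g g' hg hg'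
  have : m' = m.embDomain σ.toEmbedding := by
    rw [Finsupp.embDomain_eq_mapDomain, ← hm, ← hm', Finsupp.mapDomain_finsetSum]
    refine Finset.sum_congr rfl fun b _ => ?_
    rw [Finsupp.mapDomain_single, ← hσ]; rfl
  rw [this]
  conv_rhs => rw [← F.2.1 σ]
  exact (MvPowerSeries.coeff_embDomain_rename σ.toEmbedding F.1 m).symm

theorem coeff_monomialSym {n : ℕ} (lam : n.Partition) (m : ℕ →₀ ℕ) :
    MvPowerSeries.coeff m (monomialSym lam).1 = if shape m = lam.parts then 1 else 0 := by
  rw [monomialSym, coeff_seriesOf]; rfl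

/-- The expansion of a symmetric function in monomial symmetric functions. -/
theorem eq_sum_monomialSym (F : SymFun) {d : ℕ}
    (hd : ∀ m, MvPowerSeries.coeff m F.1 ≠ 0 → m.degree ≤ d) :
    F = ∑ n ∈ Finset.range (d + 1), ∑ mu : n.Partition,
      MvPowerSeries.coeff (expVec mu) F.1 • monomialSym mu := by
  refine Subtype.ext (MvPowerSeries.ext fun m => ?_)
  have h0 : ∀ n (mu : n.Partition), shape m = mu.parts → m.degree = n := fun n mu h => by
    rw [← sum_shape, h, mu.parts_sum]
  have h1 : ∀ (s : Finset ℕ), MvPowerSeries.coeff m (∑ n ∈ s, ∑ mu : n.Partition,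
      MvPowerSeries.coeff (expVec mu) F.1 • monomialSym mu : SymFun).1 =
      ∑ n ∈ s, ∑ mu : n.Partition, MvPowerSeries.coeff (expVec mu) F.1 *
        if shape m = mu.parts then 1 else 0 := fun s => by
    simp only [← coeff_monomialSym]
    simp [map_sum]
  rw [h1]
  by_cases hm : m.degree ≤ d
  · rw [Finset.sum_eq_single m.degree, Finset.sum_eq_single
      (⟨shape m, pos_of_mem_shape, sum_shape m⟩ : m.degree.Partition)]
    · rw [if_pos rfl, mul_one]
      exact coeff_eq_of_shape_eq F
        (shape_expVec (⟨shape m, pos_of_mem_shape, sum_shape m⟩ : m.degree.Partition)).symm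
    · intro mu _ hmu
      rw [if_neg fun h => hmu (Nat.Partition.ext h.symm), mul_zero]
    · simp
    · intro n _ hn
      exact Finset.sum_eq_zero fun mu _ => by rw [if_neg fun h => hn (h0 n mu h).symm, mul_zero]
    · intro h
      exact absurd (Finset.mem_range.2 (by omega)) h
  · have : MvPowerSeries.coeff m F.1 = 0 := by
      by_contra h; exact hm (hd m h)
    rw [this]
    refine (Finset.sum_eq_zero fun n hn => Finset.sum_eq_zero fun mu _ => ?_).symm
    rw [if_neg fun h => hm ?_, mul_zero]
    have := h0 n mu h
    have := Finset.mem_range.1 hn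
    omega

theorem powerSumPart_eq {n : ℕ} (lam : n.Partition) : powerSumPart lam = powerProd lam.parts := rfl

/-- The coefficient of `p_lam` at the monomial `x ^ mu`. -/
def powerCoeff {n : ℕ} (lam mu : n.Partition) : ℂ :=
  MvPowerSeries.coeff (expVec mu) (powerSumPart lam).1

theorem powerCoeff_self {n : ℕ} (lam : n.Partition) :
    powerCoeff lam lam = multFactorial lam.parts := by
  have := coeff_powerProd_shape (expVec lam)
  rwa [shape_expVec] at this

/-- Unitriangularity, up to the diagonal entries `∏ m_i!`, with respect to the number of parts. -/
theorem powerCoeff_ne_zero {n : ℕ} {lam mu : n.Partition} (h : powerCoeff lam mu ≠ 0) :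
    partLength mu < partLength lam ∨ mu = lam := by
  have := (coeff_powerProd_ne_zero (fun _ h => lam.parts_pos h) h).2
  rw [← card_shape, shape_expVec] at this
  exact this.imp id fun h => Nat.Partition.ext h

theorem powerSumPart_expand {n : ℕ} (lam : n.Partition) :
    powerSumPart lam = ∑ mu : n.Partition, powerCoeff lam mu • monomialSym mu := by
  have hn : ∀ m, MvPowerSeries.coeff m (powerSumPart lam).1 ≠ 0 → m.degree = n := fun m h => by
    rw [(coeff_powerProd_ne_zero (fun _ h => lam.parts_pos h) h).1, lam.parts_sum]
  rw [eq_sum_monomialSym _ fun m h => (hn m h).le, Finset.sum_eq_single n]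
  · rfl
  · intro k _ hk
    refine Finset.sum_eq_zero fun mu _ => ?_
    have : MvPowerSeries.coeff (expVec mu) (powerSumPart lam).1 = 0 := by
      by_contra h; exact hk ((degree_expVec mu).symm.trans (hn _ h))
    rw [this, zero_smul]
  · intro h; exact absurd (Finset.self_mem_range_succ n) h

/-- The leading term of `m_lam` in the power sums. -/
theorem monomialSym_sub_mem_span {n : ℕ} (lam : n.Partition) :
    monomialSym lam - (multFactorial lam.parts : ℂ)⁻¹ • powerSumPart lam ∈
      Submodule.span ℂ (powerSumPart '' {mu : n.Partition | partLength mu < partLength lam}) := by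
  induction hk : partLength lam using Nat.strong_induction_on generalizing lam with
  | _ k ih =>
    subst hk
    have hc : (multFactorial lam.parts : ℂ) ≠ 0 := Nat.cast_ne_zero.2 (multFactorial_ne_zero _)
    have hS : ∑ mu ∈ Finset.univ.erase lam, powerCoeff lam mu • monomialSym mu ∈
        Submodule.span ℂ
          (powerSumPart '' {mu : n.Partition | partLength mu < partLength lam}) := by
      refine Submodule.sum_mem _ fun mu hmu => ?_
      by_cases h0 : powerCoeff lam mu = 0
      · rw [h0, zero_smul]; exact Submodule.zero_mem _
      · have hlt := (powerCoeff_ne_zero h0).resolve_right (Finset.ne_of_mem_erase hmu)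
        refine Submodule.smul_mem _ _ ?_
        have h1 : _ ∈ Submodule.span ℂ (powerSumPart ''
            {mu : n.Partition | partLength mu < partLength lam}) :=
          Submodule.span_mono (R := ℂ) (Set.image_mono (f := powerSumPart)
          fun nu (hnu : partLength nu < partLength mu) => hnu.trans hlt) (ih _ hlt mu rfl)
        have h2 : (multFactorial mu.parts : ℂ)⁻¹ • powerSumPart mu ∈ Submodule.span ℂ
            (powerSumPart '' {mu : n.Partition | partLength mu < partLength lam}) :=
          Submodule.smul_mem _ _ (Submodule.subset_span ⟨mu, hlt, rfl⟩)
        have h3 := Submodule.add_mem _ h1 h2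
        rwa [sub_add_cancel] at h3
    have e : monomialSym lam - (multFactorial lam.parts : ℂ)⁻¹ • powerSumPart lam =
        -(multFactorial lam.parts : ℂ)⁻¹ •
          ∑ mu ∈ Finset.univ.erase lam, powerCoeff lam mu • monomialSym mu := by
      rw [powerSumPart_expand lam, ← Finset.add_sum_erase _ _ (Finset.mem_univ lam),
        powerCoeff_self, smul_add, smul_smul, inv_mul_cancel₀ hc, one_smul, neg_smul]
      abel
    rw [e]
    exact Submodule.smul_mem _ _ hS

/-- The matrix of coefficients of the power sums is invertible. -/
theorem powerCoeff_det_ne_zero (n : ℕ) :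
    (Matrix.of (powerCoeff (n := n))).det ≠ 0 := by
  classical
  rw [Ne, ← Matrix.exists_vecMul_eq_zero_iff]
  rintro ⟨x, hx, h⟩
  -- In the column of a `lam` with the most parts among the nonzero entries of the kernel vector,
  -- triangularity leaves only the diagonal term.
  obtain ⟨lam, hlam, hmax⟩ := Finset.exists_max_image (Finset.univ.filter fun l => x l ≠ 0)
    partLength (by
      obtain ⟨l, hl⟩ := Function.ne_iff.1 hx
      exact ⟨l, by simpa using hl⟩)
  have := congrFun h lam
  rw [Matrix.vecMul, dotProduct, Finset.sum_eq_single lam] at this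
  · simp only [Matrix.of_apply, powerCoeff_self, Pi.zero_apply, mul_eq_zero,
      Nat.cast_eq_zero] at this
    rcases this with h | h
    · exact (Finset.mem_filter.1 hlam).2 h
    · exact multFactorial_ne_zero _ h
  · intro mu _ hmu
    by_contra hne
    rw [Matrix.of_apply] at hne
    have h1 := hmax mu (by simpa using left_ne_zero_of_mul hne)
    have h2 := powerCoeff_ne_zero (right_ne_zero_of_mul hne)
    rcases h2 with h2 | h2
    · omega
    · exact hmu h2.symm
  · simp

/-! ### Power sums generate the symmetric functions freely -/

/-- The multiset of indices of a monomial in the power sums. -/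
def indexMultiset (σ : ℕ+ →₀ ℕ) : Multiset ℕ := (Finsupp.toMultiset σ).map PNat.val

theorem indexMultiset_injective : Function.Injective indexMultiset :=
  (Multiset.map_injective PNat.coe_injective).comp Multiset.toFinsupp.symm.injective

theorem pos_of_mem_indexMultiset {σ : ℕ+ →₀ ℕ} {k : ℕ} (h : k ∈ indexMultiset σ) : 0 < k := by
  obtain ⟨i, -, rfl⟩ := Multiset.mem_map.1 h
  exact i.pos

theorem prod_powerSum_eq (σ : ℕ+ →₀ ℕ) :
    (σ.prod fun k e => powerSum k ^ e) = powerProd (indexMultiset σ) := by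
  rw [powerProd, indexMultiset, Multiset.map_map, Finsupp.toMultiset_map, Finsupp.prod_toMultiset,
    Finsupp.prod_mapDomain_index (fun _ => pow_zero _) fun _ _ _ => pow_add _ _ _]
  rfl

/-- Among the monomials of a nonzero polynomial take one with the most factors. The monomial in the
`x_i` whose exponents are its indices occurs in no other product of power sums present, again by
triangularity. -/
theorem aeval_powerSum_injective :
    Function.Injective (MvPolynomial.aeval (R := ℂ) fun k : ℕ+ => powerSum k) := by
  rw [injective_iff_map_eq_zero]
  intro P hP
  by_contra hne
  obtain ⟨σ, hσ, hmax⟩ := Finset.exists_max_image P.support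
    (fun σ => Multiset.card (indexMultiset σ)) (MvPolynomial.support_nonempty.2 hne)
  obtain ⟨m, hm⟩ := exists_shape_eq fun k => pos_of_mem_indexMultiset (σ := σ) (k := k)
  have h1 : MvPolynomial.aeval (fun k : ℕ+ => powerSum k) P =
      ∑ τ ∈ P.support, P.coeff τ • powerProd (indexMultiset τ) := by
    conv_lhs => rw [P.as_sum, map_sum]
    refine Finset.sum_congr rfl fun τ _ => ?_
    rw [MvPolynomial.aeval_monomial, prod_powerSum_eq, Algebra.smul_def]
  have h2 := congrArg (fun F : SymFun => MvPowerSeries.coeff m F.1) (h1.symm.trans hP)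
  have h3 : MvPowerSeries.coeff m (∑ τ ∈ P.support, P.coeff τ • powerProd (indexMultiset τ) :
      SymFun).1 = ∑ τ ∈ P.support, P.coeff τ *
        MvPowerSeries.coeff m (powerProd (indexMultiset τ)).1 := by simp [map_sum]
  simp only [h3] at h2
  rw [Finset.sum_eq_single σ] at h2
  · rw [← hm, coeff_powerProd_shape] at h2
    rcases mul_eq_zero.1 (h2.trans (map_zero _)) with h | h
    · exact MvPolynomial.mem_support_iff.1 hσ h
    · exact multFactorial_ne_zero _ (Nat.cast_eq_zero.1 h)
  · intro τ hτ hτσ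
    by_contra hne
    have h4 := (coeff_powerProd_ne_zero (fun _ => pos_of_mem_indexMultiset)
      (right_ne_zero_of_mul hne)).2
    rw [← card_shape, hm] at h4
    have h5 := hmax τ hτ
    rcases h4 with h4 | h4
    · omega
    · exact hτσ (indexMultiset_injective h4.symm)
  · exact fun h => absurd hσ h

theorem powerSumPart_mem_range {n : ℕ} (lam : n.Partition) :
    powerSumPart lam ∈ (MvPolynomial.aeval (R := ℂ) fun k : ℕ+ => powerSum k).range := by
  refine Subalgebra.multiset_prod_mem _ fun F hF => ?_
  obtain ⟨k, hk, rfl⟩ := Multiset.mem_map.1 hF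
  exact ⟨MvPolynomial.X ⟨k, lam.parts_pos hk⟩, MvPolynomial.aeval_X _ _⟩

/-- The `m_μ` span, and each differs from a multiple of `p_μ` by a combination of power sum
products. -/
theorem aeval_powerSum_surjective :
    Function.Surjective (MvPolynomial.aeval (R := ℂ) fun k : ℕ+ => powerSum k) := by
  rw [← AlgHom.range_eq_top, eq_top_iff]
  intro F _
  obtain ⟨d, hd⟩ := F.2.2
  rw [eq_sum_monomialSym F hd]
  refine Subalgebra.sum_mem _ fun n _ => Subalgebra.sum_mem _ fun mu _ =>
    Subalgebra.smul_mem _ ?_ _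
  rw [← sub_add_cancel (monomialSym mu) ((multFactorial mu.parts : ℂ)⁻¹ • powerSumPart mu)]
  refine Subalgebra.add_mem _ ?_ (Subalgebra.smul_mem _ (powerSumPart_mem_range mu) _)
  have hle : Submodule.span ℂ (powerSumPart '' {nu : n.Partition | partLength nu < partLength mu}) ≤
      Subalgebra.toSubmodule (MvPolynomial.aeval (R := ℂ) fun k : ℕ+ => powerSum k).range := by
    rw [Submodule.span_le]
    rintro _ ⟨nu, -, rfl⟩
    exact powerSumPart_mem_range nu
  exact hle (monomialSym_sub_mem_span mu)

/-- This is the base change to `ℂ(v)` of the isomorphism between `ℂ[p_1, p_2, …]` and `Λ`. -/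
theorem aeval_powerSumV_bijective :
    Function.Bijective (MvPolynomial.aeval (R := Cv) powerSumV) := by
  let e : MvPolynomial ℕ+ ℂ ≃ₐ[ℂ] SymFun := AlgEquiv.ofBijective
    (MvPolynomial.aeval (R := ℂ) fun k : ℕ+ => powerSum k)
    ⟨aeval_powerSum_injective, aeval_powerSum_surjective⟩
  let E : MvPolynomial ℕ+ Cv ≃ₐ[Cv] SymFunV :=
    (MvPolynomial.algebraTensorAlgEquiv ℂ Cv).symm.trans
      (Algebra.TensorProduct.congr (AlgEquiv.refl (R := Cv)) e)
  have : MvPolynomial.aeval (R := Cv) powerSumV = E.toAlgHom := by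
    refine MvPolynomial.algHom_ext fun k => ?_
    have h1 : E (MvPolynomial.X k) =
        1 ⊗ₜ MvPolynomial.aeval (R := ℂ) (fun k : ℕ+ => powerSum k) (MvPolynomial.X k) := by
      rw [AlgEquiv.trans_apply, MvPolynomial.algebraTensorAlgEquiv_symm_X]
      rfl
    rw [MvPolynomial.aeval_X]
    refine Eq.trans ?_ h1.symm
    rw [MvPolynomial.aeval_X]
    rfl
  rw [this]
  exact E.bijective

/-- The `λ`-ring substitution `x ↦ x / (v - 1)` as an algebra homomorphism. -/
theorem exists_substDiv_algHom : ∃ D : SymFunV →ₐ[Cv] SymFunV,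
    (∀ F, substDiv F = D F) ∧
    ∀ k : ℕ+, D (powerSumV k) = (v ^ (k : ℕ) - 1)⁻¹ • powerSumV k := by
  let E : MvPolynomial ℕ+ Cv ≃ₐ[Cv] SymFunV := AlgEquiv.ofBijective _ aeval_powerSumV_bijective
  refine ⟨(MvPolynomial.aeval fun k : ℕ+ => (v ^ (k : ℕ) - 1)⁻¹ • powerSumV k).comp
    E.symm.toAlgHom, fun F => ?_, fun k => ?_⟩
  -- The chosen expression is a preimage of `F`, and by bijectivity there is only one.
  · have h : MvPolynomial.aeval powerSumV (powerSumExpression F) = F :=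
      Classical.epsilon_spec (p := fun P => MvPolynomial.aeval powerSumV P = F)
        (aeval_powerSumV_bijective.2 F)
    have h' : E.symm F = powerSumExpression F := by
      rw [AlgEquiv.symm_apply_eq]; exact h.symm
    simp [substDiv, h']
  · have h' : E.symm (powerSumV k) = MvPolynomial.X k := by
      rw [AlgEquiv.symm_apply_eq]; simp [E]
    simp [h']

/-! ### Block rotations -/

/-- The permutation rotating each block of a composition by one step. -/
def blockCycle {n : ℕ} (c : Composition n) : Equiv.Perm (Fin n) :=
  c.blocksFinEquiv.permCongr (Equiv.sigmaCongrRight fun i => finRotate (c.blocksFun i))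

theorem cyclePerm_eq {n : ℕ} (lam : n.Partition) :
    cyclePerm lam = blockCycle (partComposition lam) := rfl

theorem coe_finRotate_eq {k : ℕ} (t : Fin k) :
    (finRotate k t : ℕ) = if (t : ℕ) + 1 < k then (t : ℕ) + 1 else 0 := by
  cases k with
  | zero => exact t.elim0
  | succ k =>
    by_cases h : t = Fin.last k
    · subst h; simp
    · have h' : (t : ℕ) ≠ k := fun e => h (Fin.ext e)
      rw [coe_finRotate_of_ne_last h, if_pos (by omega)]

theorem blockCycle_embedding {n : ℕ} (c : Composition n) (b : Fin c.length)
    (t : Fin (c.blocksFun b)) :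
    blockCycle c (c.embedding b t) = c.embedding b (finRotate _ t) := by
  have : c.blocksFinEquiv.symm (c.embedding b t) = ⟨b, t⟩ := by
    rw [Equiv.symm_apply_eq]; rfl
  rw [blockCycle, Equiv.permCongr_apply, this]
  rfl

theorem exists_embedding {n : ℕ} (c : Composition n) (x : Fin n) :
    ∃ b t, x = c.embedding b t := ⟨_, _, (c.embedding_comp_inv x).symm⟩

theorem map_blocksFun {n : ℕ} (c : Composition n) :
    (Finset.univ : Finset (Fin c.length)).val.map c.blocksFun = (c.blocks : Multiset ℕ) := by
  rw [Fin.univ_val_map, c.ofFn_blocksFun]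

theorem coe_blocks_partComposition {n : ℕ} (lam : n.Partition) :
    ((partComposition lam).blocks : Multiset ℕ) = lam.parts := Multiset.sort_eq _ _

/-- The indices of the simple transpositions inside the blocks of a composition. -/
def blockSteps {n : ℕ} (c : Composition n) : Finset (Fin (n - 1)) :=
  {j | (hi j).castSucc ∉ c.boundaries}

theorem mem_boundaries_iff {n : ℕ} (c : Composition n) (x : Fin (n + 1)) :
    x ∈ c.boundaries ↔ ∃ i : Fin (c.length + 1), c.sizeUpTo i = x := by
  simp only [Composition.boundaries, Finset.mem_map, Finset.mem_univ, true_and, Fin.ext_iff]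
  rfl

/-- The transposition of `x` and `x + 1` stays inside a block unless `x + 1` starts a new block,
that is, unless `x` is the last place of its block. -/
theorem mem_blockSteps_iff {n : ℕ} (c : Composition n) {j : Fin (n - 1)} {b : Fin c.length}
    {t : Fin (c.blocksFun b)} (h : lo j = c.embedding b t) :
    j ∈ blockSteps c ↔ (t : ℕ) + 1 < c.blocksFun b := by
  have h' : (j : ℕ) = c.sizeUpTo b + t := by
    have := congrArg Fin.val h
    rwa [c.coe_embedding] at this
  have hs := c.sizeUpTo_succ' b
  rw [blockSteps, Finset.mem_filter, mem_boundaries_iff]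
  simp only [Finset.mem_univ, true_and, not_exists, Fin.val_castSucc]
  change (∀ i : Fin (c.length + 1), c.sizeUpTo i ≠ (j : ℕ) + 1) ↔ _
  constructor
  · intro hj
    have := hj b.succ
    rw [Fin.val_succ, hs] at this
    have := t.2
    omega
  · intro ht i hi'
    rcases le_or_gt (i : ℕ) b with hib | hib
    · have := c.monotone_sizeUpTo hib
      omega
    · have : c.sizeUpTo (b + 1) ≤ c.sizeUpTo i := c.monotone_sizeUpTo hib
      omega

/-- The generators left out of `J` mark the cuts between consecutive blocks, whence the complement.
-/
theorem exists_blockSteps_eq {n : ℕ} (J : Finset (Fin (n - 1))) :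
    ∃ c : Composition n, blockSteps c = J := by
  refine ⟨((compositionAsSetEquiv n).symm Jᶜ).toComposition, ?_⟩
  ext j
  rw [blockSteps, Finset.mem_filter, CompositionAsSet.toComposition_boundaries]
  have h1 : j ∈ compositionAsSetEquiv n ((compositionAsSetEquiv n).symm Jᶜ) ↔ j ∈ Jᶜ := by
    rw [Equiv.apply_symm_apply]
  have h2 : j ∈ compositionAsSetEquiv n ((compositionAsSetEquiv n).symm Jᶜ) ↔
      (hi j).castSucc ∈ ((compositionAsSetEquiv n).symm Jᶜ).boundaries := by
    simp only [compositionAsSetEquiv, Equiv.coe_fn_mk, Set.mem_toFinset, Set.mem_ofPred_eq]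
    have : (⟨1 + (j : ℕ), by omega⟩ : Fin n.succ) = (hi j).castSucc := by
      ext; simp [hi, add_comm]
    rw [this]
  rw [← h2, h1]
  simp

/-! ### Words in distinct generators -/

theorem simpleSwap_le_iff {n : ℕ} {i j : Fin (n - 1)} (h : i ≠ j) (x : Fin n) :
    (simpleSwap n i x : ℕ) ≤ j ↔ (x : ℕ) ≤ j := by
  have : (i : ℕ) ≠ j := fun e => h (Fin.ext e)
  rw [simpleSwap_eq, Equiv.swap_apply_def]
  split_ifs with h1 h2
  · subst h1; simp only [lo, hi]; omega
  · subst h2; simp only [lo, hi]; omega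
  · rfl

theorem wordPerm_le_iff {n : ℕ} {l : List (Fin (n - 1))} {j : Fin (n - 1)} (h : j ∉ l) (x : Fin n) :
    (wordPerm n l x : ℕ) ≤ j ↔ (x : ℕ) ≤ j := by
  induction l with
  | nil => simp
  | cons i l ih =>
    rw [List.mem_cons, not_or] at h
    rw [wordPerm_cons, Equiv.Perm.mul_apply, simpleSwap_le_iff (Ne.symm h.1), ih h.2]

/-- Such words are reduced. Before `s_j` is appended, the permutation preserves the set of letters
`≤ j`, so it has no descent at `j`. -/
theorem heckeWord_eq_heckeT_of_nodup {n : ℕ} {l : List (Fin (n - 1))} (h : l.Nodup) :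
    heckeWord n l = heckeT n (wordPerm n l) := by
  induction l using List.reverseRecOn with
  | nil => simp
  | append_singleton l j ih =>
    obtain ⟨h1, -, h2⟩ := List.nodup_append.1 h
    have hj : j ∉ l := fun hl => h2 j hl j (by simp) rfl
    rw [heckeWord_append, ih h1, wordPerm_append]
    simp only [heckeWord_cons, heckeWord_nil, mul_one, wordPerm_cons, wordPerm_nil]
    rw [heckeT_mul_heckeGen_of_lt]
    have e1 := (wordPerm_le_iff hj (lo j)).2 (by simp [lo])
    have e2 := mt (wordPerm_le_iff hj (hi j)).1 (by simp [hi])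
    rw [Fin.lt_def]
    omega

theorem wordPerm_of_lt {n : ℕ} {l : List (Fin (n - 1))} {x : Fin n}
    (h : ∀ j ∈ l, (x : ℕ) < j) : wordPerm n l x = x := by
  induction l with
  | nil => simp
  | cons i l ih =>
    have := h i (by simp)
    rw [wordPerm_cons, Equiv.Perm.mul_apply, ih fun j hj => h j (by simp [hj])]
    apply simpleSwap_of_ne <;> omega

/-- The rightmost, hence largest, transposition acts first: those beyond `j` fix the letter `j`,
then `s_j` moves it up, and the smaller ones fix `j + 1`. -/
theorem wordPerm_lo_of_mem {n : ℕ} {l : List (Fin (n - 1))} (hl : l.Pairwise (· < ·))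
    {j : Fin (n - 1)} (hj : j ∈ l) : wordPerm n l (lo j) = hi j := by
  induction l with
  | nil => simp at hj
  | cons i l ih =>
    rw [List.pairwise_cons] at hl
    rw [wordPerm_cons, Equiv.Perm.mul_apply]
    rcases List.mem_cons.1 hj with rfl | hj
    · rw [wordPerm_of_lt fun k hk => hl.1 k hk, simpleSwap_lo]
    · have : (i : ℕ) < j := hl.1 j hj
      rw [ih hl.2 hj]
      apply simpleSwap_of_ne <;> simp only [hi] <;> omega

/-- Here `a` and `x` are the first and the last letter of a block: the successive transpositions
carry `x` down step by step to `a`. -/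
theorem wordPerm_of_interval {n : ℕ} {l : List (Fin (n - 1))} (hl : l.Pairwise (· < ·))
    {a x : Fin n} (hax : a ≤ x)
    (h1 : ∀ j : Fin (n - 1), (a : ℕ) ≤ j → (j : ℕ) < x → j ∈ l)
    (h2 : ∀ j ∈ l, (j : ℕ) ≠ x) (h3 : ∀ j ∈ l, (j : ℕ) + 1 ≠ a) : wordPerm n l x = a := by
  induction l generalizing a with
  | nil =>
    rcases hax.lt_or_eq with h | h
    · have := h1 ⟨a, by have := x.2; have : (a : ℕ) < x := h; omega⟩ le_rfl h
      simp at this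
    · simp [h]
  | cons i l ih =>
    rw [List.pairwise_cons] at hl
    rw [wordPerm_cons, Equiv.Perm.mul_apply]
    have hax' : (a : ℕ) ≤ x := hax
    have hix := h2 i (by simp)
    have hia := h3 i (by simp)
    by_cases hi' : (i : ℕ) = a
    · have hlt : (a : ℕ) < x := by omega
      have hil : lo i = a := Fin.ext hi'
      have e := ih hl.2 (a := hi i) (by rw [Fin.le_def]; simp only [hi]; omega) (fun j hj hjx => by
        simp only [hi] at hj
        refine (List.mem_cons.1 (h1 j (by omega) hjx)).resolve_left fun e => ?_
        rw [e] at hj; omega) (fun j hj => h2 j (by simp [hj])) (fun j hj => by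
          have : (i : ℕ) < j := hl.1 j hj
          simp only [hi]; omega)
      rw [e, simpleSwap_hi, hil]
    · rw [ih hl.2 hax (fun j hj hjx => ?_) (fun j hj => h2 j (by simp [hj]))
        (fun j hj => h3 j (by simp [hj]))]
      · apply simpleSwap_of_ne <;> omega
      -- If `j` were the head `i ≠ a`, then `a < j` would belong to the word as well, although the
      -- head of an increasing word is its least letter.
      · rcases List.mem_cons.1 (h1 j hj hjx) with rfl | h
        · have hm := h1 ⟨a, by have := x.2; omega⟩ le_rfl (by simp only; omega)
          rcases List.mem_cons.1 hm with e | hm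
          · exact absurd (congrArg Fin.val e).symm hi'
          · have : (j : ℕ) < a := hl.1 _ hm
            omega
        · exact h

/-- The increasing word in a set of generators. -/
def increasingWord {n : ℕ} (J : Finset (Fin (n - 1))) : List (Fin (n - 1)) := J.sort (· ≤ ·)

theorem increasingWord_pairwise {n : ℕ} (J : Finset (Fin (n - 1))) :
    (increasingWord J).Pairwise (· < ·) := (Finset.sortedLT_sort J).pairwise

theorem increasingWord_nodup {n : ℕ} (J : Finset (Fin (n - 1))) : (increasingWord J).Nodup :=
  Finset.sort_nodup _ _

theorem mem_increasingWord {n : ℕ} {J : Finset (Fin (n - 1))} {j : Fin (n - 1)} :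
    j ∈ increasingWord J ↔ j ∈ J := Finset.mem_sort _

theorem exists_lo_eq {n : ℕ} {x : Fin n} (h : (x : ℕ) + 1 < n) : ∃ j, lo j = x :=
  ⟨⟨x, by omega⟩, rfl⟩

theorem wordPerm_increasingWord {n : ℕ} (c : Composition n) :
    wordPerm n (increasingWord (blockSteps c)) = blockCycle c := by
  ext x
  obtain ⟨b, t, rfl⟩ := exists_embedding c x
  have hs := c.sizeUpTo_succ' b
  have hle := c.sizeUpTo_le (b + 1)
  have ht := t.2
  rw [blockCycle_embedding, c.coe_embedding, coe_finRotate_eq]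
  by_cases h : (t : ℕ) + 1 < c.blocksFun b
  · obtain ⟨j, hj⟩ := exists_lo_eq (x := c.embedding b t) (by rw [c.coe_embedding]; omega)
    rw [if_pos h, ← hj, wordPerm_lo_of_mem (increasingWord_pairwise _)
      (mem_increasingWord.2 ((mem_blockSteps_iff c hj).2 h))]
    have := congrArg Fin.val hj
    rw [c.coe_embedding] at this
    simp only [hi, lo] at *
    omega
  · rw [if_neg h, wordPerm_of_interval (a := c.embedding b ⟨0, by omega⟩)
      (increasingWord_pairwise _), c.coe_embedding]
    · rw [Fin.le_def, c.coe_embedding, c.coe_embedding]; simp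
    · intro j hj1 hj2
      rw [c.coe_embedding] at hj1 hj2
      simp only at hj1
      rw [mem_increasingWord, mem_blockSteps_iff c (b := b) (t := ⟨j - c.sizeUpTo b, by omega⟩)]
      · simp only; omega
      · ext; rw [c.coe_embedding]; simp only [lo]; omega
    · intro j hj hjx
      rw [mem_increasingWord, mem_blockSteps_iff c (b := b) (t := t) (Fin.ext hjx)] at hj
      exact h hj
    · intro j hj hja
      rw [mem_increasingWord, blockSteps, Finset.mem_filter, mem_boundaries_iff] at hj
      refine hj.2 ⟨b.castSucc, ?_⟩
      rw [c.coe_embedding] at hja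
      simp only [hi, Fin.val_castSucc]
      simp only at hja
      omega

/-! ### Conjugation of block rotations -/

theorem sub_mem_commutators {n : ℕ} (a b : Hecke n) : a * b - b * a ∈ commutators n :=
  Submodule.subset_span ⟨(a, b), rfl⟩

/-- Since `d s_j = s_{j'} d` and both products increase the length of `d`, both sides equal `T_{d
s_j}`. -/
theorem heckeT_mul_heckeGen_of_conj {n : ℕ} {d : Equiv.Perm (Fin n)} {j j' : Fin (n - 1)}
    (h : d (lo j) = lo j') (h' : d (hi j) = hi j') :
    heckeT n d * heckeGen n j = heckeGen n j' * heckeT n d := by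
  rw [heckeT_mul_heckeGen_of_lt (by rw [h, h']; exact lo_lt_hi j'),
    heckeGen_mul_heckeT_of_lt, simpleSwap_eq, simpleSwap_eq, Equiv.mul_swap_eq_swap_mul, h, h']
  have e1 : d⁻¹ (lo j') = lo j := by rw [Equiv.Perm.inv_eq_iff_eq, h]
  have e2 : d⁻¹ (hi j') = hi j := by rw [Equiv.Perm.inv_eq_iff_eq, h']
  rw [e1, e2]
  exact lo_lt_hi j

/-- When `d` sends the adjacent pairs used by the word to adjacent pairs in order, `T_d` passes
through it letter by letter. As `T_d` is a unit, the two elements are conjugate in the algebra and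
differ by a commutator. -/
theorem heckeT_conj_sub_mem_commutators {n : ℕ} (d : Equiv.Perm (Fin n)) {l : List (Fin (n - 1))}
    (hl : l.Nodup) (hd : ∀ j ∈ l, ∃ j', d (lo j) = lo j' ∧ d (hi j) = hi j') :
    heckeT n (d * wordPerm n l * d⁻¹) - heckeT n (wordPerm n l) ∈ commutators n := by
  have key : ∃ l' : List (Fin (n - 1)), l'.Nodup ∧
      (∀ j' ∈ l', ∃ j ∈ l, d (lo j) = lo j') ∧
      heckeT n d * heckeWord n l = heckeWord n l' * heckeT n d ∧
      d * wordPerm n l = wordPerm n l' * d := by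
    induction l with
    | nil => exact ⟨[], by simp⟩
    | cons j l ih =>
      rw [List.nodup_cons] at hl
      obtain ⟨l', hl', hm, h1, h2⟩ := ih hl.2 fun j hj => hd j (by simp [hj])
      obtain ⟨j', hj1, hj2⟩ := hd j (by simp)
      refine ⟨j' :: l', List.nodup_cons.2 ⟨fun hmem => ?_, hl'⟩, ?_, ?_, ?_⟩
      · obtain ⟨k, hk, hk'⟩ := hm j' hmem
        have : lo k = lo j := d.injective (hk'.trans hj1.symm)
        have e : k = j := Fin.ext (Fin.mk.inj_iff.1 this)
        exact hl.1 (e ▸ hk)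
      · intro k hk
        rcases List.mem_cons.1 hk with rfl | hk
        · exact ⟨j, by simp, hj1⟩
        · obtain ⟨i, hi1, hi2⟩ := hm k hk
          exact ⟨i, by simp [hi1], hi2⟩
      · rw [heckeWord_cons, heckeWord_cons, ← mul_assoc, heckeT_mul_heckeGen_of_conj hj1 hj2,
          mul_assoc, h1, mul_assoc]
      · rw [wordPerm_cons, wordPerm_cons, ← mul_assoc, simpleSwap_eq, Equiv.mul_swap_eq_swap_mul,
          hj1, hj2, ← simpleSwap_eq, mul_assoc, h2, mul_assoc]
  obtain ⟨l', hl', -, h1, h2⟩ := key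
  rw [h2, mul_inv_cancel_right, ← heckeWord_eq_heckeT_of_nodup hl,
    ← heckeWord_eq_heckeT_of_nodup hl']
  obtain ⟨u, hu⟩ := isUnit_heckeT d
  -- The commutator is that of `T_d` and `T_l T_d⁻¹`.
  have e1 : heckeWord n l' = heckeT n d * (heckeWord n l * (↑u⁻¹ : Hecke n)) := by
    rw [← mul_assoc, h1, ← hu, mul_assoc, Units.mul_inv, mul_one]
  have e2 : heckeWord n l = heckeWord n l * (↑u⁻¹ : Hecke n) * heckeT n d := by
    rw [mul_assoc, ← hu, Units.inv_mul, mul_one]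
  rw [e1]
  nth_rewrite 2 [e2]
  exact sub_mem_commutators _ _

/-- Blocks of equal size are matched, and `d` shifts each block rigidly onto its partner. It keeps
neighbours inside a block adjacent, as the conjugation argument requires. -/
theorem heckeT_blockCycle_sub_mem_commutators {n : ℕ} {c c' : Composition n}
    (h : (c.blocks : Multiset ℕ) = c'.blocks) :
    heckeT n (blockCycle c') - heckeT n (blockCycle c) ∈ commutators n := by
  rw [← map_blocksFun, ← map_blocksFun] at h
  obtain ⟨e, he⟩ := exists_equiv_of_map_univ_eq h
  let d : Equiv.Perm (Fin n) := c.blocksFinEquiv.symm.trans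
    ((Equiv.sigmaCongr e fun b => finCongr (he b).symm).trans c'.blocksFinEquiv)
  have hd : ∀ b t, d (c.embedding b t) = c'.embedding (e b) (Fin.cast (he b).symm t) := by
    intro b t
    have : c.blocksFinEquiv.symm (c.embedding b t) = ⟨b, t⟩ := by
      rw [Equiv.symm_apply_eq]; rfl
    simp only [d, Equiv.trans_apply, this]
    rfl
  have hc : blockCycle c' = d * blockCycle c * d⁻¹ := by
    rw [eq_mul_inv_iff_mul_eq]
    refine Equiv.ext fun x => ?_
    obtain ⟨b, t, rfl⟩ := exists_embedding c x
    rw [Equiv.Perm.mul_apply, Equiv.Perm.mul_apply, hd, blockCycle_embedding, blockCycle_embedding,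
      hd]
    congr 1
    ext
    rw [Fin.val_cast, coe_finRotate_eq, coe_finRotate_eq, Fin.val_cast]
    exact if_congr (by rw [he]) rfl rfl
  rw [hc, ← wordPerm_increasingWord c]
  refine heckeT_conj_sub_mem_commutators d (increasingWord_nodup _) fun j hj => ?_
  obtain ⟨b, t, hbt⟩ := exists_embedding c (lo j)
  rw [mem_increasingWord, mem_blockSteps_iff c hbt] at hj
  have hlo := congrArg Fin.val hbt
  rw [c.coe_embedding] at hlo
  simp only [lo] at hlo
  have hhi : hi j = c.embedding b ⟨t + 1, hj⟩ := by
    ext; rw [c.coe_embedding]; simp only [hi]; omega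
  have hs := c'.sizeUpTo_succ' (e b)
  have hle := c'.sizeUpTo_le (e b + 1)
  rw [he] at hs
  obtain ⟨j', hj'⟩ := exists_lo_eq (x := d (lo j)) (by
    rw [hbt, hd, c'.coe_embedding, Fin.val_cast]; omega)
  refine ⟨j', hj'.symm, ?_⟩
  have := congrArg Fin.val hj'
  rw [hbt, hd, c'.coe_embedding, Fin.val_cast] at this
  rw [hhi, hd]
  ext
  rw [c'.coe_embedding, Fin.val_cast]
  simp only [lo, hi] at *
  omega

/-- The increasing product of generators is equivalent to the standard element of its type. -/
theorem exists_increasingWord_sub_mem_commutators {n : ℕ} (J : Finset (Fin (n - 1))) :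
    ∃ lam : n.Partition,
      heckeWord n (increasingWord J) - heckeT n (cyclePerm lam) ∈ commutators n := by
  obtain ⟨c, rfl⟩ := exists_blockSteps_eq J
  refine ⟨Nat.Partition.ofComposition n c, ?_⟩
  rw [heckeWord_eq_heckeT_of_nodup (increasingWord_nodup _), wordPerm_increasingWord, cyclePerm_eq]
  exact heckeT_blockCycle_sub_mem_commutators (coe_blocks_partComposition _)

/-! ### Cycle types -/

/-- The permutation is the product of its restrictions to the single fibres, which are disjoint. -/
theorem cycleType_sigmaCongrRight {ι : Type*} {β : ι → Type*} [Fintype ι] [DecidableEq ι]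
    [∀ i, Fintype (β i)] [∀ i, DecidableEq (β i)] (σ : ∀ i, Equiv.Perm (β i)) :
    Equiv.Perm.cycleType (Equiv.sigmaCongrRight σ : Equiv.Perm (Σ i, β i)) =
      ∑ i, (σ i).cycleType := by
  have hsingle : ∀ b, Equiv.Perm.cycleType (Equiv.sigmaCongrRight (Pi.mulSingle b (σ b)) :
      Equiv.Perm (Σ i, β i)) = (σ b).cycleType := fun b => by
    rw [← Equiv.Perm.cycleType_extendDomain (Equiv.sigmaSubtype b).symm (g := σ b)]
    congr 1
    refine Equiv.ext ?_
    rintro ⟨i, x⟩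
    by_cases h : i = b
    · subst h
      have := Equiv.Perm.extendDomain_apply_image (σ i) (Equiv.sigmaSubtype i).symm x
      refine Eq.trans ?_ this.symm
      simp [Equiv.sigmaSubtype]
    · rw [Equiv.Perm.extendDomain_apply_not_subtype _ _ (by simpa using h)]
      simp [h]
  have key : ∀ S : Finset ι, Equiv.Perm.cycleType
      (Equiv.sigmaCongrRight (fun i => if i ∈ S then σ i else 1) : Equiv.Perm (Σ i, β i)) =
        ∑ i ∈ S, (σ i).cycleType := fun S => by
    induction S using Finset.induction_on with
    | empty => simp; rfl
    | insert b S hb ih =>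
      have h1 : (Equiv.sigmaCongrRight (fun i => if i ∈ insert b S then σ i else 1) :
          Equiv.Perm (Σ i, β i)) = Equiv.sigmaCongrRight (Pi.mulSingle b (σ b)) *
            Equiv.sigmaCongrRight (fun i => if i ∈ S then σ i else 1) := by
        refine Equiv.ext ?_
        rintro ⟨i, x⟩
        by_cases h : i = b
        · subst h; simp [hb]
        · simp [h]
      rw [h1, Equiv.Perm.Disjoint.cycleType_mul, hsingle, ih, Finset.sum_insert hb]
      rintro ⟨i, x⟩
      by_cases h : i = b
      · subst h; right; simp [hb]
      · left; simp [h]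
  have := key Finset.univ
  simpa using this

theorem cycleType_permCongr {α β : Type*} [Fintype α] [Fintype β] [DecidableEq α] [DecidableEq β]
    (e : α ≃ β) (σ : Equiv.Perm α) : (e.permCongr σ).cycleType = σ.cycleType := by
  rw [← Equiv.Perm.cycleType_extendDomain (p := fun _ : β => True)
    (e.trans (Equiv.subtypeUnivEquiv fun _ => trivial).symm) (g := σ)]
  congr 1

/-- `Equiv.Perm.cycleType` omits the fixed points; the number of parts equal to 1 is recovered from
the total. -/
theorem eq_of_filter_two_le_eq {s t : Multiset ℕ} (hs : ∀ k ∈ s, 0 < k) (ht : ∀ k ∈ t, 0 < k)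
    (hsum : s.sum = t.sum) (h : s.filter (2 ≤ ·) = t.filter (2 ≤ ·)) : s = t := by
  have key : ∀ s : Multiset ℕ, (∀ k ∈ s, 0 < k) →
      s.filter (fun k => ¬ 2 ≤ k) = Multiset.replicate (s.filter (fun k => ¬ 2 ≤ k)).card 1 :=
    fun s hs => Multiset.eq_replicate_card.2 fun k hk => by
      have := hs k (Multiset.mem_filter.1 hk).1
      have := (Multiset.mem_filter.1 hk).2
      omega
  have h1 := Multiset.filter_add_not (2 ≤ ·) s
  have h2 := Multiset.filter_add_not (2 ≤ ·) t
  have e1 := congrArg Multiset.sum h1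
  have e2 := congrArg Multiset.sum h2
  rw [key s hs] at h1 e1
  rw [key t ht] at h2 e2
  rw [Multiset.sum_add, Multiset.sum_replicate] at e1 e2
  rw [← h1, ← h2, h]
  congr 2
  rw [h] at e1
  simp only [smul_eq_mul, mul_one] at e1 e2
  omega

theorem parts_partition_blockCycle {n : ℕ} (c : Composition n) :
    (blockCycle c).partition.parts = c.blocks := by
  refine eq_of_filter_two_le_eq (fun _ => (blockCycle c).partition.parts_pos)
    (fun k hk => c.blocks_pos hk) ?_ ?_
  · rw [(blockCycle c).partition.parts_sum, Fintype.card_fin]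
    exact c.blocks_sum.symm
  · rw [Equiv.Perm.filter_parts_partition_eq_cycleType, blockCycle, cycleType_permCongr,
      cycleType_sigmaCongrRight, ← map_blocksFun]
    have : ∀ k : ℕ, (finRotate k).cycleType = if 2 ≤ k then {k} else 0 := fun k => by
      split_ifs with hk
      · exact cycleType_finRotate_of_le hk
      · have : Subsingleton (Fin k) := Fin.subsingleton_iff_le_one.2 (by omega)
        rw [Subsingleton.elim (finRotate k) 1, Equiv.Perm.cycleType_one]
    simp only [this]
    change ((Finset.univ : Finset (Fin c.length)).val.map
      fun i => if 2 ≤ c.blocksFun i then {c.blocksFun i} else 0).sum = _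
    induction (Finset.univ : Finset (Fin c.length)).val using Multiset.induction_on with
    | empty => simp
    | cons i s ih =>
      rw [Multiset.map_cons, Multiset.sum_cons, ih, Multiset.map_cons, Multiset.filter_cons]

theorem parts_partition_cyclePerm {n : ℕ} (lam : n.Partition) :
    (cyclePerm lam).partition.parts = lam.parts := by
  rw [cyclePerm_eq, parts_partition_blockCycle, coe_blocks_partComposition]

/-- The cycle type of a permutation, as a partition of `n`. -/
def permType {n : ℕ} (w : Equiv.Perm (Fin n)) : n.Partition where
  parts := w.partition.parts
  parts_pos := w.partition.parts_pos
  parts_sum := by rw [w.partition.parts_sum, Fintype.card_fin]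

theorem permType_eq_iff {n : ℕ} {w : Equiv.Perm (Fin n)} {lam : n.Partition} :
    permType w = lam ↔ w.partition.parts = lam.parts := Nat.Partition.ext_iff

theorem permType_cyclePerm {n : ℕ} (lam : n.Partition) : permType (cyclePerm lam) = lam :=
  permType_eq_iff.2 (parts_partition_cyclePerm lam)

theorem permType_eq_permType_iff {n : ℕ} {w u : Equiv.Perm (Fin n)} :
    permType w = permType u ↔ IsConj w u := by
  rw [Equiv.Perm.partition_eq_of_isConj, Nat.Partition.ext_iff, Nat.Partition.ext_iff]; rfl

/-! ### Fixed words -/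

/-- A word is fixed by the rotation of the blocks precisely when it is constant on each block, so it
amounts to a filling by the block sizes. -/
theorem card_fixed_blockCycle {n : ℕ} (c : Composition n) (m : ℕ →₀ ℕ) :
    Nat.card {f : Words n m // f.permute (blockCycle c) = f} =
      Nat.card {g : Fin c.length → ℕ // ∑ b, Finsupp.single (g b) (c.blocksFun b) = m} := by
  have hsum : ∀ g : Fin c.length → ℕ,
      ∑ x : Fin n, Finsupp.single (g (c.blocksFinEquiv.symm x).1) 1 =
      ∑ b, Finsupp.single (g b) (c.blocksFun b) := fun g => by
    rw [← Equiv.sum_comp c.blocksFinEquiv, Fintype.sum_sigma]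
    refine Finset.sum_congr rfl fun b _ => ?_
    simp
  have hsymm : ∀ b t, c.blocksFinEquiv.symm (c.embedding b t) = ⟨b, t⟩ := fun b t => by
    rw [Equiv.symm_apply_eq]; rfl
  refine (Nat.card_eq_of_bijective (fun g : {g : Fin c.length → ℕ //
    ∑ b, Finsupp.single (g b) (c.blocksFun b) = m} =>
      (⟨⟨fun x => g.1 (c.blocksFinEquiv.symm x).1, (hsum g.1).trans g.2⟩, ?_⟩ :
        {f : Words n m // f.permute (blockCycle c) = f})) ⟨?_, ?_⟩).symm
  · refine Words.ext (funext fun x => ?_)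
    obtain ⟨b, t, rfl⟩ := exists_embedding c x
    rw [Words.permute_apply, blockCycle_embedding]
    simp only [hsymm]
  · rintro ⟨g, hg⟩ ⟨g', hg'⟩ h
    refine Subtype.ext (funext fun b => ?_)
    have := congrFun (congrArg (fun f => f.1.letter) h)
      (c.embedding b ⟨0, c.one_le_blocksFun b⟩)
    simpa only [hsymm] using this
  · rintro ⟨f, hf⟩
    have hconst : ∀ b (k : ℕ) (hk : k < c.blocksFun b), f.letter (c.embedding b ⟨k, hk⟩) =
        f.letter (c.embedding b ⟨0, c.one_le_blocksFun b⟩) := fun b k => by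
      induction k with
      | zero => intro _; rfl
      | succ k ih =>
        intro hk
        rw [← ih (by omega)]
        have h1 := congrFun (congrArg Words.letter hf) (c.embedding b ⟨k, by omega⟩)
        rw [Words.permute_apply, blockCycle_embedding] at h1
        rw [← h1]
        congr 2
        ext
        rw [coe_finRotate_eq, if_pos hk]
    have hf' : ∀ x, f.letter (c.embedding (c.blocksFinEquiv.symm x).1
        ⟨0, c.one_le_blocksFun _⟩) = f.letter x := fun x => by
      obtain ⟨b, t, rfl⟩ := exists_embedding c x
      rw [hsymm]
      exact (hconst b t t.2).symm
    refine ⟨⟨fun b => f.letter (c.embedding b ⟨0, c.one_le_blocksFun b⟩), ?_⟩,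
      Subtype.ext (Words.ext (funext hf'))⟩
    rw [← hsum]
    refine Eq.trans ?_ f.content
    exact Finset.sum_congr rfl fun x _ => by rw [hf']

/-- The number of fixed words of a given content is a coefficient of a power sum. -/
theorem card_fixed_words {n : ℕ} (w : Equiv.Perm (Fin n)) (m : ℕ →₀ ℕ) :
    (Fintype.card {f : Words n m // f.permute w = f} : ℂ) =
      MvPowerSeries.coeff m (powerSumPart (permType w)).1 := by
  -- Conjugate permutations fix equally many words, so `w` may be replaced by the block rotation of
  -- its type.
  obtain ⟨d, hd⟩ := isConj_iff.1 (permType_eq_permType_iff.1 (permType_cyclePerm (permType w)))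
  have hd' : d * cyclePerm (permType w) = w * d := mul_inv_eq_iff_eq_mul.1 hd
  have hd'' : d⁻¹ * w = cyclePerm (permType w) * d⁻¹ := by
    rw [inv_mul_eq_iff_eq_mul, ← mul_assoc, hd]
  have h1 : Nat.card {f : Words n m // f.permute w = f} =
      Nat.card {f : Words n m // f.permute (cyclePerm (permType w)) = f} := by
    refine Nat.card_eq_of_bijective (fun f => ⟨f.1.permute d, ?_⟩) ⟨?_, ?_⟩
    · conv_rhs => rw [← f.2]
      rw [Words.permute_permute, Words.permute_permute, hd']
    · rintro ⟨f, hf⟩ ⟨g, hg⟩ h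
      have := congrArg (fun x => x.1.permute d⁻¹) h
      simpa [Words.permute_permute, Words.permute_one] using this
    · rintro ⟨g, hg⟩
      refine ⟨⟨g.permute d⁻¹, ?_⟩, Subtype.ext ?_⟩
      · conv_rhs => rw [← hg]
        rw [Words.permute_permute, Words.permute_permute, hd'']
      · simp [Words.permute_permute, Words.permute_one]
  rw [← Nat.card_eq_fintype_card, h1, cyclePerm_eq, card_fixed_blockCycle,
    ← coeff_prod_powerSum (fun b => (partComposition (permType w)).one_le_blocksFun b),
    ← powerProd_map, map_blocksFun, coe_blocks_partComposition, powerSumPart_eq]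

/-! ### Values at `v = 1` -/

/-- The rational function `a` is regular at `1`, with value `x`. -/
def HasValue (a : Cv) (x : ℂ) : Prop := RegularAtOne a ∧ valueAtOne a = x

theorem RegularAtOne.hasValue {a : Cv} (h : RegularAtOne a) : HasValue a (valueAtOne a) := ⟨h, rfl⟩

theorem HasValue.unique {a : Cv} {x y : ℂ} (h : HasValue a x) (h' : HasValue a y) : x = y :=
  h.2.symm.trans h'.2

theorem hasValue_algebraMap (p : Polynomial ℂ) :
    HasValue (algebraMap (Polynomial ℂ) Cv p) (p.eval 1) := by
  refine ⟨?_, ?_⟩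
  · rw [RegularAtOne, RatFunc.denom_algebraMap, Polynomial.eval_one]; exact one_ne_zero
  · rw [valueAtOne, RatFunc.eval_algebraMap, Polynomial.eval₂_id]; rfl

/-- The denominator of a sum or product is only known to divide the product of the denominators,
because of cancellation. -/
theorem RegularAtOne.of_dvd {a : Cv} {q : Polynomial ℂ} (h : a.denom ∣ q) (hq : q.eval 1 ≠ 0) :
    RegularAtOne a := by
  obtain ⟨r, rfl⟩ := h
  rw [Polynomial.eval_mul] at hq
  exact left_ne_zero_of_mul hq

theorem HasValue.add {a b : Cv} {x y : ℂ} (ha : HasValue a x) (hb : HasValue b y) :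
    HasValue (a + b) (x + y) := by
  refine ⟨RegularAtOne.of_dvd (RatFunc.denom_add_dvd a b) ?_, ?_⟩
  · rw [Polynomial.eval_mul]; exact mul_ne_zero ha.1 hb.1
  · rw [← ha.2, ← hb.2, valueAtOne, RatFunc.eval_add]
    · rfl
    · rw [Polynomial.eval₂_id]; exact ha.1
    · rw [Polynomial.eval₂_id]; exact hb.1

theorem HasValue.mul {a b : Cv} {x y : ℂ} (ha : HasValue a x) (hb : HasValue b y) :
    HasValue (a * b) (x * y) := by
  refine ⟨RegularAtOne.of_dvd (RatFunc.denom_mul_dvd a b) ?_, ?_⟩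
  · rw [Polynomial.eval_mul]; exact mul_ne_zero ha.1 hb.1
  · rw [← ha.2, ← hb.2, valueAtOne, RatFunc.eval_mul]
    · rfl
    · rw [Polynomial.eval₂_id]; exact ha.1
    · rw [Polynomial.eval₂_id]; exact hb.1

theorem hasValue_one : HasValue 1 1 := by
  simpa using hasValue_algebraMap 1

theorem hasValue_zero : HasValue 0 0 := by
  simpa using hasValue_algebraMap 0

theorem hasValue_C (x : ℂ) : HasValue (algebraMap ℂ Cv x) x := by
  have := hasValue_algebraMap (Polynomial.C x)
  rwa [Polynomial.eval_C] at this

theorem hasValue_v : HasValue v 1 := by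
  have := hasValue_algebraMap Polynomial.X
  rwa [Polynomial.eval_X, RatFunc.algebraMap_X] at this

theorem HasValue.inv {a : Cv} {x : ℂ} (h : HasValue a x) (hx : x ≠ 0) : HasValue a⁻¹ x⁻¹ := by
  have hnum : a.num.eval 1 ≠ 0 := by
    intro h0
    have := h.2
    rw [valueAtOne, RatFunc.eval, Polynomial.eval₂_id, h0, zero_div] at this
    exact hx this.symm
  have hreg : RegularAtOne a⁻¹ := by
    refine RegularAtOne.of_dvd (q := a.num) ?_ hnum
    conv_lhs => rw [← RatFunc.num_div_denom a, inv_div]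
    exact RatFunc.denom_div_dvd _ _
  refine ⟨hreg, eq_inv_of_mul_eq_one_left ?_⟩
  have ha : a ≠ 0 := by
    rintro rfl
    exact hx (h.unique hasValue_zero)
  have := (hreg.hasValue.mul h)
  rw [inv_mul_cancel₀ ha] at this
  exact this.unique hasValue_one

theorem HasValue.neg {a : Cv} {x : ℂ} (h : HasValue a x) : HasValue (-a) (-x) := by
  have := (hasValue_C (-1)).mul h
  simpa using this

theorem HasValue.sub {a b : Cv} {x y : ℂ} (ha : HasValue a x) (hb : HasValue b y) :
    HasValue (a - b) (x - y) := by
  rw [sub_eq_add_neg, sub_eq_add_neg]; exact ha.add hb.neg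

theorem HasValue.pow {a : Cv} {x : ℂ} (h : HasValue a x) (k : ℕ) : HasValue (a ^ k) (x ^ k) := by
  induction k with
  | zero => simpa using hasValue_one
  | succ k ih => rw [pow_succ, pow_succ]; exact ih.mul h

theorem HasValue.sum {ι : Type*} {s : Finset ι} {a : ι → Cv} {x : ι → ℂ}
    (h : ∀ i ∈ s, HasValue (a i) (x i)) : HasValue (∑ i ∈ s, a i) (∑ i ∈ s, x i) := by
  classical
  induction s using Finset.induction_on with
  | empty => simpa using hasValue_zero
  | insert i s hi ih =>
    rw [Finset.sum_insert hi, Finset.sum_insert hi]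
    exact (h i (Finset.mem_insert_self _ _)).add
      (ih fun j hj => h j (Finset.mem_insert_of_mem hj))

/-- The subring of integral Laurent polynomials in `v`. -/
def laurent : Subalgebra ℤ Cv := Algebra.adjoin ℤ ({v, v⁻¹} : Set Cv)

theorem v_mem_laurent : v ∈ laurent := Algebra.subset_adjoin (by simp)

theorem exists_hasValue_of_mem_laurent {a : Cv} (h : a ∈ laurent) : ∃ x, HasValue a x := by
  induction h using Algebra.adjoin_induction with
  | mem a ha =>
    rcases ha with rfl | rfl
    · exact ⟨1, hasValue_v⟩
    · exact ⟨_, hasValue_v.inv one_ne_zero⟩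
  | algebraMap r =>
    refine ⟨r, ?_⟩
    have := hasValue_C (r : ℂ)
    simpa using this
  | add a b _ _ ha hb =>
    obtain ⟨x, hx⟩ := ha
    obtain ⟨y, hy⟩ := hb
    exact ⟨_, hx.add hy⟩
  | mul a b _ _ ha hb =>
    obtain ⟨x, hx⟩ := ha
    obtain ⟨y, hy⟩ := hb
    exact ⟨_, hx.mul hy⟩

/-! ### Characters of the word representations -/

/-- The character of the representation on words of a given content. -/
def wordChar {n : ℕ} (m : ℕ →₀ ℕ) : Hecke n →ₗ[Cv] Cv :=
  Matrix.traceLinearMap (Words n m) Cv Cv ∘ₗ (heckeRep n m).toLinearMap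

theorem wordChar_eq_zero {n : ℕ} (m : ℕ →₀ ℕ) {h : Hecke n} (hh : h ∈ commutators n) :
    wordChar m h = 0 := by
  have : commutators n ≤ LinearMap.ker (wordChar m) := by
    rw [commutators, Submodule.span_le]
    rintro _ ⟨⟨a, b⟩, rfl⟩
    rw [SetLike.mem_coe, LinearMap.mem_ker, map_sub, sub_eq_zero]
    simp only [wordChar, LinearMap.comp_apply, AlgHom.toLinearMap_apply, map_mul,
      Matrix.traceLinearMap_apply]
    exact Matrix.trace_mul_comm _ _
  exact this hh

/-- The character value at `T_w`, as a polynomial. -/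
def charPoly {n : ℕ} (w : Equiv.Perm (Fin n)) (m : ℕ →₀ ℕ) : Polynomial ℂ :=
  (wordMatrix Polynomial.X (reducedWord n w) :
    Matrix (Words n m) (Words n m) (Polynomial ℂ)).trace

/-- A single polynomial gives the character over `ℂ(v)` when `X` becomes `v` and the fixed word
count when `X` becomes `1`. -/
theorem map_charPoly {R : Type*} [CommRing R] (φ : Polynomial ℂ →+* R) {n : ℕ}
    (w : Equiv.Perm (Fin n)) (m : ℕ →₀ ℕ) : φ (charPoly w m) =
      (wordMatrix (φ Polynomial.X) (reducedWord n w) : Matrix (Words n m) (Words n m) R).trace := by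
  rw [← wordMatrix_map, charPoly, Matrix.trace, Matrix.trace, map_sum]
  rfl

theorem wordChar_heckeT {n : ℕ} (w : Equiv.Perm (Fin n)) (m : ℕ →₀ ℕ) :
    wordChar m (heckeT n w) = algebraMap (Polynomial ℂ) Cv (charPoly w m) := by
  rw [map_charPoly, RatFunc.algebraMap_X, ← (isReducedWord_reducedWord w).heckeWord_eq]
  change (heckeRep n m (heckeWord n (reducedWord n w))).trace = _
  rw [heckeRep_heckeWord]; rfl

theorem charPoly_eval_one {n : ℕ} (w : Equiv.Perm (Fin n)) (mu : n.Partition) :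
    (charPoly w (expVec mu)).eval 1 = powerCoeff (permType w) mu := by
  have := map_charPoly (Polynomial.evalRingHom 1) w (expVec mu)
  rw [Polynomial.coe_evalRingHom, Polynomial.eval_X, trace_wordMatrix_one,
    (isReducedWord_reducedWord w).1, card_fixed_words] at this
  exact this

theorem hasValue_wordChar {n : ℕ} (w : Equiv.Perm (Fin n)) (mu : n.Partition) :
    HasValue (wordChar (expVec mu) (heckeT n w)) (powerCoeff (permType w) mu) := by
  rw [wordChar_heckeT, ← charPoly_eval_one]
  exact hasValue_algebraMap _

/-- The determinant is a polynomial in `v`; at `v = 1` it becomes the determinant of the power sum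
coefficients, which is nonzero. -/
theorem charMatrix_det_ne_zero (n : ℕ) :
    (Matrix.of fun lam mu : n.Partition =>
      wordChar (expVec mu) (heckeT n (cyclePerm lam))).det ≠ 0 := by
  have h1 : (Matrix.of fun lam mu : n.Partition =>
      wordChar (expVec mu) (heckeT n (cyclePerm lam))) = (algebraMap (Polynomial ℂ) Cv).mapMatrix
        (Matrix.of fun lam mu : n.Partition => charPoly (cyclePerm lam) (expVec mu)) := by
    ext lam mu
    simp [wordChar_heckeT]
  have h2 : (Polynomial.evalRingHom (1 : ℂ)).mapMatrix
      (Matrix.of fun lam mu : n.Partition => charPoly (cyclePerm lam) (expVec mu)) =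
      Matrix.of powerCoeff := by
    ext lam mu
    have := charPoly_eval_one (cyclePerm lam) mu
    rw [permType_cyclePerm] at this
    exact this
  rw [h1, ← RingHom.map_det]
  intro h
  have h0 := RatFunc.algebraMap_injective ℂ (h.trans (map_zero _).symm)
  refine powerCoeff_det_ne_zero n ?_
  rw [← h2, ← RingHom.map_det, h0, map_zero]

/-- The elements `T_{w_lam}` are linearly independent modulo commutators. -/
theorem eq_zero_of_sum_mem_commutators {n : ℕ} {a : n.Partition → Cv}
    (h : ∑ lam, a lam • heckeT n (cyclePerm lam) ∈ commutators n) : a = 0 := by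
  refine Matrix.eq_zero_of_vecMul_eq_zero (charMatrix_det_ne_zero n) (funext fun mu => ?_)
  have := wordChar_eq_zero (expVec mu) h
  simpa [map_sum, Matrix.vecMul, dotProduct] using this

theorem isClassPolynomialFamily_unique {n : ℕ} {f g : Equiv.Perm (Fin n) → n.Partition → Cv}
    (hf : IsClassPolynomialFamily n f) (hg : IsClassPolynomialFamily n g) : f = g := by
  funext w
  rw [← sub_eq_zero]
  refine eq_zero_of_sum_mem_commutators ?_
  have := Submodule.sub_mem _ (hg.2 w) (hf.2 w)
  rw [sub_sub_sub_cancel_left, ← Finset.sum_sub_distrib] at this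
  convert this using 2 with lam
  rw [Pi.sub_apply, sub_smul (R := Cv) (f w lam) (g w lam) (heckeT n (cyclePerm lam))]

/-- At `v = 1` the class polynomials become the characteristic functions of the classes. -/
theorem IsClassPolynomialFamily.hasValue {n : ℕ} {f : Equiv.Perm (Fin n) → n.Partition → Cv}
    (hf : IsClassPolynomialFamily n f) (w : Equiv.Perm (Fin n)) (lam : n.Partition) :
    HasValue (f w lam) (if permType w = lam then 1 else 0) := by
  choose x hx using fun lam => exists_hasValue_of_mem_laurent (hf.1 w lam)
  -- All characters are applied to the congruence for `T_w` and evaluated at `v = 1`. The values `x`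
  -- and the indicator of the type of `w` then have the same image under an invertible matrix.
  have h : x - Pi.single (permType w) 1 = 0 := by
    refine Matrix.eq_zero_of_vecMul_eq_zero (powerCoeff_det_ne_zero n) (funext fun mu => ?_)
    have h1 := wordChar_eq_zero (expVec mu) (hf.2 w)
    rw [map_sub, sub_eq_zero, map_sum] at h1
    simp only [map_smul, smul_eq_mul] at h1
    have h2 := hasValue_wordChar w mu
    rw [h1] at h2
    have h3 := h2.unique (HasValue.sum fun lam _ =>
      (hx lam).mul (hasValue_wordChar (cyclePerm lam) mu))
    simp only [permType_cyclePerm] at h3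
    rw [Matrix.sub_vecMul, Matrix.single_one_vecMul, Pi.sub_apply, Pi.zero_apply, sub_eq_zero]
    exact h3.symm
  have h' := congrFun (sub_eq_zero.1 h) lam
  rw [Pi.single_apply] at h'
  have := hx lam
  rw [h'] at this
  simpa only [eq_comm] using this

/-! ### Existence of the class polynomials -/

theorem hecke_mul_neg {n : ℕ} (x y : Hecke n) : x * -y = -(x * y) :=
  eq_neg_of_add_eq_zero_left (by rw [← mul_add, neg_add_cancel, mul_zero])

theorem hecke_neg_mul {n : ℕ} (x y : Hecke n) : -x * y = -(x * y) :=
  eq_neg_of_add_eq_zero_left (by rw [← add_mul, neg_add_cancel, zero_mul])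

/-- The ring generated by `v` and the `T_i` with `i + 1 < k`. -/
def heckeSub (n k : ℕ) : Subring (Hecke n) :=
  Subring.closure ({v • 1} ∪ {x | ∃ i : Fin (n - 1), (i : ℕ) + 1 < k ∧ x = heckeGen n i})

theorem v_mem_heckeSub (n k : ℕ) : (v • 1 : Hecke n) ∈ heckeSub n k :=
  Subring.subset_closure (Or.inl rfl)

theorem heckeGen_mem_heckeSub {n k : ℕ} {i : Fin (n - 1)} (h : (i : ℕ) + 1 < k) :
    heckeGen n i ∈ heckeSub n k := Subring.subset_closure (Or.inr ⟨i, h, rfl⟩)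

theorem heckeSub_mono {n k l : ℕ} (h : k ≤ l) : heckeSub n k ≤ heckeSub n l := by
  refine Subring.closure_mono (Set.union_subset_union_right _ ?_)
  rintro _ ⟨i, hi, rfl⟩
  exact ⟨i, by omega, rfl⟩

theorem heckeSub_comm {n k : ℕ} {j : Fin (n - 1)} (h : k ≤ j) {x : Hecke n}
    (hx : x ∈ heckeSub n k) : x * heckeGen n j = heckeGen n j * x := by
  have : heckeSub n k ≤ Subring.centralizer {heckeGen n j} := by
    rw [heckeSub, Subring.closure_le]
    rintro y (rfl | ⟨i, hi, rfl⟩)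
    · rintro z (rfl : z = _)
      rw [mul_smul_comm, smul_mul_assoc, mul_one, one_mul]
    · rintro z (rfl : z = _)
      exact heckeGen_comm (Or.inr (by omega))
  exact (this hx _ rfl).symm

/-- The additive group generated by `H_k` and the products `a T_{k-1} b` with `a`, `b` in `H_k`. -/
def heckeStep (n k : ℕ) : AddSubgroup (Hecke n) :=
  AddSubgroup.closure ((heckeSub n k : Set (Hecke n)) ∪
    {x | ∃ j : Fin (n - 1), (j : ℕ) + 1 = k ∧
      ∃ a ∈ heckeSub n k, ∃ b ∈ heckeSub n k, x = a * heckeGen n j * b})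

theorem mem_heckeStep_of_mem {n k : ℕ} {x : Hecke n} (h : x ∈ heckeSub n k) : x ∈ heckeStep n k :=
  AddSubgroup.subset_closure (Or.inl h)

theorem mem_heckeStep {n k : ℕ} {j : Fin (n - 1)} (h : (j : ℕ) + 1 = k) {a b : Hecke n}
    (ha : a ∈ heckeSub n k) (hb : b ∈ heckeSub n k) : a * heckeGen n j * b ∈ heckeStep n k :=
  AddSubgroup.subset_closure (Or.inr ⟨j, h, a, ha, b, hb, rfl⟩)

theorem mul_mem_heckeStep {n k : ℕ} {x y : Hecke n} (hx : x ∈ heckeSub n k)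
    (hy : y ∈ heckeStep n k) : x * y ∈ heckeStep n k := by
  induction hy using AddSubgroup.closure_induction with
  | mem y hy =>
    rcases hy with hy | ⟨j, hj, a, ha, b, hb, rfl⟩
    · exact mem_heckeStep_of_mem (mul_mem hx hy)
    · rw [← mul_assoc, ← mul_assoc]
      exact mem_heckeStep hj (mul_mem hx ha) hb
  | zero => rw [mul_zero]; exact zero_mem _
  | add y z _ _ hy hz => rw [mul_add]; exact add_mem hy hz
  | neg y _ hy => rw [hecke_mul_neg]; exact neg_mem hy

/-- A summand in `H_k` commutes with `T_k`, so the quadratic relation applies. For `c T_{k-1} d` the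
outer factors commute with `T_k`, and the braid relation turns `T_k T_{k-1} T_k` into `T_{k-1} T_k
T_{k-1}`, with a single `T_k`. -/
theorem heckeGen_mul_mul_heckeGen_mem {n k : ℕ} {j : Fin (n - 1)} (hj : (j : ℕ) = k)
    {a b : Hecke n} (ha : a ∈ heckeStep n k) (hb : b ∈ heckeSub n (k + 1)) :
    heckeGen n j * a * heckeGen n j * b ∈ heckeStep n (k + 1) := by
  induction ha using AddSubgroup.closure_induction with
  | mem a ha =>
    rcases ha with ha | ⟨i, hi, c, hc, d, hd, rfl⟩
    · have ha' := heckeSub_mono (Nat.le_succ k) ha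
      have e : heckeGen n j * a * heckeGen n j * b =
          (v • 1) * a * heckeGen n j * b - a * heckeGen n j * b + (v • 1) * a * b := by
        rw [← heckeSub_comm hj.ge ha, mul_assoc a, heckeGen_quad,
          sub_smul (R := Cv) v 1 (heckeGen n j)]
        simp only [mul_add, mul_sub, add_mul, sub_mul, mul_smul_comm, smul_mul_assoc, one_smul,
          one_mul, mul_one]
      rw [e]
      exact add_mem (sub_mem (mem_heckeStep (by omega) (mul_mem (v_mem_heckeSub _ _) ha') hb)
        (mem_heckeStep (by omega) ha' hb))
        (mem_heckeStep_of_mem (mul_mem (mul_mem (v_mem_heckeSub _ _) ha') hb))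
    · have e : heckeGen n j * (c * heckeGen n i * d) * heckeGen n j * b =
          (c * heckeGen n i) * heckeGen n j * (heckeGen n i * d * b) := by
        have h1 := heckeSub_comm hj.ge hc
        have h2 := heckeSub_comm hj.ge hd
        have h3 := heckeGen_braid (hi.trans hj.symm)
        calc heckeGen n j * (c * heckeGen n i * d) * heckeGen n j * b
            = (heckeGen n j * c) * heckeGen n i * (d * heckeGen n j) * b := by
              simp only [mul_assoc]
          _ = c * (heckeGen n j * heckeGen n i * heckeGen n j) * d * b := by
              rw [← h1, h2]; simp only [mul_assoc]
          _ = _ := by rw [← h3]; simp only [mul_assoc]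
      rw [e]
      have hi' : heckeGen n i ∈ heckeSub n (k + 1) := heckeGen_mem_heckeSub (by omega)
      exact mem_heckeStep (by omega) (mul_mem (heckeSub_mono (Nat.le_succ k) hc) hi')
        (mul_mem (mul_mem hi' (heckeSub_mono (Nat.le_succ k) hd)) hb)
  | zero => rw [mul_zero, zero_mul, zero_mul]; exact zero_mem _
  | add y z _ _ hy hz => rw [mul_add, add_mul, add_mul]; exact add_mem hy hz
  | neg y _ hy => rw [hecke_mul_neg, hecke_neg_mul, hecke_neg_mul]; exact neg_mem hy

/-- The double coset decomposition of `S_{k+1}` with respect to `S_k` has two cosets; this is its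
counterpart, with `H_{k+1}` spanned by `H_k` and `H_k T_{k-1} H_k`. Only coefficients in `ℤ[v]` are
needed. -/
theorem heckeSub_succ_le (n k : ℕ) {x : Hecke n} (hx : x ∈ heckeSub n (k + 1)) :
    x ∈ heckeStep n k := by
  induction k generalizing x with
  | zero =>
    refine mem_heckeStep_of_mem ?_
    have : heckeSub n (0 + 1) ≤ heckeSub n 0 := by
      refine Subring.closure_mono (Set.union_subset_union_right _ ?_)
      rintro _ ⟨i, hi, rfl⟩
      omega
    exact this hx
  | succ k ih =>
    -- It suffices that the span is stable under left multiplication by the larger ring, since it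
    -- contains `1`.
    have key : ∀ x ∈ heckeSub n (k + 1 + 1), ∀ y ∈ heckeStep n (k + 1),
        x * y ∈ heckeStep n (k + 1) := by
      intro x hx
      induction hx using Subring.closure_induction with
      | mem x hx =>
        intro y hy
        rcases hx with rfl | ⟨j, hj, rfl⟩
        · exact mul_mem_heckeStep (v_mem_heckeSub _ _) hy
        · by_cases hjk : (j : ℕ) = k
          · induction hy using AddSubgroup.closure_induction with
            | mem y hy =>
              rcases hy with hy | ⟨i, hi, a, ha, b, hb, rfl⟩
              · have := mem_heckeStep (n := n) (j := j) (k := k + 1) (by omega) (one_mem _) hy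
                rwa [one_mul] at this
              · have hij : i = j := Fin.ext (by omega)
                subst hij
                -- The product is `T_j a T_j b`. The induction hypothesis decomposes the middle
                -- factor `a` one level lower.
                have := heckeGen_mul_mul_heckeGen_mem hjk (ih ha) hb
                simpa only [mul_assoc] using this
            | zero => rw [mul_zero]; exact zero_mem _
            | add y z _ _ hy hz => rw [mul_add]; exact add_mem hy hz
            | neg y _ hy => rw [hecke_mul_neg]; exact neg_mem hy
          · exact mul_mem_heckeStep (heckeGen_mem_heckeSub (by omega)) hy
      | zero => intro y _; rw [zero_mul]; exact zero_mem _
      | one => intro y hy; rwa [one_mul]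
      | add x z _ _ hx hz => intro y hy; rw [add_mul]; exact add_mem (hx y hy) (hz y hy)
      | neg x _ hx => intro y hy; rw [hecke_neg_mul]; exact neg_mem (hx y hy)
      | mul x z _ _ hx hz => intro y hy; rw [mul_assoc]; exact hx _ (hz y hy)
    have := key x hx 1 (mem_heckeStep_of_mem (one_mem _))
    rwa [mul_one] at this

/-- The elements that are Laurent combinations of the `T_{w_lam}` modulo commutators. -/
def reducible (n : ℕ) : AddSubgroup (Hecke n) where
  carrier := {h | ∃ a : n.Partition → Cv, (∀ lam, a lam ∈ laurent) ∧
    h - ∑ lam, a lam • heckeT n (cyclePerm lam) ∈ commutators n}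
  zero_mem' := ⟨0, fun _ => zero_mem _, by simp⟩
  add_mem' := by
    rintro x y ⟨a, ha, hx⟩ ⟨b, hb, hy⟩
    refine ⟨a + b, fun lam => add_mem (ha lam) (hb lam), ?_⟩
    have := Submodule.add_mem _ hx hy
    rw [sub_add_sub_comm, ← Finset.sum_add_distrib] at this
    simpa only [Pi.add_apply, add_smul] using this
  neg_mem' := by
    rintro x ⟨a, ha, hx⟩
    refine ⟨fun lam => (-1) * a lam, fun lam => mul_mem (neg_mem (one_mem _)) (ha lam), ?_⟩
    have := Submodule.smul_mem _ (-1 : Cv) hx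
    rw [smul_sub, Finset.smul_sum] at this
    simp only [smul_smul] at this
    rwa [neg_smul (R := Cv), one_smul] at this

theorem v_smul_mem_reducible {n : ℕ} {x : Hecke n} (hx : x ∈ reducible n) :
    v • x ∈ reducible n := by
  obtain ⟨a, ha, hx⟩ := hx
  refine ⟨fun lam => v * a lam, fun lam => mul_mem v_mem_laurent (ha lam), ?_⟩
  have := Submodule.smul_mem _ v hx
  rw [smul_sub, Finset.smul_sum] at this
  simpa only [smul_smul] using this

theorem mem_reducible_of_sub_mem {n : ℕ} {x y : Hecke n} (hx : x ∈ reducible n)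
    (h : y - x ∈ commutators n) : y ∈ reducible n := by
  obtain ⟨a, ha, hx⟩ := hx
  refine ⟨a, ha, ?_⟩
  have := Submodule.add_mem _ h hx
  rwa [sub_add_sub_cancel] at this

theorem heckeT_cyclePerm_mem_reducible {n : ℕ} (lam : n.Partition) :
    heckeT n (cyclePerm lam) ∈ reducible n := by
  refine ⟨Pi.single lam 1, fun mu => ?_, ?_⟩
  · rw [Pi.single_apply]
    split_ifs
    · exact one_mem _
    · exact zero_mem _
  · simp [Pi.single_apply, ite_smul]

theorem heckeWord_increasingWord_mem_reducible {n : ℕ} (J : Finset (Fin (n - 1))) :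
    heckeWord n (increasingWord J) ∈ reducible n := by
  obtain ⟨lam, h⟩ := exists_increasingWord_sub_mem_commutators J
  exact mem_reducible_of_sub_mem (heckeT_cyclePerm_mem_reducible lam) h

theorem increasingWord_insert {n : ℕ} {J : Finset (Fin (n - 1))} {j : Fin (n - 1)}
    (h : ∀ i ∈ J, j < i) : increasingWord (insert j J) = j :: increasingWord J :=
  Finset.sort_insert (· ≤ ·) (fun i hi => (h i hi).le) fun hj => lt_irrefl _ (h j hj)

/-- The induction trades the largest generator in `x` for a letter of the increasing word: in `a T_j
b T_J` the factor `b` commutes with `T_J`, so cyclically `a T_j b T_J ≡ b a T_j T_J`, where `j` lies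
below `J` and `b a` lies in the smaller ring. -/
theorem mul_heckeWord_mem_reducible {n k : ℕ} {x : Hecke n} (hx : x ∈ heckeSub n k)
    {J : Finset (Fin (n - 1))} (hJ : ∀ i ∈ J, k ≤ (i : ℕ) + 1) :
    x * heckeWord n (increasingWord J) ∈ reducible n := by
  induction k generalizing x J with
  | zero =>
    -- At the bottom the ring is generated by `v` alone.
    have key : ∀ y ∈ reducible n, x * y ∈ reducible n := by
      induction hx using Subring.closure_induction with
      | mem x hx =>
        intro y hy
        rcases hx with rfl | ⟨j, hj, rfl⟩
        · rw [smul_mul_assoc, one_mul]; exact v_smul_mem_reducible hy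
        · omega
      | zero => intro y _; rw [zero_mul]; exact zero_mem _
      | one => intro y hy; rwa [one_mul]
      | add x z _ _ hx hz => intro y hy; rw [add_mul]; exact add_mem (hx y hy) (hz y hy)
      | neg x _ hx => intro y hy; rw [hecke_neg_mul]; exact neg_mem (hx y hy)
      | mul x z _ _ hx hz => intro y hy; rw [mul_assoc]; exact hx _ (hz y hy)
    exact key _ (heckeWord_increasingWord_mem_reducible J)
  | succ k ih =>
    have hx' := heckeSub_succ_le n k hx
    clear hx
    induction hx' using AddSubgroup.closure_induction with
    | mem x hx =>
      rcases hx with hx | ⟨j, hj, a, ha, b, hb, rfl⟩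
      · exact ih hx fun i hi => by have := hJ i hi; omega
      · have hcomm : b * heckeWord n (increasingWord J) = heckeWord n (increasingWord J) * b := by
          have : ∀ l : List (Fin (n - 1)), (∀ i ∈ l, k ≤ (i : ℕ)) →
              b * heckeWord n l = heckeWord n l * b := fun l hl => by
            induction l with
            | nil => simp
            | cons i l ihl =>
              rw [heckeWord_cons, ← mul_assoc, heckeSub_comm (hl i (by simp)) hb, mul_assoc,
                ihl fun i hi => hl i (by simp [hi]), mul_assoc]
          exact this _ fun i hi => by have := hJ i (mem_increasingWord.1 hi); omega
        -- Now `j + 1 = k`, so `insert j J` meets the weaker bound required at level `k`.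
        have h1 : b * a * heckeWord n (increasingWord (insert j J)) ∈ reducible n := by
          refine ih (mul_mem hb ha) fun i hi => ?_
          rcases Finset.mem_insert.1 hi with rfl | hi
          · omega
          · have := hJ i hi; omega
        refine mem_reducible_of_sub_mem h1 ?_
        rw [increasingWord_insert fun i hi => by
          have := hJ i hi; rw [Fin.lt_def]; omega, heckeWord_cons, mul_assoc _ b, hcomm]
        have := sub_mem_commutators (a * heckeGen n j * heckeWord n (increasingWord J)) b
        simpa only [mul_assoc] using this
    | zero => rw [zero_mul]; exact zero_mem _
    | add y z _ _ hy hz => rw [add_mul]; exact add_mem hy hz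
    | neg y _ hy => rw [hecke_neg_mul]; exact neg_mem hy

theorem heckeT_mem_reducible {n : ℕ} (w : Equiv.Perm (Fin n)) : heckeT n w ∈ reducible n := by
  have h : heckeT n w ∈ heckeSub n n := by
    rw [← (isReducedWord_reducedWord w).heckeWord_eq]
    refine list_prod_mem fun x hx => ?_
    obtain ⟨i, -, rfl⟩ := List.mem_map.1 hx
    exact heckeGen_mem_heckeSub (by omega)
  have := mul_heckeWord_mem_reducible h (J := ∅) (by simp)
  simpa [increasingWord] using this

theorem exists_isClassPolynomialFamily (n : ℕ) : ∃ f, IsClassPolynomialFamily n f := by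
  choose f hf using fun w => heckeT_mem_reducible (n := n) w
  exact ⟨f, fun w => (hf w).1, fun w => (hf w).2⟩

theorem isClassPolynomialFamily_classPolynomial (n : ℕ) :
    IsClassPolynomialFamily n (classPolynomial n) :=
  Classical.epsilon_spec (exists_isClassPolynomialFamily n)

/-! ### The centers of the Hecke algebras -/

/-- The linear form on the Hecke algebra which sends `T_w` to `f_{w, lam}`. -/
def classForm {n : ℕ} (lam : n.Partition) : Hecke n →ₗ[Cv] Cv :=
  ∑ w, classPolynomial n w lam • heckeCoeff w

theorem classForm_heckeT {n : ℕ} (lam : n.Partition) (w : Equiv.Perm (Fin n)) :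
    classForm lam (heckeT n w) = classPolynomial n w lam := by
  simp [classForm, heckeCoeff_heckeT]

theorem sub_sum_classForm_mem_commutators {n : ℕ} (h : Hecke n) :
    h - ∑ lam, classForm lam h • heckeT n (cyclePerm lam) ∈ commutators n := by
  have e : h - ∑ lam, classForm lam h • heckeT n (cyclePerm lam) =
      ∑ w, heckeCoeff w h • (heckeT n w -
        ∑ lam, classPolynomial n w lam • heckeT n (cyclePerm lam)) := by
    simp only [smul_sub, Finset.sum_sub_distrib, sum_heckeCoeff, Finset.smul_sum, smul_smul]
    rw [Finset.sum_comm]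
    congr 1
    refine Finset.sum_congr rfl fun lam _ => ?_
    rw [← Finset.sum_smul]
    congr 1
    simp only [classForm, LinearMap.sum_apply, LinearMap.smul_apply, smul_eq_mul, mul_comm]
  rw [e]
  exact Submodule.sum_mem _ fun w _ =>
    Submodule.smul_mem _ _ ((isClassPolynomialFamily_classPolynomial n).2 w)

theorem classForm_eq_of_sum_mem_commutators {n : ℕ} {h : Hecke n} {a : n.Partition → Cv}
    (ha : h - ∑ lam, a lam • heckeT n (cyclePerm lam) ∈ commutators n) (lam : n.Partition) :
    classForm lam h = a lam := by
  have := Submodule.sub_mem _ ha (sub_sum_classForm_mem_commutators h)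
  rw [sub_sub_sub_cancel_left, ← Finset.sum_sub_distrib] at this
  have h0 := eq_zero_of_sum_mem_commutators (a := fun lam => classForm lam h - a lam) (by
    convert this using 2 with lam
    exact sub_smul (R := Cv) (classForm lam h) (a lam) (heckeT n (cyclePerm lam)))
  exact sub_eq_zero.1 (congrFun h0 lam)

theorem classForm_eq_zero {n : ℕ} {h : Hecke n} (hh : h ∈ commutators n) (lam : n.Partition) :
    classForm lam h = 0 :=
  classForm_eq_of_sum_mem_commutators (a := 0) (by simpa using hh) lam

theorem classForm_cyclePerm {n : ℕ} (lam mu : n.Partition) :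
    classForm lam (heckeT n (cyclePerm mu)) = if lam = mu then 1 else 0 :=
  classForm_eq_of_sum_mem_commutators (a := fun lam => if lam = mu then 1 else 0)
    (by simp [ite_smul]) lam

theorem heckeCoeff_geckRouquier {n : ℕ} (lam : n.Partition) (w : Equiv.Perm (Fin n)) :
    heckeCoeff w (geckRouquier lam) = (v ^ permLength n w)⁻¹ * classPolynomial n w⁻¹ lam := by
  rw [geckRouquier, map_sum, Finset.sum_eq_single w⁻¹]
  · rw [map_smul, heckeCoeff_heckeT, inv_inv, if_pos rfl, smul_eq_mul, mul_one, permLength_inv]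
  · intro u _ hu
    rw [map_smul, heckeCoeff_heckeT, if_neg, smul_zero]
    rintro h
    exact hu (by rw [← h, inv_inv])
  · simp

/-- The coefficient of `f*_lam` in a central element. -/
def centerCoord {n : ℕ} (lam : n.Partition) : Hecke n →ₗ[Cv] Cv :=
  heckeCoeff 1 ∘ₗ LinearMap.mulRight Cv (heckeT n (cyclePerm lam))

theorem centerCoord_apply {n : ℕ} (lam : n.Partition) (h : Hecke n) :
    centerCoord lam h = heckeCoeff 1 (h * heckeT n (cyclePerm lam)) := rfl

/-- The definition of `f*_λ` is made for this: by duality of the bases, it represents the form `T_w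
↦ f_{w,λ}` under the trace. -/
theorem heckeCoeff_one_geckRouquier_mul {n : ℕ} (lam : n.Partition) (h : Hecke n) :
    heckeCoeff 1 (geckRouquier lam * h) = classForm lam h := by
  have : heckeCoeff 1 ∘ₗ LinearMap.mulLeft Cv (geckRouquier lam) = classForm lam := by
    refine hecke_hom_ext fun y => ?_
    rw [LinearMap.comp_apply, LinearMap.mulLeft_apply, heckeCoeff_one_mul_heckeT,
      heckeCoeff_geckRouquier, inv_inv, permLength_inv, classForm_heckeT, ← mul_assoc,
      mul_inv_cancel₀ (pow_ne_zero _ v_ne_zero), one_mul]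
  exact LinearMap.congr_fun this h

/-- The represented form vanishes on commutators, and the trace is symmetric and nondegenerate. -/
theorem geckRouquier_mem_center {n : ℕ} (lam : n.Partition) :
    geckRouquier lam ∈ Subalgebra.center Cv (Hecke n) := by
  rw [Subalgebra.mem_center_iff]
  intro a
  refine eq_of_heckeCoeff_one_mul fun y => ?_
  rw [mul_assoc, heckeCoeff_one_mul_comm, mul_assoc, mul_assoc, heckeCoeff_one_geckRouquier_mul,
    heckeCoeff_one_geckRouquier_mul, ← sub_eq_zero, ← map_sub]
  exact classForm_eq_zero (sub_mem_commutators _ _) lam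

/-- For central `z` the form `h ↦ τ(z h)`, with `τ` the trace, vanishes on commutators. It is thus
determined by its values at the `T_{w_λ}`, which are the coordinates of `z`. -/
theorem eq_sum_geckRouquier {n : ℕ} {z : Hecke n} (hz : z ∈ Subalgebra.center Cv (Hecke n)) :
    z = ∑ lam, centerCoord lam z • geckRouquier lam := by
  rw [Subalgebra.mem_center_iff] at hz
  refine eq_of_heckeCoeff_one_mul fun y => ?_
  have key : ∀ h ∈ commutators n, heckeCoeff 1 (z * h) = 0 := by
    intro h hh
    have : commutators n ≤ LinearMap.ker (heckeCoeff 1 ∘ₗ LinearMap.mulLeft Cv z) := by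
      rw [commutators, Submodule.span_le]
      rintro _ ⟨⟨a, b⟩, rfl⟩
      rw [SetLike.mem_coe, LinearMap.mem_ker, map_sub, sub_eq_zero]
      simp only [LinearMap.comp_apply, LinearMap.mulLeft_apply]
      rw [← mul_assoc z b a, ← hz b, mul_assoc b, heckeCoeff_one_mul_comm b, mul_assoc]
    exact this hh
  have h1 := key _ (sub_sum_classForm_mem_commutators (heckeT n y))
  rw [mul_sub, map_sub, sub_eq_zero] at h1
  rw [h1, Finset.mul_sum, Finset.sum_mul, map_sum, map_sum]
  refine Finset.sum_congr rfl fun lam _ => ?_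
  rw [mul_smul_comm, smul_mul_assoc, map_smul, map_smul, heckeCoeff_one_geckRouquier_mul,
    centerCoord_apply, smul_eq_mul, smul_eq_mul, mul_comm]

theorem centerCoord_geckRouquier {n : ℕ} (lam mu : n.Partition) :
    centerCoord lam (geckRouquier mu) = if mu = lam then 1 else 0 := by
  rw [centerCoord_apply, heckeCoeff_one_geckRouquier_mul, classForm_cyclePerm]

/-- The quantum Frobenius map. -/
def quantumFrobenius : HeckeCenters →ₗ[Cv] SymFunV :=
  DirectSum.toModule Cv ℕ SymFunV fun n =>
    (∑ lam : n.Partition, (centerCoord lam).smulRight (monomialBar lam)) ∘ₗ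
      (Subalgebra.center Cv (Hecke n)).val.toLinearMap

theorem quantumFrobenius_lof {n : ℕ} (z : Subalgebra.center Cv (Hecke n)) :
    quantumFrobenius (DirectSum.lof Cv ℕ (fun n => Subalgebra.center Cv (Hecke n)) n z) =
      ∑ lam : n.Partition, centerCoord lam (z : Hecke n) • monomialBar lam := by
  rw [quantumFrobenius, DirectSum.toModule_lof, LinearMap.comp_apply, LinearMap.sum_apply]
  rfl

theorem isQuantumFrobenius_quantumFrobenius : IsQuantumFrobenius quantumFrobenius := by
  refine fun n lam => ⟨geckRouquier_mem_center lam, ?_⟩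
  rw [quantumFrobenius_lof]
  simp only [centerCoord_geckRouquier, ite_smul, one_smul, zero_smul, Finset.sum_ite_eq,
    Finset.mem_univ, if_true]

theorem IsQuantumFrobenius.unique {Ψ Ψ' : HeckeCenters →ₗ[Cv] SymFunV}
    (h : IsQuantumFrobenius Ψ) (h' : IsQuantumFrobenius Ψ') : Ψ = Ψ' := by
  refine DirectSum.linearMap_ext _ fun n => LinearMap.ext fun z => ?_
  have hz : z = ∑ lam : n.Partition,
      centerCoord lam (z : Hecke n) • ⟨geckRouquier lam, geckRouquier_mem_center lam⟩ := by
    refine Subtype.ext ((eq_sum_geckRouquier z.2).trans ?_)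
    rw [AddSubmonoidClass.coe_finsetSum]
    rfl
  rw [hz, map_sum, map_sum]
  refine Finset.sum_congr rfl fun lam _ => ?_
  obtain ⟨_, h1⟩ := h n lam
  obtain ⟨_, h2⟩ := h' n lam
  rw [map_smul, map_smul, LinearMap.comp_apply, LinearMap.comp_apply, h1, h2]

/-! ### The centers of the group algebras -/

theorem coeff_classSum {n : ℕ} (lam : n.Partition) (w : Equiv.Perm (Fin n)) :
    (classSum lam).coeff w = if permType w = lam then 1 else 0 := by
  classical
  rw [classSum, MonoidAlgebra.coeff_sum, Finsupp.finsetSum_apply, Finset.sum_filter,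
    Finset.sum_eq_single w]
  · simp [permType_eq_iff]
  · intro u _ hu
    split_ifs
    · rw [MonoidAlgebra.of_apply, MonoidAlgebra.coeff_single, Finsupp.single_eq_of_ne hu.symm]
    · rfl
  · simp

theorem permType_mul_comm {n : ℕ} (w u : Equiv.Perm (Fin n)) :
    permType (w * u) = permType (u * w) :=
  permType_eq_permType_iff.2 (isConj_iff.2 ⟨u, by group⟩)

theorem permType_inv {n : ℕ} (w : Equiv.Perm (Fin n)) : permType w⁻¹ = permType w := by
  rw [permType_eq_permType_iff, Equiv.Perm.isConj_iff_cycleType_eq, Equiv.Perm.cycleType_inv]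

theorem classSum_mem_center {n : ℕ} (lam : n.Partition) :
    classSum lam ∈ Subalgebra.center ℂ (MonoidAlgebra ℂ (Equiv.Perm (Fin n))) := by
  rw [Subalgebra.mem_center_iff]
  intro a
  induction a using MonoidAlgebra.induction_linear with
  | zero => rw [zero_mul, mul_zero]
  | add a b ha hb => rw [add_mul, mul_add, ha, hb]
  | single u r =>
    ext w
    rw [MonoidAlgebra.coeff_single_mul_apply, MonoidAlgebra.coeff_mul_single_apply,
      coeff_classSum, coeff_classSum, permType_mul_comm, mul_comm]

theorem coeff_eq_of_permType_eq {n : ℕ} {c : MonoidAlgebra ℂ (Equiv.Perm (Fin n))}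
    (hc : c ∈ Subalgebra.center ℂ (MonoidAlgebra ℂ (Equiv.Perm (Fin n))))
    {w u : Equiv.Perm (Fin n)} (h : permType w = permType u) : c.coeff w = c.coeff u := by
  obtain ⟨g, rfl⟩ := isConj_iff.1 (permType_eq_permType_iff.1 h)
  have := congrArg (fun x => x.coeff (g * w))
    ((Subalgebra.mem_center_iff.1 hc) (MonoidAlgebra.single g 1))
  simpa [MonoidAlgebra.coeff_single_mul_apply, MonoidAlgebra.coeff_mul_single_apply] using this

theorem eq_sum_classSum {n : ℕ} {c : MonoidAlgebra ℂ (Equiv.Perm (Fin n))}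
    (hc : c ∈ Subalgebra.center ℂ (MonoidAlgebra ℂ (Equiv.Perm (Fin n)))) :
    c = ∑ lam : n.Partition, c.coeff (cyclePerm lam) • classSum lam := by
  ext w
  rw [MonoidAlgebra.coeff_sum, Finsupp.finsetSum_apply]
  simp only [MonoidAlgebra.coeff_smul_apply, coeff_classSum, smul_eq_mul, mul_ite, mul_one,
    mul_zero, Finset.sum_ite_eq, Finset.mem_univ, if_true]
  exact coeff_eq_of_permType_eq hc (permType_cyclePerm _).symm

/-- The coefficient of `w` in an element of the group algebra. -/
def groupCoeff {n : ℕ} (w : Equiv.Perm (Fin n)) :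
    MonoidAlgebra ℂ (Equiv.Perm (Fin n)) →ₗ[ℂ] ℂ where
  toFun c := c.coeff w
  map_add' _ _ := rfl
  map_smul' _ _ := rfl

/-- The classical Frobenius map. -/
def classicalFrobenius : GroupCenters →ₗ[ℂ] SymFun :=
  DirectSum.toModule ℂ ℕ SymFun fun n =>
    (∑ lam : n.Partition,
      (groupCoeff (cyclePerm lam)).smulRight ((zNum lam : ℂ)⁻¹ • powerSumPart lam)) ∘ₗ
      (Subalgebra.center ℂ (MonoidAlgebra ℂ (Equiv.Perm (Fin n)))).val.toLinearMap

theorem classicalFrobenius_lof {n : ℕ}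
    (c : Subalgebra.center ℂ (MonoidAlgebra ℂ (Equiv.Perm (Fin n)))) :
    classicalFrobenius (DirectSum.lof ℂ ℕ
      (fun n => Subalgebra.center ℂ (MonoidAlgebra ℂ (Equiv.Perm (Fin n)))) n c) =
      ∑ lam : n.Partition, (c : MonoidAlgebra ℂ (Equiv.Perm (Fin n))).coeff (cyclePerm lam) •
        (zNum lam : ℂ)⁻¹ • powerSumPart lam := by
  rw [classicalFrobenius, DirectSum.toModule_lof, LinearMap.comp_apply, LinearMap.sum_apply]
  rfl

theorem isClassicalFrobenius_classicalFrobenius : IsClassicalFrobenius classicalFrobenius := by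
  refine fun n lam => ⟨classSum_mem_center lam, ?_⟩
  rw [classicalFrobenius_lof]
  simp only [coeff_classSum, permType_cyclePerm, ite_smul, one_smul, zero_smul,
    Finset.sum_ite_eq', Finset.mem_univ, if_true]

theorem IsClassicalFrobenius.unique {ψ ψ' : GroupCenters →ₗ[ℂ] SymFun}
    (h : IsClassicalFrobenius ψ) (h' : IsClassicalFrobenius ψ') : ψ = ψ' := by
  refine DirectSum.linearMap_ext _ fun n => LinearMap.ext fun c => ?_
  have hc : c = ∑ lam : n.Partition,
      (c : MonoidAlgebra ℂ (Equiv.Perm (Fin n))).coeff (cyclePerm lam) •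
        ⟨classSum lam, classSum_mem_center lam⟩ := by
    refine Subtype.ext ((eq_sum_classSum c.2).trans ?_)
    rw [AddSubmonoidClass.coe_finsetSum]
    rfl
  rw [hc, map_sum, map_sum]
  refine Finset.sum_congr rfl fun lam _ => ?_
  obtain ⟨_, h1⟩ := h n lam
  obtain ⟨_, h2⟩ := h' n lam
  rw [map_smul, map_smul, LinearMap.comp_apply, LinearMap.comp_apply, h1, h2]

/-! ### Specialization of the centers -/

/-- The `T_w` are a basis, so there is no freedom in the coefficients. This makes the specialization
unique. -/
theorem heckeSpecializes_iff {n : ℕ} {h : Hecke n} {c : MonoidAlgebra ℂ (Equiv.Perm (Fin n))} :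
    HeckeSpecializes h c ↔ ∀ w, HasValue (heckeCoeff w h) (c.coeff w) := by
  constructor
  · rintro ⟨a, ha, rfl, rfl⟩ w
    rw [heckeCoeff_sum, MonoidAlgebra.coeff_sum, Finsupp.finsetSum_apply,
      Finset.sum_eq_single w]
    · simpa using (ha w).hasValue
    · intro u _ hu
      simp [Finsupp.single_eq_of_ne hu.symm]
    · simp
  · intro hw
    refine ⟨fun w => heckeCoeff w h, fun w => (hw w).1, (sum_heckeCoeff h).symm, ?_⟩
    ext w
    rw [MonoidAlgebra.coeff_sum, Finsupp.finsetSum_apply, Finset.sum_eq_single w]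
    · simp [(hw w).2]
    · intro u _ hu
      simp [Finsupp.single_eq_of_ne hu.symm]
    · simp

theorem HeckeRegular.regularAtOne_heckeCoeff {n : ℕ} {h : Hecke n} (hh : HeckeRegular h)
    (w : Equiv.Perm (Fin n)) : RegularAtOne (heckeCoeff w h) := by
  obtain ⟨a, ha, rfl⟩ := hh
  rw [heckeCoeff_sum]
  exact ha w

theorem HeckeSpecializes.unique {n : ℕ} {h : Hecke n} {c d : MonoidAlgebra ℂ (Equiv.Perm (Fin n))}
    (hc : HeckeSpecializes h c) (hd : HeckeSpecializes h d) : c = d := by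
  ext w
  exact (heckeSpecializes_iff.1 hc w).unique (heckeSpecializes_iff.1 hd w)

/-- At `v = 1` the coefficient of `T_w` becomes the indicator of the type of `w⁻¹`, which is the
type of `w`. -/
theorem heckeSpecializes_geckRouquier {n : ℕ} (lam : n.Partition) :
    HeckeSpecializes (geckRouquier lam) (classSum lam) := by
  refine heckeSpecializes_iff.2 fun w => ?_
  have h1 := (hasValue_v.pow (permLength n w)).inv (by simp)
  have h2 := h1.mul ((isClassPolynomialFamily_classPolynomial n).hasValue w⁻¹ lam)
  rw [← heckeCoeff_geckRouquier, permType_inv, one_pow, inv_one, one_mul] at h2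
  rwa [coeff_classSum]

theorem heckeSpecializes_sum_geckRouquier {n : ℕ} {a : n.Partition → Cv} {x : n.Partition → ℂ}
    (h : ∀ lam, HasValue (a lam) (x lam)) :
    HeckeSpecializes (∑ lam, a lam • geckRouquier lam) (∑ lam, x lam • classSum lam) := by
  refine heckeSpecializes_iff.2 fun w => ?_
  rw [map_sum, MonoidAlgebra.coeff_sum, Finsupp.finsetSum_apply]
  refine HasValue.sum fun lam _ => ?_
  rw [map_smul, smul_eq_mul, MonoidAlgebra.coeff_smul_apply, smul_eq_mul]
  exact (h lam).mul (heckeSpecializes_iff.1 (heckeSpecializes_geckRouquier lam) w)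

/-- A coordinate with respect to the `f*_λ` is a power of `v` times a coefficient in the basis
`T_w`, so regularity passes from coefficients to coordinates. -/
theorem centerCoord_eq {n : ℕ} (lam : n.Partition) (h : Hecke n) :
    centerCoord lam h = v ^ permLength n (cyclePerm lam) * heckeCoeff (cyclePerm lam)⁻¹ h :=
  heckeCoeff_one_mul_heckeT h _

theorem HeckeRegular.regularAtOne_centerCoord {n : ℕ} {h : Hecke n} (hh : HeckeRegular h)
    (lam : n.Partition) : RegularAtOne (centerCoord lam h) := by
  rw [centerCoord_eq]
  exact ((hasValue_v.pow _).mul (hh.regularAtOne_heckeCoeff _).hasValue).1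

theorem HeckeSpecializes.hasValue_centerCoord {n : ℕ} {h : Hecke n}
    {c : MonoidAlgebra ℂ (Equiv.Perm (Fin n))} (hs : HeckeSpecializes h c)
    (hc : c ∈ Subalgebra.center ℂ (MonoidAlgebra ℂ (Equiv.Perm (Fin n)))) (lam : n.Partition) :
    HasValue (centerCoord lam h) (c.coeff (cyclePerm lam)) := by
  rw [centerCoord_eq, ← coeff_eq_of_permType_eq hc (permType_inv (cyclePerm lam))]
  simpa using (hasValue_v.pow (permLength n (cyclePerm lam))).mul
    (heckeSpecializes_iff.1 hs (cyclePerm lam)⁻¹)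

/-- The values at `v = 1` of the coordinates of a central element. -/
def specialCenter {n : ℕ} (z : Subalgebra.center Cv (Hecke n)) :
    Subalgebra.center ℂ (MonoidAlgebra ℂ (Equiv.Perm (Fin n))) :=
  ⟨∑ lam : n.Partition, valueAtOne (centerCoord lam (z : Hecke n)) • classSum lam,
    Subalgebra.sum_mem _ fun lam _ => Subalgebra.smul_mem _ (classSum_mem_center lam) _⟩

theorem specialCenter_zero {n : ℕ} : specialCenter (0 : Subalgebra.center Cv (Hecke n)) = 0 := by
  have h (lam : n.Partition) :
      valueAtOne (centerCoord lam ((0 : Subalgebra.center Cv (Hecke n)) : Hecke n)) •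
        classSum lam = 0 := by
    rw [ZeroMemClass.coe_zero, map_zero, hasValue_zero.2, zero_smul]
  exact Subtype.ext (Fintype.sum_eq_zero _ h)

/-- The central element with the same coordinates as a given element of the center of the group
algebra. -/
def liftCenter {n : ℕ} (c : Subalgebra.center ℂ (MonoidAlgebra ℂ (Equiv.Perm (Fin n)))) :
    Subalgebra.center Cv (Hecke n) :=
  ⟨∑ lam : n.Partition, algebraMap ℂ Cv
      ((c : MonoidAlgebra ℂ (Equiv.Perm (Fin n))).coeff (cyclePerm lam)) • geckRouquier lam,
    Subalgebra.sum_mem _ fun lam _ => Subalgebra.smul_mem _ (geckRouquier_mem_center lam) _⟩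

theorem liftCenter_zero {n : ℕ} :
    liftCenter (0 : Subalgebra.center ℂ (MonoidAlgebra ℂ (Equiv.Perm (Fin n)))) = 0 := by
  have h (lam : n.Partition) : algebraMap ℂ Cv
      (((0 : Subalgebra.center ℂ (MonoidAlgebra ℂ (Equiv.Perm (Fin n)))) :
        MonoidAlgebra ℂ (Equiv.Perm (Fin n))).coeff (cyclePerm lam)) • geckRouquier lam = 0 := by
    rw [ZeroMemClass.coe_zero, MonoidAlgebra.coeff_zero, Finsupp.zero_apply, map_zero, zero_smul]
  exact Subtype.ext (Fintype.sum_eq_zero _ h)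

theorem existsUnique_centerSpecializes (z : HeckeCenters)
    (hz : ∀ n, HeckeRegular (z n : Hecke n)) : ∃! c : GroupCenters, CenterSpecializes z c := by
  refine ⟨DFinsupp.mapRange (fun _ => specialCenter) (fun _ => specialCenter_zero) z,
    fun n => ?_, fun c hc => ?_⟩
  · have h := heckeSpecializes_sum_geckRouquier
      fun lam => ((hz n).regularAtOne_centerCoord lam).hasValue
    rw [← eq_sum_geckRouquier (z n).2] at h
    exact h
  · refine DFinsupp.ext fun n => Subtype.ext ((hc n).unique ?_)
    have h := heckeSpecializes_sum_geckRouquier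
      fun lam => ((hz n).regularAtOne_centerCoord lam).hasValue
    rw [← eq_sum_geckRouquier (z n).2] at h
    exact h

theorem exists_centerSpecializes (c : GroupCenters) :
    ∃ z : HeckeCenters, CenterSpecializes z c := by
  refine ⟨DFinsupp.mapRange (fun _ => liftCenter) (fun _ => liftCenter_zero) c, fun n => ?_⟩
  rw [eq_sum_classSum (c n).2]
  exact heckeSpecializes_sum_geckRouquier fun lam => hasValue_C _

/-! ### Specialization of symmetric functions -/

theorem symSpecializes_sum_tmul {ι : Type*} [Fintype ι] {a : ι → Cv} {x : ι → ℂ} (f : ι → SymFun)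
    (h : ∀ i, HasValue (a i) (x i)) : SymSpecializes (∑ i, a i ⊗ₜ f i) (∑ i, x i • f i) := by
  refine ⟨Fintype.card ι, fun i => a ((Fintype.equivFin ι).symm i),
    fun i => f ((Fintype.equivFin ι).symm i), fun i => (h _).1, ?_, ?_⟩
  · exact (Equiv.sum_comp (Fintype.equivFin ι).symm fun i => a i ⊗ₜ[ℂ] f i).symm
  · rw [Equiv.sum_comp (Fintype.equivFin ι).symm fun i => valueAtOne (a i) • f i]
    exact Finset.sum_congr rfl fun i _ => by rw [(h i).2]

theorem SymSpecializes.add {F G : SymFunV} {f g : SymFun} (hF : SymSpecializes F f)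
    (hG : SymSpecializes G g) : SymSpecializes (F + G) (f + g) := by
  obtain ⟨k, a, f, ha, rfl, rfl⟩ := hF
  obtain ⟨l, b, g, hb, rfl, rfl⟩ := hG
  have := symSpecializes_sum_tmul (a := Sum.elim a b)
    (x := Sum.elim (fun i => valueAtOne (a i)) fun i => valueAtOne (b i)) (Sum.elim f g)
    (by rintro (i | i); exacts [(ha i).hasValue, (hb i).hasValue])
  simpa only [Fintype.sum_sum_type, Sum.elim_inl, Sum.elim_inr] using this

theorem symSpecializes_zero : SymSpecializes 0 0 := ⟨0, 0, 0, fun i => i.elim0, by simp, by simp⟩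

theorem SymSpecializes.smul {F : SymFunV} {f : SymFun} (hF : SymSpecializes F f) {b : Cv} {y : ℂ}
    (hb : HasValue b y) : SymSpecializes (b • F) (y • f) := by
  obtain ⟨k, a, f, ha, rfl, rfl⟩ := hF
  have := symSpecializes_sum_tmul f fun i => hb.mul (ha i).hasValue
  simpa only [Finset.smul_sum, TensorProduct.smul_tmul', smul_eq_mul, smul_smul] using this

theorem SymSpecializes.sum {ι : Type*} {s : Finset ι} {F : ι → SymFunV} {f : ι → SymFun}
    (h : ∀ i ∈ s, SymSpecializes (F i) (f i)) :
    SymSpecializes (∑ i ∈ s, F i) (∑ i ∈ s, f i) := by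
  classical
  induction s using Finset.induction_on with
  | empty => simpa using symSpecializes_zero
  | insert i s hi ih =>
    rw [Finset.sum_insert hi, Finset.sum_insert hi]
    exact (h i (Finset.mem_insert_self _ _)).add
      (ih fun j hj => h j (Finset.mem_insert_of_mem hj))

theorem symSpecializes_one_tmul (f : SymFun) : SymSpecializes (1 ⊗ₜ f) f := by
  have := symSpecializes_sum_tmul (ι := Unit) (fun _ => f) fun _ => hasValue_one
  simpa using this

/-- The coefficient of a monomial in a symmetric function over `ℂ(v)`. -/
def symCoeff (m : ℕ →₀ ℕ) : SymFunV →ₗ[ℂ] Cv :=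
  LinearMap.mul' ℂ Cv ∘ₗ TensorProduct.map LinearMap.id
    (Algebra.linearMap ℂ Cv ∘ₗ MvPowerSeries.coeff m ∘ₗ SymFun.val.toLinearMap)

theorem SymSpecializes.hasValue_symCoeff {F : SymFunV} {f : SymFun} (h : SymSpecializes F f)
    (m : ℕ →₀ ℕ) : HasValue (symCoeff m F) (MvPowerSeries.coeff m (f : MvPowerSeries ℕ ℂ)) := by
  obtain ⟨k, a, f, ha, rfl, rfl⟩ := h
  rw [map_sum, AddSubmonoidClass.coe_finsetSum, map_sum]
  refine HasValue.sum fun i _ => ?_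
  exact (ha i).hasValue.mul (hasValue_C _)

/-- A decomposition into tensors is not unique, but the coefficient of each monomial is, and its
value at `v = 1` does not depend on the decomposition. -/
theorem SymSpecializes.unique {F : SymFunV} {f g : SymFun} (hf : SymSpecializes F f)
    (hg : SymSpecializes F g) : f = g := by
  refine Subtype.ext (MvPowerSeries.ext fun m => ?_)
  exact (hf.hasValue_symCoeff m).unique (hg.hasValue_symCoeff m)

theorem v_sub_one_ne_zero : v - 1 ≠ 0 := by
  intro h
  have h1 : algebraMap (Polynomial ℂ) Cv (Polynomial.X - Polynomial.C 1) = 0 := by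
    simpa [v] using h
  exact Polynomial.X_sub_C_ne_zero (1 : ℂ)
    (RatFunc.algebraMap_injective ℂ (h1.trans (map_zero _).symm))

/-- The quotient `(v^k - 1)/(v - 1)` is the geometric sum `1 + v + ⋯ + v^{k-1}`, with value `k`. -/
theorem hasValue_sub_one_mul_inv {k : ℕ} (hk : 0 < k) :
    HasValue ((v - 1) * (v ^ k - 1)⁻¹) (k : ℂ)⁻¹ := by
  have h : (v - 1) * (v ^ k - 1)⁻¹ = (∑ i ∈ Finset.range k, v ^ i)⁻¹ := by
    rw [← mul_geom_sum, mul_inv, mul_inv_cancel_left₀ v_sub_one_ne_zero]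
  rw [h]
  have h1 : HasValue (∑ i ∈ Finset.range k, v ^ i) (∑ i ∈ Finset.range k, 1 ^ i) :=
    HasValue.sum fun i _ => hasValue_v.pow i
  have h2 : (∑ i ∈ Finset.range k, (1 : ℂ) ^ i) = k := by simp
  rw [h2] at h1
  exact h1.inv (Nat.cast_ne_zero.2 hk.ne')

theorem hasValue_prod_inv {s : Multiset ℕ} (hs : ∀ k ∈ s, 0 < k) :
    HasValue ((v - 1) ^ Multiset.card s * (s.map fun k => (v ^ k - 1)⁻¹).prod)
      ((s.prod : ℕ) : ℂ)⁻¹ := by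
  induction s using Multiset.induction_on with
  | empty => simpa using hasValue_one
  | cons k s ih =>
    have h := (hasValue_sub_one_mul_inv (hs k (by simp))).mul (ih fun l hl => hs l (by simp [hl]))
    rw [Multiset.card_cons, Multiset.map_cons, Multiset.prod_cons, Multiset.prod_cons, pow_succ',
      mul_mul_mul_comm, Nat.cast_mul, mul_inv]
    exact h

theorem map_one_tmul_powerProd {D : SymFunV →ₐ[Cv] SymFunV}
    (hD : ∀ k : ℕ+, D (powerSumV k) = (v ^ (k : ℕ) - 1)⁻¹ • powerSumV k) {s : Multiset ℕ}
    (hs : ∀ k ∈ s, 0 < k) :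
    D (1 ⊗ₜ powerProd s) = (s.map fun k => (v ^ k - 1)⁻¹).prod • (1 ⊗ₜ powerProd s) := by
  induction s using Multiset.induction_on with
  | empty =>
    have : (1 ⊗ₜ powerProd 0 : SymFunV) = 1 := by simp [powerProd, Algebra.TensorProduct.one_def]
    rw [this, map_one]; simp
  | cons k s ih =>
    obtain ⟨k, rfl⟩ : ∃ j : ℕ+, (j : ℕ) = k := ⟨⟨k, hs k (by simp)⟩, rfl⟩
    have h1 : (1 ⊗ₜ powerProd (k ::ₘ s) : SymFunV) = powerSumV k * (1 ⊗ₜ powerProd s) := by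
      rw [powerSumV, Algebra.TensorProduct.tmul_mul_tmul, mul_one, powerProd, Multiset.map_cons,
        Multiset.prod_cons]
      rfl
    rw [h1, map_mul, hD, ih fun l hl => hs l (by simp [hl]), Multiset.map_cons,
      Multiset.prod_cons, smul_mul_smul_comm]

theorem zNum_eq {n : ℕ} (lam : n.Partition) :
    zNum lam = lam.parts.prod * multFactorial lam.parts := by
  rw [zNum, Finset.prod_mul_distrib, Finset.prod_multiset_count, multFactorial]

/-- Only the leading term of `m_λ` in the power sums survives at `v = 1`; its factor `1/∏ m_i!`
combines with the `1/∏ λ_i` from the substitution to `1/z_λ`. -/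
theorem symSpecializes_monomialBar {n : ℕ} (lam : n.Partition) :
    SymSpecializes (monomialBar lam) ((zNum lam : ℂ)⁻¹ • powerSumPart lam) := by
  obtain ⟨D, hsub, hD⟩ := exists_substDiv_algHom
  -- The power of `0` records the spare factors `v - 1`: it is `1` when `mu` has as many parts as
  -- `lam` and `0` when it has fewer.
  have hpow : ∀ mu : n.Partition, partLength mu ≤ partLength lam →
      SymSpecializes ((v - 1) ^ partLength lam • D (1 ⊗ₜ powerSumPart mu))
        ((0 ^ (partLength lam - partLength mu) * ((mu.parts.prod : ℕ) : ℂ)⁻¹) •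
          powerSumPart mu) := by
    intro mu hmu
    rw [powerSumPart_eq, map_one_tmul_powerProd hD fun k hk => mu.parts_pos hk, smul_smul]
    refine (symSpecializes_one_tmul _).smul ?_
    have h1 := ((hasValue_v.sub hasValue_one).pow (partLength lam - partLength mu)).mul
      (hasValue_prod_inv fun k hk => mu.parts_pos hk)
    rw [← mul_assoc, sub_self, ← partLength, ← pow_add, Nat.sub_add_cancel hmu] at h1
    exact h1
  have hlow : ∀ f ∈ Submodule.span ℂ
      (powerSumPart '' {mu : n.Partition | partLength mu < partLength lam}),
      SymSpecializes ((v - 1) ^ partLength lam • D (1 ⊗ₜ f)) 0 := by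
    intro f hf
    induction hf using Submodule.span_induction with
    | mem f hf =>
      obtain ⟨mu, hmu, rfl⟩ := hf
      have := hpow mu (le_of_lt hmu)
      rwa [zero_pow (Nat.sub_pos_of_lt hmu).ne', zero_mul, zero_smul] at this
    | zero => rw [TensorProduct.tmul_zero, map_zero, smul_zero]; exact symSpecializes_zero
    | add f g _ _ hf hg =>
      rw [TensorProduct.tmul_add, map_add, smul_add]
      simpa using hf.add hg
    | smul c f _ hf =>
      have e : (1 ⊗ₜ (c • f) : SymFunV) = algebraMap ℂ Cv c • (1 ⊗ₜ f) := by
        rw [TensorProduct.tmul_smul, algebraMap_smul]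
      rw [e, map_smul, smul_comm]
      simpa using hf.smul (hasValue_C c)
  have h1 := hlow _ (monomialSym_sub_mem_span lam)
  have h2 := (hpow lam le_rfl).smul (hasValue_C (multFactorial lam.parts : ℂ)⁻¹)
  have h3 := h1.add h2
  rw [Nat.sub_self, pow_zero, one_mul, zero_add,
    smul_smul (multFactorial lam.parts : ℂ)⁻¹, ← mul_inv, mul_comm, ← Nat.cast_mul,
    ← zNum_eq] at h3
  convert h3 using 1
  have e : (1 ⊗ₜ monomialSym lam : SymFunV) =
      1 ⊗ₜ (monomialSym lam - (multFactorial lam.parts : ℂ)⁻¹ • powerSumPart lam) +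
        algebraMap ℂ Cv (multFactorial lam.parts : ℂ)⁻¹ • (1 ⊗ₜ powerSumPart lam) := by
    rw [algebraMap_smul, ← TensorProduct.tmul_smul, ← TensorProduct.tmul_add, sub_add_cancel]
  rw [monomialBar, hsub, e, map_add, map_smul, smul_add, smul_comm ((v - 1) ^ partLength lam)]

/-! ### The specialization of the Frobenius map -/

theorem eq_sum_lof {R : Type*} [Semiring R] {M : ℕ → Type*} [∀ n, AddCommMonoid (M n)]
    [∀ n, Module R (M n)] (x : DirectSum ℕ M) {s : Finset ℕ} (hs : ∀ n ∉ s, x n = 0) :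
    x = ∑ n ∈ s, DirectSum.lof R ℕ M n (x n) := by
  classical
  refine DFinsupp.ext fun k => ?_
  rw [DFinsupp.finsetSum_apply]
  by_cases hk : k ∈ s
  · rw [Finset.sum_eq_single_of_mem k hk]
    · exact (DirectSum.of_eq_same k (x k)).symm
    · intro j _ hj
      exact DirectSum.of_eq_of_ne _ _ _ hj.symm
  · rw [hs k hk, Finset.sum_eq_zero]
    intro j hj
    exact DirectSum.of_eq_of_ne _ _ _ (by rintro rfl; exact hk hj)

theorem CenterSpecializes.symSpecializes {z : HeckeCenters} {c : GroupCenters}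
    (h : CenterSpecializes z c) : SymSpecializes (quantumFrobenius z) (classicalFrobenius c) := by
  classical
  obtain ⟨s, hz, hc⟩ : ∃ s : Finset ℕ, (∀ n ∉ s, z n = 0) ∧ ∀ n ∉ s, c n = 0 :=
    ⟨DFinsupp.support z ∪ DFinsupp.support c,
      fun n hn => DFinsupp.notMem_support_iff.1 fun h => hn (Finset.mem_union_left _ h),
      fun n hn => DFinsupp.notMem_support_iff.1 fun h => hn (Finset.mem_union_right _ h)⟩
  rw [eq_sum_lof (R := Cv) z hz, eq_sum_lof (R := ℂ) c hc, map_sum, map_sum]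
  refine SymSpecializes.sum fun n _ => ?_
  rw [quantumFrobenius_lof, classicalFrobenius_lof]
  exact SymSpecializes.sum fun lam _ =>
    (symSpecializes_monomialBar lam).smul ((h n).hasValue_centerCoord (c n).2 lam)

end HeckeFrobenius

end

theorem proposition4p5 :
    -- every symmetric function is a polynomial in the power sums in exactly one way
    (∀ F : SymFunV, ∃! P : MvPolynomial ℕ+ Cv, MvPolynomial.aeval powerSumV P = F) ∧
    -- the class polynomials exist and are unique
    (∀ n : ℕ, ∃! f : Equiv.Perm (Fin n) → n.Partition → Cv, IsClassPolynomialFamily n f) ∧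
    -- the quantum and the classical Frobenius map exist and are unique; their specializations:
    ∃ (Ψ : HeckeCenters →ₗ[Cv] SymFunV) (ψ : GroupCenters →ₗ[ℂ] SymFun),
      (IsQuantumFrobenius Ψ ∧ ∀ Ψ', IsQuantumFrobenius Ψ' → Ψ' = Ψ) ∧
      (IsClassicalFrobenius ψ ∧ ∀ ψ', IsClassicalFrobenius ψ' → ψ' = ψ) ∧
      -- specialization at `v = 1` is a well-defined map from the elements of the centers that are
      -- regular at `v = 1` onto the centers of the group algebras
      (∀ z : HeckeCenters, (∀ n, HeckeRegular (z n : Hecke n)) →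
        ∃! c : GroupCenters, CenterSpecializes z c) ∧
      (∀ c : GroupCenters, ∃ z : HeckeCenters, CenterSpecializes z c) ∧
      -- `f*_lam` specializes to `c_lam`
      (∀ (n : ℕ) (lam : n.Partition), HeckeSpecializes (geckRouquier lam) (classSum lam)) ∧
      -- the specialization of `Ψ` is `ψ`
      (∀ (z : HeckeCenters) (c : GroupCenters), CenterSpecializes z c →
        ∀ g : SymFun, SymSpecializes (Ψ z) g ↔ g = ψ c) := by
  refine ⟨fun F => ?_, fun n => ?_, quantumFrobenius, classicalFrobenius,
    ⟨isQuantumFrobenius_quantumFrobenius, fun _ h => h.unique isQuantumFrobenius_quantumFrobenius⟩,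
    ⟨isClassicalFrobenius_classicalFrobenius,
      fun _ h => h.unique isClassicalFrobenius_classicalFrobenius⟩,
    existsUnique_centerSpecializes, exists_centerSpecializes,
    fun _ => heckeSpecializes_geckRouquier, fun z c h g => ⟨fun hg => hg.unique h.symSpecializes, ?_⟩⟩
  · exact aeval_powerSumV_bijective.existsUnique F
  · obtain ⟨f, hf⟩ := exists_isClassPolynomialFamily n
    exact ⟨f, hf, fun g hg => isClassPolynomialFamily_unique hg hf⟩
  · rintro rfl
    exact h.symSpecializes
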